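/- **Setting.** Let $G=(V,E)$ be a directed graph with $n$ nodes, $\mathcal I(v)$ and $\mathcal O(v)$ the sets of in- and out-neighbours of $v$, $d_{in}(v)=|\mathcal I(v)|$, let $c\in(0,1)$, and let $s$ be SimRank: $s(u,u)=1$ and, for $u\ne v$, $s(u,v)=\frac{c}{|\mathcal I(u)||\mathcal I(v)|}\sum_{u'\in\mathcal I(u)}\sum_{v'\in\mathcal I(v)}s(u',v')$ (which is $0$ if $\mathcal I(u)$ or $\mathcal I(v)$ is empty). A *$\sqrt c$-walk* from $u$ starts at $u$ and at each step terminates at the current node with probability $1-\sqrt c$, and otherwise proceeds to a uniformly random in-neighbour (if there is none, the walk is lost and terminates nowhere). Two walks from the same node *meet* if for some $k\ge 1$ they visit the same node at step $k$. The reverse PageRank $\pi(w)$ is the probability that a $\sqrt c$-walk from a uniformly random node terminates at $w$. **Algorithm PRSim.** Parameters: $\varepsilon>0$, $\delta\in(0,1)$, $j_0$. Put $c_1=\frac{12}{(1-\sqrt c)^2}$ and $r_{max}=\varepsilon/c_1$, and let $d_r\ge c_1/\varepsilon^2$ and $f_r\ge 3\ln(n/\delta)$ be integers, $n_r=d_rf_r$.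 *Index.* Let $H$ be a set of $j_0$ nodes with the largest reverse PageRanks. For each $w\in H$ start with $r_0(w,w)=1$ and all other residues and all reserves $\psi_\ell(v,w)$ equal to $0$. For $\ell=0,1,2,\dots$, for each $v$ with $r_\ell(v,w)>r_{max}$, add $\sqrt c\,r_\ell(v,w)/d_{in}(z)$ to $r_{\ell+1}(z,w)$ for each $z\in\mathcal O(v)$ and set $\psi_\ell(v,w)=(1-\sqrt c)\,r_\ell(v,w)$; then store the list $L_\ell(w)$ of all $(v,\psi_\ell(v,w))$ with $\psi_\ell(v,w)>r_{max}$. *Variance Bounded Backward Walk* from $w$ to level $\ell$. Start with $\hat\pi_0(w,w)=1-\sqrt c$ and all other values $0$. For $i=0,\dots,\ell-1$ and each $x$ with $\hat\pi_i(x,w)\neq0$, draw $r_0,r$ uniformly from $(0,1)$; if $r_0<\sqrt c$, add to $\hat\pi_{i+1}(y,w)$, for each $y\in\mathcal O(x)$, the amount $\hat\pi_i(x,w)/d_{in}(y)$ if $d_{in}(y)\le\frac{\hat\pi_i(x,w)}{1-\sqrt c}$, and the amount $1-\sqrt c$ if $\frac{\hat\pi_i(x,w)}{1-\sqrt c}<d_{in}(y)\le\frac{\hat\pi_i(x,w)}{r(1-\sqrt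 c)}$. Return $\hat\pi_\ell(v,w)$ for all $v$. *Query* from $u$. All estimators start at $0$, and all random choices are independent. For $i=1,\dots,f_r$ and $j=1,\dots,d_r$ sample a $\sqrt c$-walk from $u$; if it terminates, at $w$ with $\ell$ steps, sample two $\sqrt c$-walks from $w$; if these do not meet, add $1/n_r$ to $\widehat{\eta\pi}_\ell(u,w)$ and, if $w\notin H$, run a Variance Bounded Backward Walk from $w$ to level $\ell$ and add $\frac{\hat\pi_\ell(v,w)}{(1-\sqrt c)^2d_r}$ to $\hat s_B^i(u,v)$ for each $v$. Let $\hat s_B(u,v)$ be the median of $\hat s_B^1(u,v),\dots,\hat s_B^{f_r}(u,v)$, and let $\hat s_I(u,v)$ be the sum of $\frac{\widehat{\eta\pi}_\ell(u,w)\,\psi_\ell(v,w)}{(1-\sqrt c)^2}$ over all $w\in H$ and $\ell\ge0$ with $\widehat{\eta\pi}_\ell(u,w)>\varepsilon/c_1$ and $(v,\psi_\ell(v,w))\in L_\ell(w)$. Return $\hat s(u,v)=\hat s_B(u,v)+\hat s_I(u,v)$ for each $v\in V$. **Theorem.** For every directed graph $G$, every $c\in(0,1)$, $\varepsilon>0$,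 $\delta\in(0,1)$, every choice of $j_0$, $H$, $d_r$, $f_r$ as above and every query node $u\in V$, $$\Pr\bigl[\,|\hat s(u,v)-s(u,v)|\le\varepsilon\ \text{ for all } v\in V\,\bigr]\ \ge\ 1-\delta .$$ -/

import Mathlib

open MeasureTheory

noncomputable section

namespace PRSim

/-! ### Graphs and SimRank -/

section Graph

variable {V : Type*} [Fintype V]

open scoped Classical in
/-- The set `I(y)` of in-neighbours of `y`: all `x` with an edge from `x` to `y`. -/
def inNbrs (G : Digraph V) (y : V) : Finset V :=
  Finset.univ.filter fun x => G.Adj x y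

/-- The in-degree of `y`. -/
def inDeg (G : Digraph V) (y : V) : ℕ := (inNbrs G y).card

/-- `s` is the SimRank similarity of `G` with decay factor `c`, i.e. it solves the SimRank
equations. If `u ≠ v` and one of the two nodes has no in-neighbour, the double sum is empty and
`s u v = 0`. For `0 < c < 1` there is exactly one such `s`, see `existsUnique_isSimRank`. -/
def IsSimRank (G : Digraph V) (c : ℝ) (s : V → V → ℝ) : Prop :=
  (∀ u, s u u = 1) ∧
  ∀ u v, u ≠ v →
    s u v = c / ((inDeg G u : ℝ) * (inDeg G v : ℝ)) *
      ∑ u' ∈ inNbrs G u, ∑ v' ∈ inNbrs G v, s u' v'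

end Graph

/-! ### Random numbers and `√c`-walks

Every call of `rand()` is a coordinate of a random source: a family of independent random
numbers, uniformly distributed on `[0, 1]`. The randomized algorithms are deterministic functions
of the source. -/

/-- The law of a family, indexed by `ι`, of independent uniform random numbers in `[0, 1]`. -/
def randLaw (ι : Type*) : Measure (ι → unitInterval) :=
  Measure.infinitePi fun _ : ι => (volume : Measure unitInterval)

/-- The random numbers used by one `√c`-walk: at step `k`, `halt k` decides whether the walk
terminates, and `move k` selects the in-neighbour to which it proceeds otherwise. -/
inductive WalkDraw
  | halt (k : ℕ)
  | move (k : ℕ)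

section Walk

variable {V : Type*} [Fintype V]

/-- The in-neighbour of `y` selected by the random number `r`: the entry number `⌊r * d⌋` of a list
of the `d` in-neighbours, which is uniformly distributed. It is `none` if `y` has no
in-neighbour (and for `r = 1`, which has probability zero). -/
def randInNbr (G : Digraph V) (y : V) (r : unitInterval) : Option V :=
  (inNbrs G y).toList[⌊(r : ℝ) * (inDeg G y : ℝ)⌋₊]?

open scoped Classical in
/-- The node which the `√c`-walk from `u` visits at step `k`, or `none` if there is no such node.
At each step, the walk proceeds to a uniformly random in-neighbour with probability `√c` and
terminates at the current node with probability `1 - √c`. If it has to proceed from a node without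
in-neighbours, it is lost: it visits no further node and terminates nowhere. -/
def walkAt (G : Digraph V) (c : ℝ) (u : V) (r : WalkDraw → unitInterval) : ℕ → Option V
  | 0 => some u
  | k + 1 =>
    if (r (.halt k) : ℝ) < Real.sqrt c then
      (walkAt G c u r k).bind fun x => randInNbr G x (r (.move k))
    else none

/-- The `√c`-walk from `u` terminates at `w` with exactly `l` steps. -/
def TerminatesAt (G : Digraph V) (c : ℝ) (u : V) (r : WalkDraw → unitInterval)
    (w : V) (l : ℕ) : Prop :=
  walkAt G c u r l = some w ∧ Real.sqrt c ≤ (r (.halt l) : ℝ)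

/-- Two `√c`-walks from `w` meet, i.e. for some `k ≥ 1` they visit the same node at step `k`. -/
def Meet (G : Digraph V) (c : ℝ) (w : V) (r₁ r₂ : WalkDraw → unitInterval) : Prop :=
  ∃ k : ℕ, 1 ≤ k ∧ ∃ x, walkAt G c w r₁ k = some x ∧ walkAt G c w r₂ k = some x

/-- The reverse PageRank of `w`: the probability that a `√c`-walk from a uniformly chosen source
node terminates at `w`. -/
def reversePageRank (G : Digraph V) (c : ℝ) (w : V) : ℝ :=
  (∑ u, (randLaw WalkDraw).real {r | ∃ l, TerminatesAt G c u r w l}) / (Fintype.card V : ℝ)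

/-- `H` consists of `j₀` nodes with the largest reverse PageRank values (ties are broken
arbitrarily). These are the hub nodes, for which the index is built. -/
def IsHubSet (G : Digraph V) (c : ℝ) (j₀ : ℕ) (H : Finset V) : Prop :=
  H.card = j₀ ∧ ∀ w ∈ H, ∀ w' ∉ H, reversePageRank G c w' ≤ reversePageRank G c w

end Walk

/-! ### Preprocessing: the index -/

section Index

variable {V : Type*} [Fintype V]

/-- The constant `c₁ = 12 / (1 - √c)²`. -/
def c₁ (c : ℝ) : ℝ := 12 / (1 - Real.sqrt c) ^ 2

/-- The residue threshold `r_max = ε / c₁`. -/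
def rmax (c ε : ℝ) : ℝ := ε / c₁ c

open scoped Classical in
/-- The residue `r_l(v, w)` of the backward search from `w`, at the moment when the search reaches
level `l`. Each node `x` at level `l` with residue above `r_max` adds
`√c * r_l(x, w) / d_in(z)` to the residue at level `l + 1` of each of its out-neighbours `z`. -/
def residue (G : Digraph V) (c ε : ℝ) (w : V) : ℕ → V → ℝ
  | 0, v => if v = w then 1 else 0
  | l + 1, z =>
    ∑ x ∈ inNbrs G z,
      if rmax c ε < residue G c ε w l x then
        Real.sqrt c * residue G c ε w l x / (inDeg G z : ℝ)
      else 0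

open scoped Classical in
/-- The reserve `ψ_l(v, w)` computed by the backward search from `w`. -/
def reserve (G : Digraph V) (c ε : ℝ) (w : V) (l : ℕ) (v : V) : ℝ :=
  if rmax c ε < residue G c ε w l v then (1 - Real.sqrt c) * residue G c ε w l v else 0

/-- The tuple `(v, ψ_l(v, w))` belongs to the list `L_l(w)`. -/
def InList (G : Digraph V) (c ε : ℝ) (w : V) (l : ℕ) (v : V) : Prop :=
  rmax c ε < reserve G c ε w l v

end Index

/-! ### Variance Bounded Backward Walk -/

section BackwardWalk

variable {V : Type*} [Fintype V]

/-- The random numbers used by one backward walk: at level `i`, the node `x` draws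
`gate i x` (called `r₀` in the pseudocode) and `cut i x` (called `r`). -/
inductive BackDraw (V : Type*)
  | gate (i : ℕ) (x : V)
  | cut (i : ℕ) (x : V)

open scoped Classical in
/-- The value `π̂_l(v, w)` computed by the Variance Bounded Backward Walk from `w`. If
`r₀ < √c`, a node `x` at level `i` adds to each out-neighbour `y` at level `i + 1` the amount
`π̂_i(x, w) / d_in(y)` if `d_in(y) ≤ π̂_i(x, w) / (1 - √c)`, the amount `1 - √c` if
`π̂_i(x, w) / (1 - √c) < d_in(y) ≤ π̂_i(x, w) / (r (1 - √c))`, and nothing otherwise. Nodes with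
`π̂_i(x, w) = 0` add nothing. -/
def backEst (G : Digraph V) (c : ℝ) (w : V) (r : BackDraw V → unitInterval) : ℕ → V → ℝ
  | 0, v => if v = w then 1 - Real.sqrt c else 0
  | i + 1, y =>
    ∑ x ∈ inNbrs G y,
      if (r (.gate i x) : ℝ) < Real.sqrt c then
        if (inDeg G y : ℝ) ≤ backEst G c w r i x / (1 - Real.sqrt c) then
          backEst G c w r i x / (inDeg G y : ℝ)
        else if (inDeg G y : ℝ) ≤
            backEst G c w r i x / ((r (.cut i x) : ℝ) * (1 - Real.sqrt c)) then
          1 - Real.sqrt c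
        else 0
      else 0

end BackwardWalk

/-! ### The query algorithm -/

/-- The random numbers used by one run of the query algorithm. In round `i`, sample `j` uses three
`√c`-walks (number `0` from the query node, numbers `1` and `2` from the node where it terminates)
and one backward walk, all of them with fresh random numbers. -/
inductive Draw (V : Type*)
  | walk (i j : ℕ) (a : Fin 3) (d : WalkDraw)
  | back (i j : ℕ) (d : BackDraw V)

/-- The median of `x 0, …, x (k - 1)`: the middle value if `k` is odd, the mean of the two middle
values if `k` is even. -/
def median (k : ℕ) (x : ℕ → ℝ) : ℝ :=
  ((((Multiset.range k).map x).sort (· ≤ ·)).getD ((k - 1) / 2) 0 +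
    (((Multiset.range k).map x).sort (· ≤ ·)).getD (k / 2) 0) / 2

section Query

variable {V : Type*} [Fintype V]

/-- In round `i`, sample `j`, the walk from `u` terminates at `w` with exactly `l` steps, and then
the two walks from `w` do not meet. -/
def Hits (G : Digraph V) (c : ℝ) (u : V) (ω : Draw V → unitInterval) (i j : ℕ)
    (w : V) (l : ℕ) : Prop :=
  TerminatesAt G c u (fun d => ω (.walk i j 0 d)) w l ∧
    ¬ Meet G c w (fun d => ω (.walk i j 1 d)) (fun d => ω (.walk i j 2 d))

open scoped Classical in
/-- The pair `(w, l)` for which `Hits` holds in round `i`, sample `j` (there is at most one), or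
`none` if there is no such pair. -/
def sampled (G : Digraph V) (c : ℝ) (u : V) (ω : Draw V → unitInterval) (i j : ℕ) :
    Option (V × ℕ) :=
  if h : ∃ p : V × ℕ, Hits G c u ω i j p.1 p.2 then some h.choose else none

open scoped Classical in
/-- The estimator of `η(w) π_l(u, w)`, with `dr` samples in each of `fr` rounds: each sample that
hits `(w, l)` contributes `1 / n_r`, where `n_r = dr * fr`. -/
def etaPiEst (G : Digraph V) (c : ℝ) (u : V) (dr fr : ℕ) (ω : Draw V → unitInterval)
    (w : V) (l : ℕ) : ℝ :=
  ∑ i ∈ Finset.range fr, ∑ j ∈ Finset.range dr,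
    if sampled G c u ω i j = some (w, l) then 1 / ((dr : ℝ) * (fr : ℝ)) else 0

open scoped Classical in
/-- The estimator `ŝ_B^i(u, v)` of round `i`, with `dr` samples. -/
def roundEst (G : Digraph V) (c : ℝ) (H : Finset V) (u : V) (dr : ℕ)
    (ω : Draw V → unitInterval) (v : V) (i : ℕ) : ℝ :=
  ∑ j ∈ Finset.range dr,
    match sampled G c u ω i j with
    | none => 0
    | some (w, l) =>
      if w ∈ H then 0
      else backEst G c w (fun d => ω (.back i j d)) l v /
        ((1 - Real.sqrt c) ^ 2 * (dr : ℝ))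

open scoped Classical in
/-- The estimator `ŝ_I(u, v)` obtained from the index. Only finitely many terms of the sum over the
levels `l` are nonzero. -/
def indexEst (G : Digraph V) (c ε : ℝ) (H : Finset V) (u : V) (dr fr : ℕ)
    (ω : Draw V → unitInterval) (v : V) : ℝ :=
  ∑ w ∈ H, ∑' l : ℕ,
    if ε / c₁ c < etaPiEst G c u dr fr ω w l ∧ InList G c ε w l v then
      etaPiEst G c u dr fr ω w l * reserve G c ε w l v / (1 - Real.sqrt c) ^ 2
    else 0

/-- The answer `ŝ(u, v)` of PRSim to a single-source query from `u`, with hub nodes `H`, error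
parameter `ε`, and `dr` samples in each of `fr` rounds. -/
def answer (G : Digraph V) (c ε : ℝ) (H : Finset V) (u : V) (dr fr : ℕ)
    (ω : Draw V → unitInterval) (v : V) : ℝ :=
  median fr (roundEst G c H u dr ω v) + indexEst G c ε H u dr fr ω v

end Query

/-! ### Well-posedness -/

section WellPosed

variable {V : Type*} [Fintype V]

open scoped Classical in
/-- The SimRank equations have exactly one solution. -/
theorem existsUnique_isSimRank (G : Digraph V) (c : ℝ) (hc0 : 0 < c) (hc1 : c < 1) :
    ∃! s : V → V → ℝ, IsSimRank G c s := by
  let F : (V → V → ℝ) → (V → V → ℝ) := fun s u v =>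
    if u = v then 1 else c / ((inDeg G u : ℝ) * (inDeg G v : ℝ)) *
      ∑ u' ∈ inNbrs G u, ∑ v' ∈ inNbrs G v, s u' v'
  have hF : ∀ s, IsSimRank G c s ↔ F s = s := by
    intro s
    constructor
    · rintro ⟨h1, h2⟩
      funext u v
      by_cases h : u = v
      · subst h; simp [F, h1]
      · simp only [F, if_neg h]; exact (h2 u v h).symm
    · intro h
      refine ⟨fun u => ?_, fun u v huv => ?_⟩
      · rw [← h]; simp [F]
      · conv_lhs => rw [← h]
        simp only [F, if_neg huv]
  have hcon : ContractingWith ⟨c, hc0.le⟩ F := by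
    refine ⟨by exact_mod_cast hc1, LipschitzWith.of_dist_le_mul fun s t => ?_⟩
    change dist (F s) (F t) ≤ c * dist s t
    have hnn : 0 ≤ c * dist s t := mul_nonneg hc0.le dist_nonneg
    refine (dist_pi_le_iff hnn).2 fun u => (dist_pi_le_iff hnn).2 fun v => ?_
    by_cases h : u = v
    · simpa [F, h] using hnn
    · simp only [F, if_neg h, Real.dist_eq, ← mul_sub, abs_mul, ← Finset.sum_sub_distrib]
      have hle : |∑ u' ∈ inNbrs G u, ∑ v' ∈ inNbrs G v, (s u' v' - t u' v')|
          ≤ ((inDeg G u : ℝ) * (inDeg G v : ℝ)) * dist s t := by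
        calc |∑ u' ∈ inNbrs G u, ∑ v' ∈ inNbrs G v, (s u' v' - t u' v')|
            ≤ ∑ u' ∈ inNbrs G u, ∑ v' ∈ inNbrs G v, |s u' v' - t u' v'| :=
              (Finset.abs_sum_le_sum_abs _ _).trans
                (Finset.sum_le_sum fun _ _ => Finset.abs_sum_le_sum_abs _ _)
          _ ≤ ∑ u' ∈ inNbrs G u, ∑ v' ∈ inNbrs G v, dist s t := by
              refine Finset.sum_le_sum fun a _ => Finset.sum_le_sum fun b _ => ?_
              rw [← Real.dist_eq]
              exact (dist_le_pi_dist (s a) (t a) b).trans (dist_le_pi_dist s t a)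
          _ = _ := by simp [inDeg, mul_assoc]
      by_cases h0 : (inDeg G u : ℝ) * (inDeg G v : ℝ) = 0
      · rw [h0]; simpa using hnn
      · have hpos : 0 < (inDeg G u : ℝ) * (inDeg G v : ℝ) :=
          lt_of_le_of_ne (by positivity) (Ne.symm h0)
        rw [abs_of_nonneg (by positivity : 0 ≤ c / ((inDeg G u : ℝ) * (inDeg G v : ℝ)))]
        calc _ ≤ c / ((inDeg G u : ℝ) * (inDeg G v : ℝ)) *
              (((inDeg G u : ℝ) * (inDeg G v : ℝ)) * dist s t) :=
              mul_le_mul_of_nonneg_left hle (by positivity)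
          _ = c * dist s t := by rw [← mul_assoc, div_mul_cancel₀ _ h0]
  refine ⟨hcon.fixedPoint F, (hF _).2 hcon.fixedPoint_isFixedPt, fun t ht => ?_⟩
  exact hcon.fixedPoint_unique ((hF t).1 ht)

end WellPosed

end PRSim

end

namespace PRSim

open ProbabilityTheory
open scoped unitInterval

set_option linter.unusedSectionVars false

/-! ### The random source -/

section Source

variable {ι κ κ' J : Type*}

/-! SimRank is the probability that two independent √c-walks ever meet. Both this probability and
the SimRank equations are governed by the first steps of the two walks, and the solution is unique
(`IsSimRank.eq_meetProb`). Unrolling the recursion gives s(u,v) = (1-√c)⁻² ∑ π_l(u,w) π_l(v,w) η(w),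
summed over nodes w and levels l, where η(w) is the probability that two walks from w never meet
again (`IsSimRank.hasSum`). A sample hits (w,l) with probability π_l(u,w) η(w), so it remains to
estimate π_l(v,w). Splitting the sum by w ∉ H and w ∈ H gives s = s_B + s_I, and each sample
contributes a pair (Y, Z), at most one of which is nonzero.

For w ∉ H the backward walk is unbiased and its second moment is at most its mean
(`integral_backEst_sq_le`): nonzero values are at least 1-√c, and conditionally on one level the
second moment at the next is bounded by a convex combination of p² and p. Hence E Y = s_B and E Y² ≤
s_B/(1-√c)². For w ∈ H the search never overestimates and loses at most r_max, and the list
threshold loses another r_max, so s_I - ε/6 ≤ E Z ≤ s_I; discarding small frequencies costs ε/12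
more (`indexEst_bounds`). The index part therefore has a bias between -ε/4 and 0, which leaves 3ε/4
for downward fluctuations and ε for upward ones.

Since Y, Z ≥ 0, their lower tails are sub-Gaussian with only second moments in the exponent
(`measureReal_sum_le_sub`). The two deviations allowed downwards scale with the square roots of s_B
and s_I, and s_B + s_I ≤ 1 keeps their sum below 3ε/4. Upwards the budget is 0.78ε for Y, by a
Cantelli bound, and 0.22ε for Z, by Hoeffding's inequality. A bad median forces at least half of the
independent rounds to be bad, so both median errors decay exponentially in f_r
(`measureReal_majority_le`). For f_r ≥ 3 the four failure probabilities add up to at most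
exp(-f_r/3); for f_r ≤ 2 the median is the mean and Chebyshev's inequality for Y + Z suffices. As
f_r ≥ 3 ln(n/δ), a union bound over the n nodes finishes the proof. -/

instance : IsProbabilityMeasure (randLaw ι) := by
  unfold randLaw; infer_instance

theorem measurePreserving_reindex {f : κ → ι} (hf : Function.Injective f) :
    MeasurePreserving (fun (ω : ι → I) k => ω (f k)) (randLaw ι) (randLaw κ) :=
  ⟨by fun_prop, Measure.map_infinitePi_infinitePi_of_inj hf⟩

theorem integral_reindex {e : κ → ι} (he : Function.Injective e) {f : (κ → I) → ℝ}
    (hf : Measurable f) :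
    ∫ ω : ι → I, f (fun k => ω (e k)) ∂(randLaw ι) = ∫ b, f b ∂(randLaw κ) := by
  have h := measurePreserving_reindex he
  rw [← h.map_eq, integral_map h.measurable.aemeasurable hf.aestronglyMeasurable]

/-- Blocks of the source with disjoint sets of coordinates are independent. -/
theorem indepFun_of_disjoint {e₁ : κ → ι} {e₂ : κ' → ι}
    (h : Disjoint (Set.range e₁) (Set.range e₂)) :
    IndepFun (fun (ω : ι → I) k => ω (e₁ k)) (fun (ω : ι → I) k => ω (e₂ k)) (randLaw ι) := by
  have hi : iIndepFun (fun (i : ι) (ω : ι → I) => ω i) (randLaw ι) :=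
    iIndepFun_infinitePi (P := fun _ : ι => (volume : Measure I)) (X := fun _ x => x)
      (fun _ => measurable_id)
  have key := indep_iSup_of_disjoint (fun i => (measurable_pi_apply (X := fun _ : ι => I) i).comap_le)
    hi h
  rw [IndepFun_iff_Indep]
  refine indep_of_indep_of_le_left (indep_of_indep_of_le_right key ?_) ?_
  · simp only [MeasurableSpace.pi, MeasurableSpace.comap_iSup, MeasurableSpace.comap_comp]
    exact iSup_le fun k => le_iSup₂_of_le (e₂ k) (Set.mem_range_self k) le_rfl
  · simp only [MeasurableSpace.pi, MeasurableSpace.comap_iSup, MeasurableSpace.comap_comp]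
    exact iSup_le fun k => le_iSup₂_of_le (e₁ k) (Set.mem_range_self k) le_rfl

/-- The members of a family of disjoint blocks of the source are independent. -/
theorem iIndepFun_blocks {e : J × κ → ι} (he : Function.Injective e) :
    iIndepFun (fun (j : J) (ω : ι → I) k => ω (e (j, k))) (randLaw ι) := by
  rw [iIndepFun_iff_map_fun_eq_infinitePi_map (fun j => by fun_prop)]
  have h1 : ∀ j : J, (randLaw ι).map (fun (ω : ι → I) k => ω (e (j, k))) = randLaw κ := fun j =>
    (measurePreserving_reindex (f := fun k => e (j, k))
      (fun a b hab => (Prod.mk.inj (he hab)).2)).map_eq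
  simp_rw [h1]
  have h2 : (fun (ω : ι → I) (j : J) (k : κ) => ω (e (j, k)))
      = (MeasurableEquiv.curry J κ I) ∘ (fun ω p => ω (e p)) := by
    ext; rfl
  rw [h2, ← Measure.map_map (by fun_prop) (by fun_prop), (measurePreserving_reindex he).map_eq]
  exact Measure.infinitePi_map_curry (fun (_ : J) (_ : κ) => (volume : Measure I))

theorem measureReal_inter_of_indepFun {Ω α β : Type*} [MeasurableSpace Ω] [MeasurableSpace α]
    [MeasurableSpace β] {μ : Measure Ω} {f : Ω → α} {g : Ω → β} (h : IndepFun f g μ)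
    {s : Set α} {t : Set β} (hs : MeasurableSet s) (ht : MeasurableSet t) :
    μ.real (f ⁻¹' s ∩ g ⁻¹' t) = μ.real (f ⁻¹' s) * μ.real (g ⁻¹' t) := by
  simp only [measureReal_def, h.measure_inter_preimage_eq_mul s t hs ht, ENNReal.toReal_mul]

open scoped Classical in
/-- Take the coordinates in `A` from `ω` and the other ones from `ω'`. -/
noncomputable def merge (A : Set ι) (p : (ι → I) × (ι → I)) : ι → I := fun i => if i ∈ A then p.1 i else p.2 i

theorem merge_of_mem {A : Set ι} {i : ι} (h : i ∈ A) (p : (ι → I) × (ι → I)) :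
    merge A p i = p.1 i := if_pos h

theorem merge_of_notMem {A : Set ι} {i : ι} (h : i ∉ A) (p : (ι → I) × (ι → I)) :
    merge A p i = p.2 i := if_neg h

theorem measurable_merge (A : Set ι) : Measurable (merge A) := by
  refine measurable_pi_lambda _ fun i => ?_
  unfold merge
  split_ifs <;> fun_prop

theorem randLaw_pi (s : Finset ι) (t : ι → Set I) (ht : ∀ i ∈ s, MeasurableSet (t i)) :
    randLaw ι (Set.pi s t) = ∏ i ∈ s, volume (t i) :=
  Measure.infinitePi_pi _ ht

/-- Resampling a part of the coordinates does not change the law. -/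
theorem measurePreserving_merge (A : Set ι) :
    MeasurePreserving (merge A) ((randLaw ι).prod (randLaw ι)) (randLaw ι) := by
  classical
  refine ⟨measurable_merge A, Measure.eq_infinitePi _ fun s t ht => ?_⟩
  rw [Measure.map_apply (measurable_merge A) (.pi s.countable_toSet fun _ _ => ht _)]
  -- A box pulls back to a product of two boxes that share out its coordinates, so the two factors
  -- multiply back to its measure.
  have : merge A ⁻¹' (Set.pi s t) = (Set.pi (s.filter (· ∈ A) : Finset ι) t) ×ˢ
      (Set.pi (s.filter (· ∉ A) : Finset ι) t) := by
    ext p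
    simp only [Set.mem_preimage, Set.mem_pi, Finset.mem_coe, Finset.coe_filter, Set.mem_ofPred_eq,
      Set.mem_prod, merge]
    grind
  rw [this, Measure.prod_prod, randLaw_pi _ _ (fun i _ => ht i), randLaw_pi _ _ (fun i _ => ht i),
    Finset.prod_filter_mul_prod_filter_not]

theorem integral_merge (A : Set ι) {f : (ι → I) → ℝ} (hf : Measurable f) {C : ℝ}
    (hC : ∀ ω, |f ω| ≤ C) :
    ∫ ω, f ω ∂(randLaw ι) = ∫ ω, ∫ ω', f (merge A (ω, ω')) ∂(randLaw ι) ∂(randLaw ι) := by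
  rw [← (measurePreserving_merge A).map_eq,
    integral_map (measurable_merge A).aemeasurable hf.aestronglyMeasurable, integral_prod]
  · rw [(measurePreserving_merge A).map_eq]
  · exact Integrable.of_bound (hf.comp (measurable_merge A)).aestronglyMeasurable C
      (.of_forall fun p => hC _)

theorem volume_real_lt {a : ℝ} (h0 : 0 ≤ a) (h1 : a ≤ 1) :
    (volume : Measure I).real {x : I | (x : ℝ) < a} = a := by
  have : {x : I | (x : ℝ) < a} = Set.Iio (⟨a, h0, h1⟩ : I) := by ext; rfl
  rw [this, measureReal_def, unitInterval.volume_Iio, ENNReal.toReal_ofReal h0]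

theorem volume_real_ge {a : ℝ} (h0 : 0 ≤ a) (h1 : a ≤ 1) :
    (volume : Measure I).real {x : I | a ≤ (x : ℝ)} = 1 - a := by
  have : {x : I | a ≤ (x : ℝ)} = Set.Ici (⟨a, h0, h1⟩ : I) := by ext; rfl
  rw [this, measureReal_def, unitInterval.volume_Ici, ENNReal.toReal_ofReal (by simpa using h1)]

theorem volume_real_Ioc {a : ℝ} (h0 : 0 ≤ a) (h1 : a ≤ 1) :
    (volume : Measure I).real {x : I | 0 < (x : ℝ) ∧ (x : ℝ) ≤ a} = a := by
  have : {x : I | 0 < (x : ℝ) ∧ (x : ℝ) ≤ a} = Set.Ioc 0 (⟨a, h0, h1⟩ : I) := by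
    ext x
    exact and_congr (by rw [← unitInterval.coe_pos]) Iff.rfl
  rw [this, measureReal_def, unitInterval.volume_Ioc]
  simp [ENNReal.toReal_ofReal h0]

theorem volume_real_floor {d k : ℕ} (hk : k < d) :
    (volume : Measure I).real {x : I | ⌊(x : ℝ) * d⌋₊ = k} = 1 / d := by
  have hd : (0 : ℝ) < d := by exact_mod_cast (Nat.zero_le k).trans_lt hk
  have h1 : ((k : ℝ) + 1) / d ≤ 1 := by
    rw [div_le_one hd]; exact_mod_cast hk
  have h0 : (0 : ℝ) ≤ k / d := by positivity
  have h01 : (k : ℝ) / d ≤ ((k : ℝ) + 1) / d := by gcongr; simp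
  have : {x : I | ⌊(x : ℝ) * d⌋₊ = k} = Set.Ico (⟨k / d, h0, h01.trans h1⟩ : I)
      (⟨((k : ℝ) + 1) / d, h0.trans h01, h1⟩ : I) := by
    ext x
    rw [Set.mem_ofPred_eq, Nat.floor_eq_iff (mul_nonneg x.2.1 hd.le), Set.mem_Ico,
      ← Subtype.coe_le_coe, ← Subtype.coe_lt_coe, div_le_iff₀ hd, lt_div_iff₀ hd]
  rw [this, measureReal_def, unitInterval.volume_Ico, ENNReal.toReal_ofReal]
  · simp only; ring
  · simpa using h01

end Source

/-! ### `√c`-walks -/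

section Walks

variable {V : Type*} [Fintype V] {G : Digraph V} {c : ℝ}

theorem inDeg_pos {x y : V} (h : x ∈ inNbrs G y) : 0 < inDeg G y :=
  Finset.card_pos.2 ⟨x, h⟩

theorem measurableSet_randInNbr (y x : V) :
    MeasurableSet {t : I | randInNbr G y t = some x} := by
  have : Measurable fun t : I => ⌊(t : ℝ) * (inDeg G y : ℝ)⌋₊ := by fun_prop
  exact this (MeasurableSet.of_discrete (s := {k | (inNbrs G y).toList[k]? = some x}))

theorem mem_inNbrs_of_randInNbr {y x : V} {t : I} (h : randInNbr G y t = some x) :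
    x ∈ inNbrs G y :=
  Finset.mem_toList.1 (List.mem_of_getElem? h)

theorem volume_randInNbr {x y : V} (h : x ∈ inNbrs G y) :
    (volume : Measure I).real {t : I | randInNbr G y t = some x} = 1 / inDeg G y := by
  obtain ⟨k, hk, hx⟩ := List.mem_iff_getElem.1 (Finset.mem_toList.2 h)
  have hk' : k < inDeg G y := by simpa [inDeg] using hk
  rw [← volume_real_floor hk']
  congr 1
  ext t
  simp only [Set.mem_ofPred_eq, randInNbr]
  constructor
  · intro ht
    obtain ⟨hl, ht'⟩ := List.getElem?_eq_some_iff.1 ht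
    exact ((Finset.nodup_toList _).getElem_inj_iff).1 (ht'.trans hx.symm)
  · intro ht
    rw [ht, List.getElem?_eq_getElem hk, hx]

theorem measurableSet_walkAt (u : V) (k : ℕ) (x : V) :
    MeasurableSet {r : WalkDraw → I | walkAt G c u r k = some x} := by
  induction k generalizing x with
  | zero => exact MeasurableSet.const (some u = some x)
  | succ k ih =>
    have : {r : WalkDraw → I | walkAt G c u r (k + 1) = some x} =
        {r | (r (.halt k) : ℝ) < Real.sqrt c} ∩ ⋃ y : V, ({r | walkAt G c u r k = some y} ∩
          (fun r => r (.move k)) ⁻¹' {t : I | randInNbr G y t = some x}) := by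
      ext r
      by_cases h : (r (.halt k) : ℝ) < Real.sqrt c
      · simp [walkAt, h, Option.bind_eq_some_iff]
      · simp [walkAt, h]
    rw [this]
    refine MeasurableSet.inter (measurableSet_lt (by fun_prop) measurable_const)
      (MeasurableSet.iUnion fun y => (ih y).inter ?_)
    exact (measurable_pi_apply _) (measurableSet_randInNbr y x)

theorem measurableSet_terminatesAt (u w : V) (l : ℕ) :
    MeasurableSet {r : WalkDraw → I | TerminatesAt G c u r w l} :=
  (measurableSet_walkAt u l w).inter (measurableSet_le (f := fun _ => Real.sqrt c)
    (g := fun r : WalkDraw → I => (r (.halt l) : ℝ)) measurable_const (by fun_prop))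

/-- The first step of the `√c`-walk from `u`. -/
noncomputable def firstStep (G : Digraph V) (c : ℝ) (u : V) (r : WalkDraw → I) : Option V :=
  walkAt G c u r 1

/-- The draws of the walk after its first step. -/
def WalkDraw.next : WalkDraw → WalkDraw
  | .halt k => .halt (k + 1)
  | .move k => .move (k + 1)

theorem WalkDraw.next_injective : Function.Injective WalkDraw.next := by
  rintro (a | a) (b | b) h <;> simp_all [WalkDraw.next]

/-- The draws of the first step. -/
def WalkDraw.head : Bool → WalkDraw
  | true => .halt 0
  | false => .move 0

theorem WalkDraw.disjoint_head_next : Disjoint (Set.range head) (Set.range next) := by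
  rw [Set.disjoint_range_iff]
  rintro (_ | _) (_ | _) <;> simp [head, next]

/-- `walkAt` appends steps at the end, while SimRank and `termProb` condition on the first step;
this is the change of viewpoint. -/
theorem walkAt_succ' (u : V) (r : WalkDraw → I) (k : ℕ) :
    walkAt G c u r (k + 1) =
      (firstStep G c u r).bind fun x => walkAt G c x (fun d => r d.next) k := by
  induction k with
  | zero => simp [firstStep, walkAt]
  | succ k ih =>
    rw [walkAt, ih]
    cases h : firstStep G c u r with
    | none => simp
    | some x => rfl

theorem firstStep_eq (u : V) (r : WalkDraw → I) :
    firstStep G c u r =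
      if (r (.halt 0) : ℝ) < Real.sqrt c then randInNbr G u (r (.move 0)) else none := by
  simp [firstStep, walkAt]

theorem measurableSet_firstStep (u x : V) :
    MeasurableSet {r : WalkDraw → I | firstStep G c u r = some x} :=
  measurableSet_walkAt u 1 x

open scoped Classical in
/-- The transition probabilities of the `√c`-walk. -/
noncomputable def trans (G : Digraph V) (c : ℝ) (u x : V) : ℝ :=
  if x ∈ inNbrs G u then Real.sqrt c / inDeg G u else 0

theorem trans_nonneg (u x : V) : 0 ≤ trans G c u x := by
  unfold trans; split_ifs <;> positivity

theorem sum_trans_mul (u : V) (f : V → ℝ) :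
    ∑ x, trans G c u x * f x = Real.sqrt c / inDeg G u * ∑ x ∈ inNbrs G u, f x := by
  classical
  simp [trans, Finset.mul_sum]

theorem sum_trans_le (u : V) : ∑ x, trans G c u x ≤ Real.sqrt c := by
  have := sum_trans_mul (G := G) (c := c) u (fun _ => 1)
  simp only [mul_one, Finset.sum_const, nsmul_eq_mul] at this
  rw [this]
  rcases Nat.eq_zero_or_pos (inDeg G u) with h | h
  · simp [h]
  · rw [inDeg] at h ⊢
    have : ((inNbrs G u).card : ℝ) ≠ 0 := by positivity
    field_simp
    rfl

theorem measureReal_firstStep (hc1 : c < 1) (u x : V) :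
    (randLaw WalkDraw).real {r | firstStep G c u r = some x} = trans G c u x := by
  classical
  by_cases hx : x ∈ inNbrs G u
  · rw [trans, if_pos hx]
    have hq : Real.sqrt c ≤ 1 := Real.sqrt_le_one.2 hc1.le
    have h : {r : WalkDraw → I | firstStep G c u r = some x} = Set.pi
        ((Finset.univ.image WalkDraw.head : Finset WalkDraw) : Set WalkDraw) fun d =>
        match d with
        | .halt _ => {t : I | (t : ℝ) < Real.sqrt c}
        | .move _ => {t : I | randInNbr G u t = some x} := by
      ext r
      rw [Set.mem_ofPred_eq, firstStep_eq]
      simp [WalkDraw.head]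
    rw [h, measureReal_def, randLaw_pi, ENNReal.toReal_prod, Finset.prod_image]
    · have h1 := volume_real_lt (Real.sqrt_nonneg c) hq
      have h2 := volume_randInNbr hx
      rw [measureReal_def] at h1 h2
      simp [WalkDraw.head, h1, h2, div_eq_mul_inv]
    · rintro (_ | _) _ (_ | _) _ h <;> simp_all [WalkDraw.head]
    · rintro (k | k) _
      · exact measurableSet_lt (by fun_prop) measurable_const
      · exact measurableSet_randInNbr u x
  · rw [trans, if_neg hx]
    have : {r : WalkDraw → I | firstStep G c u r = some x} = ∅ := by
      ext r
      simp only [Set.mem_ofPred_eq, Set.mem_empty_iff_false, iff_false, firstStep_eq]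
      intro h
      split_ifs at h
      exact hx (mem_inNbrs_of_randInNbr h)
    rw [this]; simp

theorem firstStep_congr {u : V} {r r' : WalkDraw → I}
    (h : ∀ b, r (WalkDraw.head b) = r' (WalkDraw.head b)) :
    firstStep G c u r = firstStep G c u r' := by
  rw [firstStep_eq, firstStep_eq]
  have h1 := h true
  have h2 := h false
  simp only [WalkDraw.head] at h1 h2
  rw [h1, h2]

open scoped Classical in
/-- The probability `π_l(u, w)` that the `√c`-walk from `u` terminates at `w` with `l` steps. -/
noncomputable def termProb (G : Digraph V) (c : ℝ) : ℕ → V → V → ℝ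
  | 0, u, w => if u = w then 1 - Real.sqrt c else 0
  | l + 1, u, w => ∑ x, trans G c u x * termProb G c l x w

theorem termProb_nonneg (hc1 : c < 1) (l : ℕ) (u w : V) : 0 ≤ termProb G c l u w := by
  induction l generalizing u with
  | zero =>
    have : Real.sqrt c ≤ 1 := Real.sqrt_le_one.2 hc1.le
    rw [termProb]; split_ifs <;> linarith
  | succ l ih => exact Finset.sum_nonneg fun x _ => mul_nonneg (trans_nonneg u x) (ih x)

/-- Extends the draws of the first step to all draws. -/
def WalkDraw.ofHead (b : Bool → I) : WalkDraw → I
  | .halt _ => b true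
  | .move _ => b false

theorem WalkDraw.measurable_ofHead : Measurable ofHead :=
  measurable_pi_lambda _ fun d => by cases d <;> simp only [ofHead] <;> fun_prop

theorem firstStep_ofHead (u : V) (r : WalkDraw → I) :
    firstStep G c u (WalkDraw.ofHead fun b => r (WalkDraw.head b)) = firstStep G c u r :=
  firstStep_congr fun b => by cases b <;> rfl

/-- The walk after its first step is a `√c`-walk, independent of the first step. -/
theorem measureReal_firstStep_inter (hc1 : c < 1) (u x : V) {S : Set (WalkDraw → I)}
    (hS : MeasurableSet S) :
    (randLaw WalkDraw).real ({r | firstStep G c u r = some x} ∩ {r | (fun d => r d.next) ∈ S})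
      = trans G c u x * (randLaw WalkDraw).real S := by
  -- The first-step event is pulled back through `WalkDraw.ofHead` to make it depend on the two head
  -- coordinates only.
  have h := measureReal_inter_of_indepFun (indepFun_of_disjoint WalkDraw.disjoint_head_next)
    (s := WalkDraw.ofHead ⁻¹' {r | firstStep G c u r = some x}) (t := S)
    (WalkDraw.measurable_ofHead (measurableSet_firstStep u x)) hS
  have h1 : (fun (ω : WalkDraw → I) k => ω (WalkDraw.head k)) ⁻¹'
      (WalkDraw.ofHead ⁻¹' {r | firstStep G c u r = some x})
      = {r | firstStep G c u r = some x} := by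
    ext r; simp [firstStep_ofHead]
  rw [h1, measureReal_firstStep hc1] at h
  refine h.trans ?_
  congr 1
  exact (measurePreserving_reindex WalkDraw.next_injective).measureReal_preimage
    hS.nullMeasurableSet

theorem measureReal_terminatesAt (hc1 : c < 1) (l : ℕ) (u w : V) :
    (randLaw WalkDraw).real {r | TerminatesAt G c u r w l} = termProb G c l u w := by
  classical
  induction l generalizing u with
  | zero =>
    rw [termProb]
    by_cases h : u = w
    · have : {r : WalkDraw → I | TerminatesAt G c u r w 0}
          = (fun r : WalkDraw → I => r (.halt 0)) ⁻¹' {t : I | Real.sqrt c ≤ (t : ℝ)} := by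
        ext r; simp [TerminatesAt, walkAt, h]
      rw [this, if_pos h, ← volume_real_ge (Real.sqrt_nonneg c) (Real.sqrt_le_one.2 hc1.le)]
      exact (measurePreserving_eval_infinitePi (fun _ : WalkDraw => (volume : Measure I))
        (.halt 0)).measureReal_preimage
          (measurableSet_le measurable_const (by fun_prop)).nullMeasurableSet
    · have : {r : WalkDraw → I | TerminatesAt G c u r w 0} = ∅ := by
        ext r; simp [TerminatesAt, walkAt, h]
      rw [this, if_neg h]; simp
  | succ l ih =>
    have : {r : WalkDraw → I | TerminatesAt G c u r w (l + 1)} = ⋃ x ∈ (Finset.univ : Finset V),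
        ({r | firstStep G c u r = some x} ∩
          {r | (fun d => r (WalkDraw.next d)) ∈ {r | TerminatesAt G c x r w l}}) := by
      ext r
      simp only [TerminatesAt, walkAt_succ', Set.mem_ofPred_eq, Option.bind_eq_some_iff,
        Set.mem_iUnion, Set.mem_inter_iff, Finset.mem_univ, WalkDraw.next]
      grind
    rw [this, measureReal_biUnion_finset, termProb]
    · refine Finset.sum_congr rfl fun x _ => ?_
      rw [measureReal_firstStep_inter hc1 u x (measurableSet_terminatesAt x w l), ih]
    · intro x _ y _ hxy
      refine Set.disjoint_left.2 fun r hr hr' => hxy ?_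
      exact Option.some_injective _ (hr.1.symm.trans hr'.1)
    · intro x _
      refine (measurableSet_firstStep u x).inter ?_
      exact (measurable_pi_lambda _ fun d => measurable_pi_apply (WalkDraw.next d))
        (measurableSet_terminatesAt x w l)

end Walks

/-! ### SimRank as a meeting probability -/

section SimRank

variable {V : Type*} [Fintype V] {G : Digraph V} {c : ℝ}

/-- Independent `√c`-walks from `u` and `v` visit the same node at some step `k ≥ k₀`. -/
def MeetFrom (G : Digraph V) (c : ℝ) (k₀ : ℕ) (u v : V) (r : Bool × WalkDraw → I) : Prop :=
  ∃ k : ℕ, k₀ ≤ k ∧ ∃ x, walkAt G c u (fun d => r (false, d)) k = some x ∧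
    walkAt G c v (fun d => r (true, d)) k = some x

theorem measurableSet_meetFrom (k₀ : ℕ) (u v : V) :
    MeasurableSet {r | MeetFrom G c k₀ u v r} := by
  have : {r | MeetFrom G c k₀ u v r} = ⋃ k : ℕ, ⋃ _ : k₀ ≤ k, ⋃ x : V,
      ((fun (r : Bool × WalkDraw → I) d => r (false, d)) ⁻¹' {r | walkAt G c u r k = some x} ∩
      (fun (r : Bool × WalkDraw → I) d => r (true, d)) ⁻¹' {r | walkAt G c v r k = some x}) := by
    ext r
    simp [MeetFrom]
  rw [this]
  refine .iUnion fun k => .iUnion fun _ => .iUnion fun x => .inter ?_ ?_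
  · exact (by fun_prop : Measurable fun (r : Bool × WalkDraw → I) d => r (false, d))
      (measurableSet_walkAt u k x)
  · exact (by fun_prop : Measurable fun (r : Bool × WalkDraw → I) d => r (true, d))
      (measurableSet_walkAt v k x)

/-- The probability that independent `√c`-walks from `u` and `v` meet at some step `k ≥ 0`. -/
noncomputable def meetProb (G : Digraph V) (c : ℝ) (u v : V) : ℝ :=
  (randLaw (Bool × WalkDraw)).real {r | MeetFrom G c 0 u v r}

theorem measureReal_firstSteps (hc1 : c < 1) (u v x y : V) :
    (randLaw (Bool × WalkDraw)).real {r | firstStep G c u (fun d => r (false, d)) = some x ∧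
      firstStep G c v (fun d => r (true, d)) = some y} = trans G c u x * trans G c v y := by
  have hd : Disjoint (Set.range fun d : WalkDraw => (false, d))
      (Set.range fun d : WalkDraw => (true, d)) := by
    rw [Set.disjoint_range_iff]; simp
  have h := measureReal_inter_of_indepFun (indepFun_of_disjoint hd)
    (measurableSet_firstStep (G := G) (c := c) u x) (measurableSet_firstStep (G := G) (c := c) v y)
  rw [(measurePreserving_reindex (Prod.mk_right_injective false)).measureReal_preimage
      (measurableSet_firstStep u x).nullMeasurableSet,
    (measurePreserving_reindex (Prod.mk_right_injective true)).measureReal_preimage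
      (measurableSet_firstStep v y).nullMeasurableSet,
    measureReal_firstStep hc1, measureReal_firstStep hc1] at h
  exact h

/-- Markov property of the pair of walks: the four draws of the two first steps are disjoint from
all later draws, and the latter are again distributed as a full source. -/
theorem measureReal_firstSteps_inter (hc1 : c < 1) (u v x y : V)
    {S : Set (Bool × WalkDraw → I)} (hS : MeasurableSet S) :
    (randLaw (Bool × WalkDraw)).real ({r | firstStep G c u (fun d => r (false, d)) = some x ∧
      firstStep G c v (fun d => r (true, d)) = some y} ∩
        {r | (fun p => r (p.1, WalkDraw.next p.2)) ∈ S})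
      = trans G c u x * trans G c v y * (randLaw (Bool × WalkDraw)).real S := by
  have hd : Disjoint (Set.range fun p : Bool × Bool => (p.1, WalkDraw.head p.2))
      (Set.range fun p : Bool × WalkDraw => (p.1, WalkDraw.next p.2)) := by
    rw [Set.disjoint_range_iff]
    intro p p' h
    exact Set.disjoint_range_iff.1 WalkDraw.disjoint_head_next p.2 p'.2 (Prod.mk.inj h).2
  have hi : Function.Injective fun p : Bool × WalkDraw => (p.1, WalkDraw.next p.2) := by
    rintro ⟨a, b⟩ ⟨a', b'⟩ h
    obtain ⟨h1, h2⟩ := Prod.mk.inj h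
    exact Prod.ext h1 (WalkDraw.next_injective h2)
  have hm : MeasurableSet {b : Bool × Bool → I |
      firstStep G c u (WalkDraw.ofHead fun i => b (false, i)) = some x ∧
      firstStep G c v (WalkDraw.ofHead fun i => b (true, i)) = some y} :=
    ((WalkDraw.measurable_ofHead.comp (by fun_prop :
      Measurable fun (b : Bool × Bool → I) i => b (false, i))) (measurableSet_firstStep u x)).inter
    ((WalkDraw.measurable_ofHead.comp (by fun_prop :
      Measurable fun (b : Bool × Bool → I) i => b (true, i))) (measurableSet_firstStep v y))
  have h := measureReal_inter_of_indepFun (indepFun_of_disjoint hd) hm hS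
  rw [(measurePreserving_reindex hi).measureReal_preimage hS.nullMeasurableSet] at h
  have h1 : (fun (ω : Bool × WalkDraw → I) (k : Bool × Bool) => ω (k.1, WalkDraw.head k.2)) ⁻¹'
      {b | firstStep G c u (WalkDraw.ofHead fun i => b (false, i)) = some x ∧
        firstStep G c v (WalkDraw.ofHead fun i => b (true, i)) = some y} =
      {r | firstStep G c u (fun d => r (false, d)) = some x ∧
        firstStep G c v (fun d => r (true, d)) = some y} := by
    ext r
    simp only [Set.mem_preimage, Set.mem_ofPred_eq]
    rw [firstStep_ofHead u (fun d => r (false, d)), firstStep_ofHead v (fun d => r (true, d))]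
  rw [h1, measureReal_firstSteps hc1] at h
  exact h

theorem measureReal_meetFrom_one (hc1 : c < 1) (u v : V) :
    (randLaw (Bool × WalkDraw)).real {r | MeetFrom G c 1 u v r} =
      ∑ x, ∑ y, trans G c u x * trans G c v y * meetProb G c x y := by
  classical
  have : {r | MeetFrom G c 1 u v r} = ⋃ p ∈ (Finset.univ : Finset (V × V)),
      ({r : Bool × WalkDraw → I | firstStep G c u (fun d => r (false, d)) = some p.1 ∧
      firstStep G c v (fun d => r (true, d)) = some p.2} ∩
        {r | (fun q => r (q.1, WalkDraw.next q.2)) ∈ {r | MeetFrom G c 0 p.1 p.2 r}}) := by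
    ext r
    simp only [MeetFrom, Set.mem_ofPred_eq, Set.mem_iUnion, Set.mem_inter_iff, Finset.mem_univ]
    constructor
    · rintro ⟨k, hk, x, h1, h2⟩
      obtain ⟨k, rfl⟩ := Nat.exists_eq_add_of_le' hk
      rw [walkAt_succ', Option.bind_eq_some_iff] at h1 h2
      obtain ⟨a, ha, h1⟩ := h1
      obtain ⟨b, hb, h2⟩ := h2
      exact ⟨(a, b), trivial, ⟨ha, hb⟩, k, Nat.zero_le _, x, h1, h2⟩
    · rintro ⟨⟨a, b⟩, -, ⟨ha, hb⟩, k, -, x, h1, h2⟩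
      refine ⟨k + 1, by omega, x, ?_, ?_⟩
      · rw [walkAt_succ', ha]; exact h1
      · rw [walkAt_succ', hb]; exact h2
  rw [this, measureReal_biUnion_finset, Fintype.sum_prod_type]
  · refine Finset.sum_congr rfl fun x _ => Finset.sum_congr rfl fun y _ => ?_
    exact measureReal_firstSteps_inter hc1 u v x y (measurableSet_meetFrom 0 x y)
  · intro p _ p' _ hpp
    refine Set.disjoint_left.2 fun r hr hr' => hpp ?_
    exact Prod.ext (Option.some_injective _ (hr.1.1.symm.trans hr'.1.1))
      (Option.some_injective _ (hr.1.2.symm.trans hr'.1.2))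
  · intro p _
    refine .inter (.inter ?_ ?_) ?_
    · exact (by fun_prop : Measurable fun (r : Bool × WalkDraw → I) d => r (false, d))
        (measurableSet_firstStep u p.1)
    · exact (by fun_prop : Measurable fun (r : Bool × WalkDraw → I) d => r (true, d))
        (measurableSet_firstStep v p.2)
    · exact (by fun_prop : Measurable fun (r : Bool × WalkDraw → I) (q : Bool × WalkDraw) =>
        r (q.1, WalkDraw.next q.2)) (measurableSet_meetFrom 0 p.1 p.2)

theorem sum_trans_trans_mul (hc0 : 0 < c) (u v : V) (f : V → V → ℝ) :
    ∑ x, ∑ y, trans G c u x * trans G c v y * f x y =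
      c / ((inDeg G u : ℝ) * (inDeg G v : ℝ)) * ∑ x ∈ inNbrs G u, ∑ y ∈ inNbrs G v, f x y := by
  simp_rw [mul_assoc, ← Finset.mul_sum, sum_trans_mul, ← Finset.mul_sum]
  nth_rewrite 3 [← Real.mul_self_sqrt hc0.le]
  ring

theorem isSimRank_meetProb (hc0 : 0 < c) (hc1 : c < 1) : IsSimRank G c (meetProb G c) := by
  refine ⟨fun u => ?_, fun u v huv => ?_⟩
  · have : {r | MeetFrom G c 0 u u r} = Set.univ :=
      Set.eq_univ_of_forall fun r => ⟨0, le_rfl, u, rfl, rfl⟩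
    rw [meetProb, this, probReal_univ]
  · rw [← sum_trans_trans_mul hc0, ← measureReal_meetFrom_one hc1, meetProb]
    congr 1
    ext r
    constructor
    · rintro ⟨k, -, x, h1, h2⟩
      refine ⟨k, Nat.one_le_iff_ne_zero.2 ?_, x, h1, h2⟩
      rintro rfl
      -- At step 0 the walks sit at the distinct nodes `u` and `v`, so any meeting happens at a step
      -- `k ≥ 1`.
      exact huv (Option.some_injective _ (h1.trans h2.symm))
    · rintro ⟨k, -, h⟩
      exact ⟨k, Nat.zero_le k, h⟩

theorem IsSimRank.eq_meetProb (hc0 : 0 < c) (hc1 : c < 1) {s : V → V → ℝ}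
    (hs : IsSimRank G c s) : s = meetProb G c :=
  (existsUnique_isSimRank G c hc0 hc1).unique hs (isSimRank_meetProb hc0 hc1)

/-- The probability `η(w)` that two independent `√c`-walks from `w` do not meet. -/
noncomputable def noMeetProb (G : Digraph V) (c : ℝ) (w : V) : ℝ :=
  (randLaw (Bool × WalkDraw)).real {r | ¬ MeetFrom G c 1 w w r}

theorem noMeetProb_nonneg (w : V) : 0 ≤ noMeetProb G c w := measureReal_nonneg

theorem noMeetProb_le_one (w : V) : noMeetProb G c w ≤ 1 := measureReal_le_one

-- On the diagonal, 1 splits into η(u) and the probability of a meeting at some step `k ≥ 1`; off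
-- the diagonal this is the SimRank equation. The two cases become one affine recursion with source
-- term η.
open scoped Classical in
theorem IsSimRank.eq_add (hc0 : 0 < c) (hc1 : c < 1) {s : V → V → ℝ} (hs : IsSimRank G c s)
    (u v : V) : s u v = (if u = v then noMeetProb G c u else 0) +
      ∑ x, ∑ y, trans G c u x * trans G c v y * s x y := by
  split_ifs with h
  · subst h
    rw [hs.1, hs.eq_meetProb hc0 hc1, ← measureReal_meetFrom_one hc1, noMeetProb]
    have := probReal_compl_eq_one_sub (μ := randLaw (Bool × WalkDraw))
      (measurableSet_meetFrom (G := G) (c := c) 1 u u)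
    rw [Set.compl_ofPred] at this
    rw [this]; ring
  · rw [zero_add, sum_trans_trans_mul hc0, hs.2 u v h]

/-- The contribution of `w` and `l` to the SimRank of `u` and `v`. -/
noncomputable def simTerm (G : Digraph V) (c : ℝ) (u v w : V) (l : ℕ) : ℝ :=
  termProb G c l u w * termProb G c l v w * noMeetProb G c w / (1 - Real.sqrt c) ^ 2

theorem simTerm_nonneg (hc1 : c < 1) (u v w : V) (l : ℕ) : 0 ≤ simTerm G c u v w l :=
  div_nonneg (mul_nonneg (mul_nonneg (termProb_nonneg hc1 _ _ _) (termProb_nonneg hc1 _ _ _))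
    (noMeetProb_nonneg _)) (sq_nonneg _)

theorem sqrt_lt_one (hc1 : c < 1) : Real.sqrt c < 1 := by
  rw [Real.sqrt_lt' one_pos]; simpa using hc1

open scoped Classical in
theorem sum_simTerm_zero (hc1 : c < 1) (u v : V) :
    ∑ w, simTerm G c u v w 0 = if u = v then noMeetProb G c u else 0 := by
  have h : 1 - Real.sqrt c ≠ 0 := by linarith [sqrt_lt_one hc1]
  rw [Finset.sum_eq_single u]
  · by_cases h' : u = v
    · subst h'; simp only [simTerm, termProb, if_true]; field_simp
    · simp [simTerm, termProb, h', Ne.symm h']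
  · intro w _ hw; simp [simTerm, termProb, hw.symm]
  · simp

theorem sum_simTerm_succ (u v : V) (l : ℕ) :
    ∑ w, simTerm G c u v w (l + 1) =
      ∑ x, ∑ y, trans G c u x * trans G c v y * ∑ w, simTerm G c x y w l := by
  have h : ∀ w, simTerm G c u v w (l + 1) =
      ∑ x, ∑ y, trans G c u x * trans G c v y * simTerm G c x y w l := fun w => by
    rw [simTerm, termProb, termProb, Finset.sum_mul_sum, Finset.sum_mul, Finset.sum_div]
    refine Finset.sum_congr rfl fun x _ => ?_
    rw [Finset.sum_mul, Finset.sum_div]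
    refine Finset.sum_congr rfl fun y _ => ?_
    rw [simTerm]
    ring
  simp_rw [h, Finset.mul_sum]
  rw [Finset.sum_comm]
  exact Finset.sum_congr rfl fun x _ => Finset.sum_comm

/-- The partial sums satisfy the recursion of `IsSimRank.eq_add`, so the remainder is propagated by
two substochastic kernels, each of total mass at most √c, and shrinks by a factor c per level. -/
theorem abs_sub_sum_simTerm_le (hc0 : 0 < c) (hc1 : c < 1) {s : V → V → ℝ}
    (hs : IsSimRank G c s) (L : ℕ) (u v : V) :
    |s u v - ∑ l ∈ Finset.range L, ∑ w, simTerm G c u v w l| ≤ c ^ L := by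
  classical
  induction L generalizing u v with
  | zero =>
    rw [hs.eq_meetProb hc0 hc1]
    simp only [Finset.range_zero, Finset.sum_empty, sub_zero, pow_zero, meetProb]
    rw [abs_of_nonneg measureReal_nonneg]
    exact measureReal_le_one
  | succ L ih =>
    have h : s u v - ∑ l ∈ Finset.range (L + 1), ∑ w, simTerm G c u v w l =
        ∑ x, ∑ y, trans G c u x * trans G c v y *
          (s x y - ∑ l ∈ Finset.range L, ∑ w, simTerm G c x y w l) := by
      rw [Finset.sum_range_succ', sum_simTerm_zero hc1]
      nth_rewrite 1 [hs.eq_add hc0 hc1 u v]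
      simp_rw [sum_simTerm_succ, mul_sub, Finset.sum_sub_distrib, Finset.mul_sum]
      rw [Finset.sum_comm]
      simp_rw [Finset.sum_comm (s := Finset.range L)]
      ring
    rw [h]
    calc _ ≤ ∑ x, ∑ y, trans G c u x * trans G c v y * c ^ L := by
          refine (Finset.abs_sum_le_sum_abs _ _).trans (Finset.sum_le_sum fun x _ =>
            (Finset.abs_sum_le_sum_abs _ _).trans (Finset.sum_le_sum fun y _ => ?_))
          rw [abs_mul, abs_of_nonneg (mul_nonneg (trans_nonneg u x) (trans_nonneg v y))]
          exact mul_le_mul_of_nonneg_left (ih x y)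
            (mul_nonneg (trans_nonneg u x) (trans_nonneg v y))
      _ = (∑ x, trans G c u x) * (∑ y, trans G c v y) * c ^ L := by
          rw [Finset.sum_mul_sum, Finset.sum_mul]
          simp_rw [Finset.sum_mul]
      _ ≤ Real.sqrt c * Real.sqrt c * c ^ L := by
          gcongr
          · exact Finset.sum_nonneg fun y _ => trans_nonneg v y
          · exact sum_trans_le u
          · exact sum_trans_le v
      _ = c ^ (L + 1) := by rw [Real.mul_self_sqrt hc0.le, pow_succ']

theorem IsSimRank.hasSum (hc0 : 0 < c) (hc1 : c < 1) {s : V → V → ℝ} (hs : IsSimRank G c s)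
    (u v : V) : HasSum (fun p : V × ℕ => simTerm G c u v p.1 p.2) (s u v) := by
  have h1 : HasSum (fun l => ∑ w, simTerm G c u v w l) (s u v) := by
    rw [hasSum_iff_tendsto_nat_of_nonneg fun l =>
      Finset.sum_nonneg fun w _ => simTerm_nonneg hc1 u v w l]
    rw [tendsto_iff_norm_sub_tendsto_zero]
    refine squeeze_zero (fun _ => norm_nonneg _) (fun L => ?_)
      (tendsto_pow_atTop_nhds_zero_of_lt_one hc0.le hc1)
    rw [norm_sub_rev]
    exact abs_sub_sum_simTerm_le hc0 hc1 hs L u v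
  have h2 : Summable fun p : ℕ × V => simTerm G c u v p.2 p.1 := by
    rw [summable_prod_of_nonneg fun p => simTerm_nonneg hc1 u v p.2 p.1]
    refine ⟨fun l => Summable.of_finite, ?_⟩
    simpa only [tsum_fintype] using h1.summable
  have h3 := h2.hasSum.prod_fiberwise (fun l => hasSum_fintype _)
  have h4 := h2.hasSum
  rw [h3.unique h1] at h4
  exact (Equiv.prodComm V ℕ).hasSum_iff.2 h4

theorem IsSimRank.le_one (hc0 : 0 < c) (hc1 : c < 1) {s : V → V → ℝ} (hs : IsSimRank G c s)
    (u v : V) : s u v ≤ 1 := by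
  rw [hs.eq_meetProb hc0 hc1]; exact measureReal_le_one

end SimRank

/-! ### The Variance Bounded Backward Walk -/

section Backward

variable {V : Type*} [Fintype V] {G : Digraph V} {c : ℝ}

open scoped Classical in
/-- The amount that a node with value `p` passes on to an out-neighbour of in-degree `d`. -/
noncomputable def passOn (c d p : ℝ) (g r : I) : ℝ :=
  if (g : ℝ) < Real.sqrt c then
    if d ≤ p / (1 - Real.sqrt c) then p / d
    else if d ≤ p / ((r : ℝ) * (1 - Real.sqrt c)) then 1 - Real.sqrt c
    else 0
  else 0

theorem backEst_succ (w : V) (r : BackDraw V → I) (i : ℕ) (y : V) :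
    backEst G c w r (i + 1) y = ∑ x ∈ inNbrs G y,
      passOn c (inDeg G y) (backEst G c w r i x) (r (.gate i x)) (r (.cut i x)) := rfl

theorem measurable_passOn (c d : ℝ) :
    Measurable fun t : ℝ × I × I => passOn c d t.1 t.2.1 t.2.2 := by
  unfold passOn
  refine Measurable.ite (measurableSet_lt (by fun_prop) (by fun_prop)) ?_ measurable_const
  refine Measurable.ite (measurableSet_le (by fun_prop) (by fun_prop)) (by fun_prop) ?_
  exact Measurable.ite (measurableSet_le (by fun_prop) (by fun_prop)) measurable_const
    measurable_const

theorem measurable_passOn_comp {Ω : Type*} [MeasurableSpace Ω] (c d p : ℝ) {f g : Ω → I}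
    (hf : Measurable f) (hg : Measurable g) : Measurable fun ω => passOn c d p (f ω) (g ω) :=
  (measurable_passOn c d).comp (measurable_const.prodMk (hf.prodMk hg))

theorem passOn_nonneg (hc1 : c < 1) {d p : ℝ} (hd : 0 ≤ d) (hp : 0 ≤ p) (g r : I) :
    0 ≤ passOn c d p g r := by
  have := sqrt_lt_one hc1
  unfold passOn
  split_ifs
  · positivity
  · linarith
  all_goals rfl

theorem passOn_eq_zero_or_ge (hc1 : c < 1) {d p : ℝ} (hd : 0 < d) (g r : I) :
    passOn c d p g r = 0 ∨ 1 - Real.sqrt c ≤ passOn c d p g r := by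
  have h := sqrt_lt_one hc1
  unfold passOn
  split_ifs with h1 h2 h3
  · right
    rw [le_div_iff₀ (by linarith)] at h2
    rw [le_div_iff₀ hd]
    linarith
  · exact .inr le_rfl
  all_goals exact .inl rfl

theorem passOn_le (hc1 : c < 1) {d p M : ℝ} (hd : 0 < d) (hp : 0 ≤ p) (hpM : p ≤ M) (hdM : d ≤ M)
    (g r : I) : passOn c d p g r ≤ M / d := by
  have h := sqrt_lt_one hc1
  have h' := Real.sqrt_nonneg c
  unfold passOn
  split_ifs
  · gcongr
  · rw [le_div_iff₀ hd]; nlinarith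
  all_goals exact div_nonneg (hp.trans hpM) hd.le

theorem backEst_nonneg (hc1 : c < 1) (w : V) (r : BackDraw V → I) (i : ℕ) (y : V) :
    0 ≤ backEst G c w r i y := by
  induction i generalizing y with
  | zero =>
    have := sqrt_lt_one hc1
    rw [backEst]; split_ifs <;> linarith
  | succ i ih =>
    rw [backEst_succ]
    exact Finset.sum_nonneg fun x _ => passOn_nonneg hc1 (Nat.cast_nonneg _) (ih x) _ _

/-- Every nonzero amount passed on is at least 1-√c, and amounts only add up. The dichotomy gives
(1-√c) p ≤ p² for every value p, which the second-moment bound needs. -/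
theorem backEst_eq_zero_or_ge (hc1 : c < 1) (w : V) (r : BackDraw V → I) (i : ℕ) (y : V) :
    backEst G c w r i y = 0 ∨ 1 - Real.sqrt c ≤ backEst G c w r i y := by
  cases i with
  | zero => rw [backEst]; split_ifs <;> simp
  | succ i =>
    rw [backEst_succ]
    by_cases h : ∀ x ∈ inNbrs G y,
        passOn c (inDeg G y) (backEst G c w r i x) (r (.gate i x)) (r (.cut i x)) = 0
    · exact .inl (Finset.sum_eq_zero h)
    · push Not at h
      obtain ⟨x, hx, hx0⟩ := h
      have hd : (0 : ℝ) < inDeg G y := by exact_mod_cast inDeg_pos hx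
      exact .inr (((passOn_eq_zero_or_ge hc1 hd _ _).resolve_left hx0).trans
        (Finset.single_le_sum (f := fun x => passOn c (inDeg G y) (backEst G c w r i x)
          (r (.gate i x)) (r (.cut i x)))
          (fun x _ => passOn_nonneg hc1 hd.le (backEst_nonneg hc1 w r i x) _ _) hx))

/-- With n nodes, each of the d in-neighbours passes on at most n/d, because d ≤ n. The bound is
crude and serves only integrability; it does not enter the error estimates. -/
theorem backEst_le_card (hc1 : c < 1) (w : V) (r : BackDraw V → I) (i : ℕ) (y : V) :
    backEst G c w r i y ≤ Fintype.card V := by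
  induction i generalizing y with
  | zero =>
    have h1 := Real.sqrt_nonneg c
    have : (1 : ℝ) ≤ Fintype.card V := by
      exact_mod_cast Fintype.card_pos_iff.2 ⟨w⟩
    rw [backEst]; split_ifs <;> linarith
  | succ i ih =>
    rw [backEst_succ]
    rcases (inNbrs G y).eq_empty_or_nonempty with h | ⟨x, hx⟩
    · rw [h]; simp
    · have hd : (0 : ℝ) < inDeg G y := by exact_mod_cast inDeg_pos hx
      have hdM : (inDeg G y : ℝ) ≤ Fintype.card V := by
        exact_mod_cast Finset.card_le_univ (inNbrs G y)
      refine (Finset.sum_le_card_nsmul _ _ (Fintype.card V / (inDeg G y : ℝ)) fun x _ =>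
        passOn_le hc1 hd (backEst_nonneg hc1 w r i x) (ih x) hdM _ _).trans_eq ?_
      rw [nsmul_eq_mul, ← inDeg]
      field_simp

theorem measurable_backEst (w : V) (i : ℕ) (y : V) :
    Measurable fun r : BackDraw V → I => backEst G c w r i y := by
  induction i generalizing y with
  | zero => exact measurable_const
  | succ i ih =>
    simp_rw [backEst_succ]
    refine Finset.measurable_sum _ fun x _ => ?_
    exact (measurable_passOn c (inDeg G y)).comp
      ((ih x).prodMk ((measurable_pi_apply _).prodMk (measurable_pi_apply _)))

/-- The level at which a draw of the backward walk is used. -/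
def BackDraw.level : BackDraw V → ℕ
  | .gate i _ => i
  | .cut i _ => i

theorem backEst_congr (w : V) {r r' : BackDraw V → I} {i : ℕ}
    (h : ∀ d : BackDraw V, d.level < i → r d = r' d) (y : V) :
    backEst G c w r i y = backEst G c w r' i y := by
  induction i generalizing y with
  | zero => rfl
  | succ i ih =>
    rw [backEst_succ, backEst_succ]
    refine Finset.sum_congr rfl fun x _ => ?_
    rw [ih (fun d hd => h d (hd.trans i.lt_succ_self)),
      h (.gate i x) i.lt_succ_self, h (.cut i x) i.lt_succ_self]

theorem measureReal_two {ι : Type*} {a b : ι} (hab : a ≠ b) {S T : Set I}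
    (hS : MeasurableSet S) (hT : MeasurableSet T) :
    (randLaw ι).real {ω | ω a ∈ S ∧ ω b ∈ T} =
      (volume : Measure I).real S * (volume : Measure I).real T := by
  have hi : iIndepFun (fun (i : ι) (ω : ι → I) => ω i) (randLaw ι) :=
    iIndepFun_infinitePi (P := fun _ : ι => (volume : Measure I)) (X := fun _ x => x)
      (fun _ => measurable_id)
  have h := measureReal_inter_of_indepFun (hi.indepFun hab) hS hT
  have he : ∀ i, MeasurePreserving (fun ω : ι → I => ω i) (randLaw ι) volume :=
    fun i => measurePreserving_eval_infinitePi (fun _ : ι => (volume : Measure I)) i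
  rw [(he a).measureReal_preimage hS.nullMeasurableSet,
    (he b).measureReal_preimage hT.nullMeasurableSet] at h
  exact h

/-- For a fixed value `p`, the amount passed on is a multiple of an indicator function. -/
theorem passOn_eq_indicator (hc1 : c < 1) {d p : ℝ} (hd : 0 < d) :
    (∀ g r, p < d * (1 - Real.sqrt c) → passOn c d p g r =
      if (g : ℝ) < Real.sqrt c ∧ (0 < (r : ℝ) ∧ (r : ℝ) ≤ p / (d * (1 - Real.sqrt c)))
        then 1 - Real.sqrt c else 0) ∧
    (∀ g r, d * (1 - Real.sqrt c) ≤ p → passOn c d p g r =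
      if (g : ℝ) < Real.sqrt c then p / d else 0) := by
  have h : 0 < 1 - Real.sqrt c := by linarith [sqrt_lt_one hc1]
  constructor
  · intro g r hlt
    have h1 : ¬ d ≤ p / (1 - Real.sqrt c) := by rw [le_div_iff₀ h]; exact not_le.2 hlt
    have h2 : d ≤ p / ((r : ℝ) * (1 - Real.sqrt c)) ↔
        0 < (r : ℝ) ∧ (r : ℝ) ≤ p / (d * (1 - Real.sqrt c)) := by
      rcases r.2.1.eq_or_lt with h0 | h0
      -- At `r = 0` the quotient is 0 by convention, so the test against `d > 0` fails, in agreement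
      -- with the condition `0 < r`.
      · rw [← h0]; simp [hd]
      · rw [le_div_iff₀ (by positivity), le_div_iff₀ (by positivity), and_iff_right h0]
        constructor <;> intro h <;> linarith
    unfold passOn
    rw [if_neg h1]
    simp only [h2]
    by_cases hg : (g : ℝ) < Real.sqrt c <;> simp [hg]
  · intro g r hle
    have h1 : d ≤ p / (1 - Real.sqrt c) := by rw [le_div_iff₀ h]; exact hle
    unfold passOn
    rw [if_pos h1]

open scoped Classical in
/-- The second moment of the amount passed on. -/
noncomputable def passOnSq (c d p : ℝ) : ℝ :=
  if d * (1 - Real.sqrt c) ≤ p then Real.sqrt c * (p / d) ^ 2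
  else Real.sqrt c * (1 - Real.sqrt c) * (p / d)

/-- The gate opens with probability √c. Small shares are rounded up to 1-√c and kept with
probability p/(d(1-√c)), so the mean is √c p/d in both regimes. -/
theorem integral_passOn_pow (hc1 : c < 1) {d p : ℝ} (hd : 0 < d) (hp : 0 ≤ p) {ι : Type*}
    {a b : ι} (hab : a ≠ b) :
    ∫ ω, passOn c d p (ω a) (ω b) ∂(randLaw ι) = Real.sqrt c * (p / d) ∧
    ∫ ω, passOn c d p (ω a) (ω b) ^ 2 ∂(randLaw ι) = passOnSq c d p := by
  classical
  have h : 0 < 1 - Real.sqrt c := by linarith [sqrt_lt_one hc1]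
  have hmg : MeasurableSet {t : I | (t : ℝ) < Real.sqrt c} :=
    measurableSet_lt (by fun_prop) measurable_const
  have hq := volume_real_lt (Real.sqrt_nonneg c) (sqrt_lt_one hc1).le
  have gen : ∀ (S : Set (ι → I)) [DecidablePred (· ∈ S)], MeasurableSet S → ∀ val : ℝ,
      ∫ ω, (if ω ∈ S then val else 0) ∂(randLaw ι) = (randLaw ι).real S * val := by
    intro S _ hS val
    have : (fun ω => if ω ∈ S then val else 0) = S.indicator fun _ => val := by
      ext ω; simp [Set.indicator_apply]
    rw [this, integral_indicator_const _ hS, smul_eq_mul]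
  rcases le_or_gt (d * (1 - Real.sqrt c)) p with hle | hlt
  · have hS : MeasurableSet {ω : ι → I | (ω a : ℝ) < Real.sqrt c} :=
      hmg.preimage (measurable_pi_apply a)
    have hμ : (randLaw ι).real {ω : ι → I | (ω a : ℝ) < Real.sqrt c} = Real.sqrt c := by
      have := measureReal_two hab hmg MeasurableSet.univ
      rw [hq] at this
      simpa using this
    have hg := fun val => (gen _ hS val).trans (congrArg (· * val) hμ)
    simp_rw [(passOn_eq_indicator hc1 hd).2 _ _ hle, ite_pow]
    refine ⟨hg _, ?_⟩
    rw [passOnSq, if_pos hle]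
    simpa using hg ((p / d) ^ 2)
  · set α := p / (d * (1 - Real.sqrt c)) with hα
    have hα0 : 0 ≤ α := by positivity
    have hα1 : α ≤ 1 := by rw [hα, div_le_one (by positivity)]; exact hlt.le
    have hI : Measurable fun t : I => (t : ℝ) := by fun_prop
    have hmr : MeasurableSet {t : I | 0 < (t : ℝ) ∧ (t : ℝ) ≤ α} :=
      (measurableSet_lt measurable_const hI).inter (measurableSet_le hI measurable_const)
    have hS : MeasurableSet
        {ω : ι → I | (ω a : ℝ) < Real.sqrt c ∧ (0 < (ω b : ℝ) ∧ (ω b : ℝ) ≤ α)} :=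
      (hmg.preimage (measurable_pi_apply a)).inter (hmr.preimage (measurable_pi_apply b))
    have hμ : (randLaw ι).real {ω : ι → I | (ω a : ℝ) < Real.sqrt c ∧
        (0 < (ω b : ℝ) ∧ (ω b : ℝ) ≤ α)} = Real.sqrt c * α := by
      have := measureReal_two hab hmg hmr
      rw [hq, volume_real_Ioc hα0 hα1] at this
      exact this
    simp_rw [(passOn_eq_indicator hc1 hd).1 _ _ hlt, ite_pow]
    refine ⟨?_, ?_⟩
    · refine (gen _ hS _).trans ?_
      rw [hμ, hα]; field_simp
    · rw [passOnSq, if_neg (not_le.2 hlt)]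
      have := gen _ hS ((1 - Real.sqrt c) ^ 2)
      rw [hμ, hα] at this
      refine Eq.trans (by simp) (this.trans ?_)
      field_simp

/-! ### Moments of one level of the backward walk, given the previous level. -/

section Sum

variable {d : ℝ} {p : V → ℝ} (i : ℕ) (s : Finset V)

theorem memLp_passOn (hc1 : c < 1) (hd : 0 < d) (hp : ∀ x, 0 ≤ p x) (x : V) :
    MemLp (fun ω : BackDraw V → I => passOn c d (p x) (ω (.gate i x)) (ω (.cut i x))) 2
      (randLaw (BackDraw V)) := by
  refine MemLp.of_bound ?_ ((p x + d) / d) (.of_forall fun ω => ?_)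
  · exact (measurable_passOn_comp c d (p x) (measurable_pi_apply (BackDraw.gate i x))
      (measurable_pi_apply (BackDraw.cut i x))).aestronglyMeasurable
  · rw [Real.norm_of_nonneg (passOn_nonneg hc1 hd.le (hp x) _ _)]
    exact passOn_le hc1 hd (hp x) (by linarith) (by linarith [hp x]) _ _

/-- The draws of one level of the backward walk. -/
def BackDraw.ofLevel (i : ℕ) : V × Bool → BackDraw V
  | (x, true) => .gate i x
  | (x, false) => .cut i x

theorem iIndepFun_passOn (c d : ℝ) (p : V → ℝ) :
    iIndepFun (fun (x : V) (ω : BackDraw V → I) =>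
      passOn c d (p x) (ω (.gate i x)) (ω (.cut i x))) (randLaw (BackDraw V)) := by
  have he : Function.Injective (BackDraw.ofLevel (V := V) i) := by
    rintro ⟨x, _ | _⟩ ⟨y, _ | _⟩ h <;> simp_all [BackDraw.ofLevel]
  refine (iIndepFun_blocks he).comp (fun x (b : Bool → I) => passOn c d (p x) (b true) (b false))
    fun x => ?_
  exact measurable_passOn_comp c d (p x) (measurable_pi_apply _) (measurable_pi_apply _)

theorem integral_sum_passOn (hc1 : c < 1) (hd : 0 < d) (hp : ∀ x, 0 ≤ p x) :
    ∫ ω, ∑ x ∈ s, passOn c d (p x) (ω (.gate i x)) (ω (.cut i x)) ∂(randLaw (BackDraw V))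
      = Real.sqrt c / d * ∑ x ∈ s, p x := by
  rw [integral_finsetSum _ fun x _ => (memLp_passOn i hc1 hd hp x).integrable one_le_two,
    Finset.mul_sum]
  refine Finset.sum_congr rfl fun x _ => ?_
  rw [(integral_passOn_pow hc1 hd (hp x) (by simp)).1]
  ring

theorem integral_sum_passOn_sq (hc1 : c < 1) (hd : 0 < d) (hp : ∀ x, 0 ≤ p x) :
    ∫ ω, (∑ x ∈ s, passOn c d (p x) (ω (.gate i x)) (ω (.cut i x))) ^ 2 ∂(randLaw (BackDraw V))
      = ∑ x ∈ s, (passOnSq c d (p x) - (Real.sqrt c * (p x / d)) ^ 2)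
        + (Real.sqrt c / d * ∑ x ∈ s, p x) ^ 2 := by
  have hL := memLp_passOn i hc1 hd hp
  have h := IndepFun.variance_sum (s := s) (fun x _ => hL x) fun x _ y _ hxy =>
    (iIndepFun_passOn i c d p).indepFun hxy
  rw [variance_eq_sub (memLp_finsetSum' s fun x _ => hL x)] at h
  simp_rw [fun x => variance_eq_sub (hL x)] at h
  simp only [Pi.pow_apply, Finset.sum_apply] at h
  rw [integral_sum_passOn i s hc1 hd hp, sub_eq_iff_eq_add] at h
  rw [h]
  congr 1
  refine Finset.sum_congr rfl fun x _ => ?_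
  rw [(integral_passOn_pow hc1 hd (hp x) (by simp)).1,
    (integral_passOn_pow hc1 hd (hp x) (by simp)).2]

/-- By independence the second moment is the sum of the variances plus the squared mean, and
Cauchy–Schwarz bounds the latter. The right-hand side is arranged so that the coefficients of p² and
p add up to 1: if E p² ≤ E p on one level, the same holds on the next. -/
theorem integral_sum_passOn_sq_le (hc1 : c < 1) (hd : 1 ≤ d) (hs : (s.card : ℝ) = d)
    (hp : ∀ x, p x = 0 ∨ 1 - Real.sqrt c ≤ p x) :
    ∫ ω, (∑ x ∈ s, passOn c d (p x) (ω (.gate i x)) (ω (.cut i x))) ^ 2 ∂(randLaw (BackDraw V))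
      ≤ Real.sqrt c / d * ∑ x ∈ s, ((1 / d + Real.sqrt c * (1 - 1 / d)) * p x ^ 2 +
        (1 - 1 / d) * (1 - Real.sqrt c) * p x) := by
  have hd0 : 0 < d := by linarith
  have hq := sqrt_lt_one hc1
  have hq0 := Real.sqrt_nonneg c
  set q := Real.sqrt c with hqdef
  have hp0 : ∀ x, 0 ≤ p x := fun x => by rcases hp x with h | h <;> linarith
  rw [integral_sum_passOn_sq i s hc1 hd0 hp0]
  have hcs : (∑ x ∈ s, p x) ^ 2 ≤ d * ∑ x ∈ s, p x ^ 2 := by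
    rw [← hs]; exact sq_sum_le_card_mul_sum_sq
  have h1 : (q / d * ∑ x ∈ s, p x) ^ 2 ≤ ∑ x ∈ s, q ^ 2 / d * p x ^ 2 := by
    rw [← Finset.mul_sum, mul_pow]
    calc (q / d) ^ 2 * (∑ x ∈ s, p x) ^ 2 ≤ (q / d) ^ 2 * (d * ∑ x ∈ s, p x ^ 2) := by gcongr
      _ = _ := by field_simp
  refine (add_le_add le_rfl h1).trans ?_
  rw [← Finset.sum_add_distrib, Finset.mul_sum]
  refine Finset.sum_le_sum fun x _ => ?_
  have hd1 : 0 ≤ 1 - 1 / d := by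
    rw [sub_nonneg, div_le_one hd0]; exact hd
  have key : passOnSq c d (p x) ≤ q / d * (p x ^ 2 / d + (1 - 1 / d) * (1 - q) * p x) := by
    unfold passOnSq
    rw [← hqdef]
    split_ifs with h
    · have : q / d * (p x ^ 2 / d + (1 - 1 / d) * (1 - q) * p x) =
          q * (p x / d) ^ 2 + q / d * ((1 - 1 / d) * (1 - q) * p x) := by field_simp
      rw [this]
      have : 0 ≤ q / d * ((1 - 1 / d) * (1 - q) * p x) := by
        have := hp0 x
        have : 0 ≤ 1 - q := by linarith
        positivity
      linarith
    -- The difference is a nonnegative multiple of p(p-(1-q)), which is where the gap between 0 and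
    -- 1-√c is used.
    · have : q / d * (p x ^ 2 / d + (1 - 1 / d) * (1 - q) * p x) - q * (1 - q) * (p x / d) =
          q / d ^ 2 * (p x * (p x - (1 - q))) := by field_simp; ring
      have : 0 ≤ q / d ^ 2 * (p x * (p x - (1 - q))) := by
        rcases hp x with h0 | h0
        · simp [h0]
        · have := hp0 x
          have : 0 ≤ p x - (1 - q) := by linarith
          positivity
      linarith
  have : q / d * ((1 / d + q * (1 - 1 / d)) * p x ^ 2 + (1 - 1 / d) * (1 - q) * p x) =
      q / d * (p x ^ 2 / d + (1 - 1 / d) * (1 - q) * p x) +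
        (q ^ 2 / d * p x ^ 2 - (q * (p x / d)) ^ 2) := by field_simp; ring
  rw [this]
  linarith

end Sum

/-- The values on level i depend only on draws of lower levels, so resampling the rest leaves them
fixed and makes the draws of level i fresh. This replaces conditional expectations. -/
theorem backEst_merge (w : V) (i : ℕ) (y : V) (ω ω' : BackDraw V → I) :
    backEst G c w (merge {d | d.level < i} (ω, ω')) (i + 1) y = ∑ x ∈ inNbrs G y,
      passOn c (inDeg G y) (backEst G c w ω i x) (ω' (.gate i x)) (ω' (.cut i x)) := by
  rw [backEst_succ]
  refine Finset.sum_congr rfl fun x _ => ?_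
  rw [merge_of_notMem (by simp [BackDraw.level]), merge_of_notMem (by simp [BackDraw.level]),
    backEst_congr w (r' := ω) fun d hd => merge_of_mem (A := {d : BackDraw V | d.level < i}) hd _]

theorem integrable_backEst_pow (hc1 : c < 1) (w : V) (i n : ℕ) (y : V) :
    Integrable (fun r => backEst G c w r i y ^ n) (randLaw (BackDraw V)) := by
  refine Integrable.of_bound ((measurable_backEst w i y).pow_const n).aestronglyMeasurable
    ((Fintype.card V : ℝ) ^ n) (.of_forall fun r => ?_)
  have h := backEst_nonneg (G := G) hc1 w r i y
  rw [norm_pow, Real.norm_of_nonneg h]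
  exact pow_le_pow_left₀ h (backEst_le_card hc1 w r i y) n

theorem abs_backEst_pow_le (hc1 : c < 1) (w : V) (r : BackDraw V → I) (i n : ℕ) (y : V) :
    |backEst G c w r i y ^ n| ≤ (Fintype.card V : ℝ) ^ n := by
  have h := backEst_nonneg (G := G) hc1 w r i y
  rw [abs_of_nonneg (pow_nonneg h n)]
  exact pow_le_pow_left₀ h (backEst_le_card hc1 w r i y) n

/-- The backward walk is unbiased. -/
theorem integral_backEst (hc1 : c < 1) (w : V) (i : ℕ) (y : V) :
    ∫ r, backEst G c w r i y ∂(randLaw (BackDraw V)) = termProb G c i y w := by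
  induction i generalizing y with
  | zero => simp [backEst, termProb]
  | succ i ih =>
    rw [termProb, sum_trans_mul]
    rcases Nat.eq_zero_or_pos (inDeg G y) with h0 | h0
    · have : inNbrs G y = ∅ := Finset.card_eq_zero.1 h0
      simp [backEst_succ, this]
    have hd : (0 : ℝ) < inDeg G y := by exact_mod_cast h0
    rw [integral_merge {d | d.level < i} (measurable_backEst w (i + 1) y)
      (fun r => by simpa using abs_backEst_pow_le hc1 w r (i + 1) 1 y)]
    simp_rw [backEst_merge]
    simp_rw [fun ω => integral_sum_passOn i (inNbrs G y) hc1 hd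
      (backEst_nonneg (G := G) hc1 w ω i)]
    rw [integral_const_mul, integral_finsetSum _ fun x _ => by
      simpa using integrable_backEst_pow hc1 w i 1 x]
    simp_rw [ih]

/-- The second moment of the backward walk is at most its mean. -/
theorem integral_backEst_sq_le (hc1 : c < 1) (w : V) (i : ℕ) (y : V) :
    ∫ r, backEst G c w r i y ^ 2 ∂(randLaw (BackDraw V)) ≤ termProb G c i y w := by
  have hq := sqrt_lt_one hc1
  have hq0 := Real.sqrt_nonneg c
  induction i generalizing y with
  | zero =>
    simp only [backEst, termProb]
    split_ifs
    · simp; nlinarith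
    · simp
  | succ i ih =>
    rw [termProb, sum_trans_mul]
    rcases Nat.eq_zero_or_pos (inDeg G y) with h0 | h0
    · have : inNbrs G y = ∅ := Finset.card_eq_zero.1 h0
      simp [backEst_succ, this]
    have hd : (1 : ℝ) ≤ inDeg G y := by exact_mod_cast h0
    have hint : ∀ x n, Integrable (fun r => backEst G c w r i x ^ n) (randLaw (BackDraw V)) :=
      fun x n => integrable_backEst_pow hc1 w i n x
    have hint1 : ∀ x, Integrable (fun r => backEst G c w r i x) (randLaw (BackDraw V)) :=
      fun x => by simpa using hint x 1
    have hd1 : 0 ≤ 1 - 1 / (inDeg G y : ℝ) := by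
      rw [sub_nonneg, div_le_one (by linarith)]; exact hd
    rw [integral_merge {d | d.level < i} ((measurable_backEst w (i + 1) y).pow_const 2)
      (fun r => abs_backEst_pow_le hc1 w r (i + 1) 2 y)]
    simp_rw [backEst_merge]
    set d : ℝ := (↑(inDeg G y) : ℝ) with hddef
    set q := Real.sqrt c
    have hint2 : ∀ x, Integrable (fun r => (1 / d + q * (1 - 1 / d)) * backEst G c w r i x ^ 2 +
        (1 - 1 / d) * (1 - q) * backEst G c w r i x) (randLaw (BackDraw V)) :=
      fun x => ((hint x 2).const_mul _).add ((hint1 x).const_mul _)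
    refine (integral_mono_of_nonneg (.of_forall fun ω => integral_nonneg fun _ => sq_nonneg _)
      ((integrable_finsetSum (inNbrs G y) fun x _ => hint2 x).const_mul (q / d))
      (.of_forall fun ω => integral_sum_passOn_sq_le i (inNbrs G y) hc1 hd rfl
        (backEst_eq_zero_or_ge hc1 w ω i))).trans ?_
    rw [integral_const_mul, integral_finsetSum _ fun x _ => hint2 x]
    refine mul_le_mul_of_nonneg_left (Finset.sum_le_sum fun x _ => ?_) (by positivity)
    rw [integral_add ((hint x 2).const_mul _) ((hint1 x).const_mul _), integral_const_mul,
      integral_const_mul, integral_backEst hc1]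
    have h1 : 0 ≤ 1 / d + q * (1 - 1 / d) := by positivity
    have := mul_le_mul_of_nonneg_left (ih x) h1
    have h2 : (1 / d + q * (1 - 1 / d)) * termProb G c i x w +
        (1 - 1 / d) * (1 - q) * termProb G c i x w = termProb G c i x w := by ring
    linarith

end Backward

/-! ### The index -/

section Index

variable {V : Type*} [Fintype V] {G : Digraph V} {c ε : ℝ}

theorem sum_termProb_le (hc1 : c < 1) (u : V) (l : ℕ) :
    ∑ w, termProb G c l u w ≤ (1 - Real.sqrt c) * Real.sqrt c ^ l := by
  classical
  induction l generalizing u with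
  | zero => simp [termProb]
  | succ l ih =>
    have h : 0 ≤ 1 - Real.sqrt c := by linarith [sqrt_lt_one hc1]
    simp only [termProb]
    rw [Finset.sum_comm]
    simp_rw [← Finset.mul_sum]
    calc _ ≤ ∑ x, trans G c u x * ((1 - Real.sqrt c) * Real.sqrt c ^ l) :=
          Finset.sum_le_sum fun x _ => mul_le_mul_of_nonneg_left (ih x) (trans_nonneg u x)
      _ ≤ Real.sqrt c * ((1 - Real.sqrt c) * Real.sqrt c ^ l) := by
          rw [← Finset.sum_mul]
          exact mul_le_mul_of_nonneg_right (sum_trans_le u) (by positivity)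
      _ = _ := by ring

theorem sum_sum_termProb_le (hc1 : c < 1) (u : V) (L : ℕ) :
    ∑ l ∈ Finset.range L, ∑ w, termProb G c l u w ≤ 1 := by
  have h : 0 < 1 - Real.sqrt c := by linarith [sqrt_lt_one hc1]
  have h0 : 0 ≤ Real.sqrt c ^ L := by positivity
  refine (Finset.sum_le_sum fun l _ => sum_termProb_le hc1 u l).trans ?_
  rw [← Finset.mul_sum, geom_sum_eq (by linarith)]
  rw [← neg_div_neg_eq, neg_sub, neg_sub, mul_div_cancel₀ _ h.ne']
  linarith

theorem summable_termProb (hc1 : c < 1) (u : V) :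
    Summable fun p : V × ℕ => termProb G c p.2 u p.1 := by
  have h : Summable fun p : ℕ × V => termProb G c p.1 u p.2 := by
    rw [summable_prod_of_nonneg fun p => termProb_nonneg hc1 _ _ _]
    refine ⟨fun l => Summable.of_finite, ?_⟩
    simp_rw [tsum_fintype]
    exact summable_of_sum_range_le
      (fun l => Finset.sum_nonneg fun w _ => termProb_nonneg hc1 _ _ _)
      (sum_sum_termProb_le hc1 u)
  exact (Equiv.prodComm V ℕ).summable_iff.2 h

theorem tsum_termProb_le (hc1 : c < 1) (u : V) :
    ∑' p : V × ℕ, termProb G c p.2 u p.1 ≤ 1 := by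
  have h : Summable fun p : ℕ × V => termProb G c p.1 u p.2 :=
    (Equiv.prodComm V ℕ).summable_iff.1 (summable_termProb hc1 u)
  rw [← (Equiv.prodComm ℕ V).tsum_eq]
  refine (h.tsum_prod' fun l => Summable.of_finite).trans_le ?_
  simp_rw [tsum_fintype]
  exact Real.tsum_le_of_sum_range_le
    (fun l => Finset.sum_nonneg fun w _ => termProb_nonneg hc1 _ _ _) (sum_sum_termProb_le hc1 u)

theorem termProb_le (hc1 : c < 1) (u w : V) (l : ℕ) :
    termProb G c l u w ≤ 1 - Real.sqrt c := by
  have h : 0 ≤ 1 - Real.sqrt c := by linarith [sqrt_lt_one hc1]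
  calc termProb G c l u w ≤ ∑ w, termProb G c l u w :=
        Finset.single_le_sum (f := fun w => termProb G c l u w)
          (fun x _ => termProb_nonneg hc1 l u x) (Finset.mem_univ w)
    _ ≤ (1 - Real.sqrt c) * Real.sqrt c ^ l := sum_termProb_le hc1 u l
    _ ≤ (1 - Real.sqrt c) * 1 := by
        gcongr
        exact pow_le_one₀ (Real.sqrt_nonneg c) (sqrt_lt_one hc1).le
    _ = _ := mul_one _

theorem c₁_pos (hc1 : c < 1) : 0 < c₁ c := by
  have h : 0 < 1 - Real.sqrt c := by linarith [sqrt_lt_one hc1]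
  unfold c₁; positivity

theorem rmax_pos (hc1 : c < 1) (hε : 0 < ε) : 0 < rmax c ε := div_pos hε (c₁_pos hc1)

theorem reserve_nonneg (hc1 : c < 1) (hε : 0 < ε) (w : V) (l : ℕ) (v : V) :
    0 ≤ reserve G c ε w l v := by
  have h : 0 ≤ 1 - Real.sqrt c := by linarith [sqrt_lt_one hc1]
  unfold reserve
  split_ifs with h1
  · exact mul_nonneg h ((rmax_pos hc1 hε).trans h1).le
  · rfl

/-- Scaled by 1-√c, the residues obey the recursion of `termProb`, except that thresholded reserves
are fed in. -/
theorem residue_succ (w : V) (l : ℕ) (z : V) :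
    (1 - Real.sqrt c) * residue G c ε w (l + 1) z =
      ∑ x, trans G c z x * reserve G c ε w l x := by
  rw [sum_trans_mul, residue, Finset.mul_sum, Finset.mul_sum]
  refine Finset.sum_congr rfl fun x _ => ?_
  unfold reserve
  split_ifs
  · ring
  · ring

/-- The backward search underestimates, by at most `r_max`. -/
theorem termProb_sub_reserve (hc1 : c < 1) (hε : 0 < ε) (w : V) (l : ℕ) (v : V) :
    reserve G c ε w l v ≤ termProb G c l v w ∧
      termProb G c l v w ≤ reserve G c ε w l v + rmax c ε := by
  have hq : 0 < 1 - Real.sqrt c := by linarith [sqrt_lt_one hc1]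
  have hr := rmax_pos hc1 hε
  -- Thresholding loses at most (1-√c) r_max on top of an inherited error √c r_max, in total r_max.
  -- One more transition multiplies this by at most √c, so the error does not accumulate over
  -- levels.
  have key : ∀ l v, (1 - Real.sqrt c) * residue G c ε w l v ≤ termProb G c l v w →
      termProb G c l v w ≤ (1 - Real.sqrt c) * residue G c ε w l v + Real.sqrt c * rmax c ε →
      reserve G c ε w l v ≤ termProb G c l v w ∧
        termProb G c l v w ≤ reserve G c ε w l v + rmax c ε := by
    intro l v h1 h2
    have h0 := termProb_nonneg (G := G) hc1 l v w
    have hq0 := Real.sqrt_nonneg c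
    unfold reserve
    split_ifs with h
    · exact ⟨h1, by nlinarith⟩
    · exact ⟨h0, by nlinarith⟩
  induction l generalizing v with
  | zero =>
    have hq0 := Real.sqrt_nonneg c
    refine key 0 v ?_ ?_ <;> rw [residue, termProb] <;> split_ifs <;>
      simp [mul_nonneg hq0 hr.le]
  | succ l ih =>
    refine key (l + 1) v ?_ ?_
    · rw [residue_succ, termProb]
      exact Finset.sum_le_sum fun x _ => mul_le_mul_of_nonneg_left (ih x).1 (trans_nonneg v x)
    · rw [residue_succ, termProb]
      calc _ ≤ ∑ x, trans G c v x * (reserve G c ε w l x + rmax c ε) :=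
            Finset.sum_le_sum fun x _ => mul_le_mul_of_nonneg_left (ih x).2 (trans_nonneg v x)
        _ = ∑ x, trans G c v x * reserve G c ε w l x + (∑ x, trans G c v x) * rmax c ε := by
            simp_rw [mul_add, Finset.sum_add_distrib, Finset.sum_mul]
        _ ≤ _ := by
            gcongr
            exact sum_trans_le v

open scoped Classical in
/-- The value that the index stores for `v` in the list `L_l(w)`, or `0`. -/
noncomputable def indexVal (G : Digraph V) (c ε : ℝ) (w : V) (l : ℕ) (v : V) : ℝ :=
  if InList G c ε w l v then reserve G c ε w l v else 0

theorem indexVal_nonneg (hc1 : c < 1) (hε : 0 < ε) (w : V) (l : ℕ) (v : V) :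
    0 ≤ indexVal G c ε w l v := by
  unfold indexVal
  split_ifs
  · exact reserve_nonneg hc1 hε w l v
  · rfl

theorem indexVal_le (hc1 : c < 1) (hε : 0 < ε) (w : V) (l : ℕ) (v : V) :
    indexVal G c ε w l v ≤ termProb G c l v w := by
  unfold indexVal
  split_ifs
  · exact (termProb_sub_reserve hc1 hε w l v).1
  · exact termProb_nonneg hc1 l v w

/-- One r_max comes from the search, the other from the reserves that are too small to be stored. -/
theorem le_indexVal_add (hc1 : c < 1) (hε : 0 < ε) (w : V) (l : ℕ) (v : V) :
    termProb G c l v w ≤ indexVal G c ε w l v + 2 * rmax c ε := by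
  have h := (termProb_sub_reserve (G := G) hc1 hε w l v).2
  have hr := rmax_pos hc1 hε
  unfold indexVal InList
  split_ifs with h1
  · linarith
  · linarith

end Index

/-! ### One sample of the query algorithm -/

section Sample

variable {V : Type*} [Fintype V] {G : Digraph V} {c ε : ℝ}

theorem walkAt_eq_none_of_terminatesAt {u w : V} {r : WalkDraw → I} {l : ℕ}
    (h : TerminatesAt G c u r w l) {k : ℕ} (hk : l < k) : walkAt G c u r k = none := by
  induction k, hk using Nat.le_induction with
  | base => rw [walkAt, if_neg (not_lt.2 h.2)]
  | succ k _ ih => rw [walkAt, ih]; simp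

theorem TerminatesAt.unique {u w w' : V} {r : WalkDraw → I} {l l' : ℕ}
    (h : TerminatesAt G c u r w l) (h' : TerminatesAt G c u r w' l') : w = w' ∧ l = l' := by
  have hl : l = l' := by
    rcases lt_trichotomy l l' with hlt | heq | hlt
    · have := walkAt_eq_none_of_terminatesAt h hlt
      rw [h'.1] at this; simp at this
    · exact heq
    · have := walkAt_eq_none_of_terminatesAt h' hlt
      rw [h.1] at this; simp at this
  subst hl
  exact ⟨Option.some_injective _ (h.1.symm.trans h'.1), rfl⟩

/-- The random numbers used by one sample. -/
inductive SampleDraw (V : Type*)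
  | walk (a : Fin 3) (d : WalkDraw)
  | back (d : BackDraw V)

/-- The draws of the two walks which must not meet. -/
def SampleDraw.pair : Bool × WalkDraw → SampleDraw V
  | (false, d) => .walk 1 d
  | (true, d) => .walk 2 d

theorem SampleDraw.pair_injective : Function.Injective (pair (V := V)) := by
  rintro ⟨_ | _, a⟩ ⟨_ | _, b⟩ h <;> simp_all [pair]

/-- The draws of all walks of a sample. -/
def SampleDraw.walks (p : Fin 3 × WalkDraw) : SampleDraw V := .walk p.1 p.2

/-- The draws of sample `j` in round `i`. -/
def SampleDraw.toDraw : (ℕ × ℕ) × SampleDraw V → Draw V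
  | (p, .walk a d) => .walk p.1 p.2 a d
  | (p, .back d) => .back p.1 p.2 d

theorem SampleDraw.toDraw_injective : Function.Injective (toDraw (V := V)) := by
  rintro ⟨⟨_, _⟩, _ | _⟩ ⟨⟨_, _⟩, _ | _⟩ h <;> simp_all [toDraw]

/-- The walk from `u` terminates at `w` with `l` steps, and the walks from `w` do not meet. -/
def SampleHits (G : Digraph V) (c : ℝ) (u : V) (ρ : SampleDraw V → I) (p : V × ℕ) : Prop :=
  TerminatesAt G c u (fun d => ρ (.walk 0 d)) p.1 p.2 ∧
    ¬ Meet G c p.1 (fun d => ρ (.walk 1 d)) (fun d => ρ (.walk 2 d))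

open scoped Classical in
/-- The outcome of a sample. -/
noncomputable def sampleOut (G : Digraph V) (c : ℝ) (u : V) (ρ : SampleDraw V → I) :
    Option (V × ℕ) :=
  if h : ∃ p : V × ℕ, SampleHits G c u ρ p then some h.choose else none

theorem sampleOut_eq_some {u : V} {ρ : SampleDraw V → I} {p : V × ℕ} :
    sampleOut G c u ρ = some p ↔ SampleHits G c u ρ p := by
  unfold sampleOut
  constructor
  · intro h
    split_ifs at h with h'
    obtain rfl := Option.some_injective _ h
    exact h'.choose_spec
  · intro h
    have h' : ∃ p, SampleHits G c u ρ p := ⟨p, h⟩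
    rw [dif_pos h']
    have := h'.choose_spec.1.unique h.1
    exact congrArg some (Prod.ext this.1 this.2)

/-- The probability that a sample has the outcome `p`. -/
noncomputable def hitProb (G : Digraph V) (c : ℝ) (u : V) (p : V × ℕ) : ℝ :=
  termProb G c p.2 u p.1 * noMeetProb G c p.1

theorem hitProb_nonneg (hc1 : c < 1) (u : V) (p : V × ℕ) : 0 ≤ hitProb G c u p :=
  mul_nonneg (termProb_nonneg hc1 _ _ _) (noMeetProb_nonneg _)

theorem hitProb_le (hc1 : c < 1) (u : V) (p : V × ℕ) :
    hitProb G c u p ≤ termProb G c p.2 u p.1 :=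
  mul_le_of_le_one_right (termProb_nonneg hc1 _ _ _) (noMeetProb_le_one _)

theorem summable_hitProb (hc1 : c < 1) (u : V) : Summable (hitProb G c u) :=
  (summable_termProb hc1 u).of_nonneg_of_le (hitProb_nonneg hc1 u) (hitProb_le hc1 u)

theorem tsum_hitProb_le (hc1 : c < 1) (u : V) : ∑' p, hitProb G c u p ≤ 1 :=
  ((summable_hitProb hc1 u).tsum_le_tsum (hitProb_le hc1 u) (summable_termProb hc1 u)).trans
    (tsum_termProb_le hc1 u)

theorem simTerm_eq (u v : V) (p : V × ℕ) : simTerm G c u v p.1 p.2 =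
    hitProb G c u p * termProb G c p.2 v p.1 / (1 - Real.sqrt c) ^ 2 := by
  rw [simTerm, hitProb]; ring

theorem measurableSet_sampleHits (u : V) (p : V × ℕ) :
    MeasurableSet {ρ : SampleDraw V → I | SampleHits G c u ρ p} := by
  have h1 : Measurable fun (ρ : SampleDraw V → I) d => ρ (SampleDraw.walk 0 d) := by fun_prop
  have h2 : Measurable fun (ρ : SampleDraw V → I) q => ρ (SampleDraw.pair q) := by fun_prop
  exact (h1 (measurableSet_terminatesAt u p.1 p.2)).inter
    (h2 (measurableSet_meetFrom 1 p.1 p.1)).compl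

theorem measureReal_sampleHits (hc1 : c < 1) (u : V) (p : V × ℕ) :
    (randLaw (SampleDraw V)).real {ρ | SampleHits G c u ρ p} = hitProb G c u p := by
  have hd : Disjoint (Set.range fun d : WalkDraw => SampleDraw.walk (V := V) 0 d)
      (Set.range SampleDraw.pair) := by
    rw [Set.disjoint_range_iff]
    rintro d ⟨_ | _, d'⟩ <;> simp [SampleDraw.pair]
  have h := measureReal_inter_of_indepFun (indepFun_of_disjoint hd)
    (measurableSet_terminatesAt (G := G) (c := c) u p.1 p.2)
    (measurableSet_meetFrom (G := G) (c := c) 1 p.1 p.1).compl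
  rw [(measurePreserving_reindex fun a b h => (SampleDraw.walk.inj h).2).measureReal_preimage
      (measurableSet_terminatesAt u p.1 p.2).nullMeasurableSet,
    (measurePreserving_reindex SampleDraw.pair_injective).measureReal_preimage
      (measurableSet_meetFrom 1 p.1 p.1).compl.nullMeasurableSet,
    measureReal_terminatesAt hc1] at h
  exact h

/-- The contribution of a sample, if it is `g p b` for the outcome `p` and the draws `b` of the
backward walk. -/
noncomputable def sampleVal (G : Digraph V) (c : ℝ) (u : V)
    (g : V × ℕ → (BackDraw V → I) → ℝ) (ρ : SampleDraw V → I) : ℝ :=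
  (sampleOut G c u ρ).elim 0 fun p => g p fun d => ρ (.back d)

theorem sampleVal_of_hits {u : V} {g : V × ℕ → (BackDraw V → I) → ℝ} {ρ : SampleDraw V → I}
    {p : V × ℕ} (h : SampleHits G c u ρ p) :
    sampleVal G c u g ρ = g p fun d => ρ (.back d) := by
  rw [sampleVal, sampleOut_eq_some.2 h]; rfl

theorem sampleVal_of_not_hits {u : V} {g : V × ℕ → (BackDraw V → I) → ℝ} {ρ : SampleDraw V → I}
    (h : ∀ p, ¬ SampleHits G c u ρ p) : sampleVal G c u g ρ = 0 := by
  rw [sampleVal, sampleOut, dif_neg (not_exists.2 h)]; rfl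

variable {g : V × ℕ → (BackDraw V → I) → ℝ} {C : ℝ}

theorem measurable_sampleVal (u : V) (hg : ∀ p, Measurable (g p)) :
    Measurable (sampleVal G c u g) := by
  intro T hT
  have hb : Measurable fun (ρ : SampleDraw V → I) d => ρ (SampleDraw.back d) := by fun_prop
  have : sampleVal G c u g ⁻¹' T = ({ρ | ∀ p, ¬ SampleHits G c u ρ p} ∩ {_ρ | (0 : ℝ) ∈ T}) ∪
      ⋃ p, ({ρ | SampleHits G c u ρ p} ∩ (fun ρ => g p fun d => ρ (SampleDraw.back d)) ⁻¹' T) := by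
    ext ρ
    simp only [Set.mem_preimage, Set.mem_union, Set.mem_inter_iff, Set.mem_ofPred_eq,
      Set.mem_iUnion]
    by_cases h : ∃ p, SampleHits G c u ρ p
    · obtain ⟨p, hp⟩ := h
      rw [sampleVal_of_hits hp]
      constructor
      · exact fun h => .inr ⟨p, hp, h⟩
      · rintro (⟨h, -⟩ | ⟨p', hp', h⟩)
        · exact absurd hp (h p)
        · rwa [← sampleVal_of_hits (g := g) hp, sampleVal_of_hits hp']
    · push Not at h
      rw [sampleVal_of_not_hits h]
      constructor
      · exact fun h' => .inl ⟨h, h'⟩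
      · rintro (⟨-, h'⟩ | ⟨p', hp', -⟩)
        · exact h'
        · exact absurd hp' (h p')
  rw [this]
  refine .union (.inter ?_ (.const _)) (.iUnion fun p => (measurableSet_sampleHits u p).inter
    (((hg p).comp hb) hT))
  rw [show {ρ : SampleDraw V → I | ∀ p, ¬ SampleHits G c u ρ p} =
    ⋂ p, {ρ | SampleHits G c u ρ p}ᶜ by ext; simp]
  exact .iInter fun p => (measurableSet_sampleHits u p).compl

theorem sampleVal_cases (u : V) (ρ : SampleDraw V → I) {P : ℝ → Prop} (h0 : P 0)
    (hg : ∀ p b, P (g p b)) : P (sampleVal G c u g ρ) := by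
  rw [sampleVal]
  cases sampleOut G c u ρ with
  | none => exact h0
  | some p => exact hg p _

theorem integrable_sampleVal (u : V) (hg : ∀ p, Measurable (g p)) (hC : ∀ p b, |g p b| ≤ C)
    (hC0 : 0 ≤ C) : Integrable (sampleVal G c u g) (randLaw (SampleDraw V)) :=
  .of_bound (measurable_sampleVal u hg).aestronglyMeasurable C (.of_forall fun ρ => by
    rw [Real.norm_eq_abs]
    exact sampleVal_cases u ρ (P := fun x => |x| ≤ C) (by simpa using hC0) hC)

/-- The mean of the contribution of a sample. -/
theorem hasSum_integral_sampleVal (hc1 : c < 1) (u : V) (hg : ∀ p, Measurable (g p))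
    (hC : ∀ p b, |g p b| ≤ C) (hC0 : 0 ≤ C) :
    HasSum (fun p => hitProb G c u p * ∫ b, g p b ∂(randLaw (BackDraw V)))
      (∫ ρ, sampleVal G c u g ρ ∂(randLaw (SampleDraw V))) := by
  classical
  have hint := integrable_sampleVal (G := G) (c := c) u hg hC hC0
  -- A sample has at most one outcome, so the hit events are disjoint, and the contribution vanishes
  -- outside their union.
  have h := hasSum_integral_iUnion (μ := randLaw (SampleDraw V)) (f := sampleVal G c u g)
    (s := fun p => {ρ | SampleHits G c u ρ p}) (measurableSet_sampleHits u)
    (fun p p' hpp => Set.disjoint_left.2 fun ρ h h' => hpp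
      (Option.some_injective _ ((sampleOut_eq_some.2 h).symm.trans (sampleOut_eq_some.2 h'))))
    hint.integrableOn
  have h0 : ∀ ρ, ρ ∉ (⋃ p, {ρ | SampleHits G c u ρ p}) → sampleVal G c u g ρ = 0 :=
    fun ρ hρ => sampleVal_of_not_hits fun p hp => hρ (Set.mem_iUnion.2 ⟨p, hp⟩)
  rw [setIntegral_eq_integral_of_forall_compl_eq_zero h0] at h
  convert! h using 2 with p
  rw [← integral_indicator (measurableSet_sampleHits u p)]
  have hd : Disjoint (Set.range (SampleDraw.walks (V := V))) (Set.range SampleDraw.back) := by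
    rw [Set.disjoint_range_iff]
    rintro d d'; simp [SampleDraw.walks]
  -- Filling the backward draws with 0 exhibits a hit as an event of the walk draws alone, hence
  -- independent of the backward walk.
  have hw : Measurable fun (r : Fin 3 × WalkDraw → I) (d : SampleDraw V) =>
      (match d with | .walk a d => r (a, d) | .back _ => 0 : I) := by
    refine measurable_pi_lambda _ fun d => ?_
    cases d <;> simp only <;> fun_prop
  have hS := hw (measurableSet_sampleHits (G := G) (c := c) u p)
  have hI : Measurable (Set.indicator ((fun (r : Fin 3 × WalkDraw → I) (d : SampleDraw V) =>
      (match d with | .walk a d => r (a, d) | .back _ => 0 : I)) ⁻¹'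
        {ρ | SampleHits G c u ρ p}) (fun _ => (1 : ℝ))) := measurable_const.indicator hS
  have hi := (indepFun_of_disjoint hd).comp hI (hg p)
  have hm := hi.integral_mul_eq_mul_integral (hI.comp (by fun_prop)).aestronglyMeasurable
    ((hg p).comp (by fun_prop)).aestronglyMeasurable
  have e1 : ∀ ρ : SampleDraw V → I, {ρ | SampleHits G c u ρ p}.indicator (sampleVal G c u g) ρ =
      {ρ | SampleHits G c u ρ p}.indicator (fun _ => (1 : ℝ)) ρ *
        g p (fun d => ρ (SampleDraw.back d)) := by
    intro ρ
    by_cases h : SampleHits G c u ρ p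
    · simp [h, sampleVal_of_hits h]
    · simp [h]
  have e2 : ∫ b, g p b ∂(randLaw (BackDraw V)) =
      ∫ ρ : SampleDraw V → I, g p (fun d => ρ (SampleDraw.back d)) ∂(randLaw (SampleDraw V)) :=
    (integral_reindex (fun a b h => SampleDraw.back.inj h) (hg p)).symm
  simp_rw [e1]
  rw [e2, ← measureReal_sampleHits hc1,
    ← integral_indicator_one (measurableSet_sampleHits u p)]
  exact hm.symm

end Sample

/-! ### First and second moments of the two contributions of a sample. -/

section Moments

variable {V : Type*} [Fintype V] {G : Digraph V} {c ε : ℝ}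

open scoped Classical in
/-- The contribution of a sample to the estimator of a round, up to the factor `1 / d_r`. -/
noncomputable def backGain (G : Digraph V) (c : ℝ) (H : Finset V) (v : V) (p : V × ℕ)
    (b : BackDraw V → I) : ℝ :=
  if p.1 ∈ H then 0 else backEst G c p.1 b p.2 v / (1 - Real.sqrt c) ^ 2

open scoped Classical in
/-- The contribution of a sample to the index part, without truncation of the frequencies. -/
noncomputable def indexGain (G : Digraph V) (c ε : ℝ) (H : Finset V) (v : V) (p : V × ℕ)
    (_b : BackDraw V → I) : ℝ :=
  if p.1 ∈ H then indexVal G c ε p.1 p.2 v / (1 - Real.sqrt c) ^ 2 else 0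

open scoped Classical in
/-- The part of the SimRank that is due to the nodes outside `H`. -/
noncomputable def simBack (G : Digraph V) (c : ℝ) (H : Finset V) (u v : V) : ℝ :=
  ∑' p : V × ℕ, if p.1 ∈ H then 0 else simTerm G c u v p.1 p.2

open scoped Classical in
/-- The part of the SimRank that is due to the nodes in `H`. -/
noncomputable def simIndex (G : Digraph V) (c : ℝ) (H : Finset V) (u v : V) : ℝ :=
  ∑' p : V × ℕ, if p.1 ∈ H then simTerm G c u v p.1 p.2 else 0

open scoped Classical in
theorem hasSum_simBack (hc0 : 0 < c) (hc1 : c < 1) (H : Finset V) (u v : V) :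
    HasSum (fun p : V × ℕ => if p.1 ∈ H then 0 else simTerm G c u v p.1 p.2)
      (simBack G c H u v) := by
  obtain ⟨s, hs, -⟩ := existsUnique_isSimRank G c hc0 hc1
  refine (Summable.of_nonneg_of_le (fun p => ?_) (fun p => ?_)
    (hs.hasSum hc0 hc1 u v).summable).hasSum
  all_goals
    have := simTerm_nonneg (G := G) hc1 u v p.1 p.2
    split_ifs <;> simp [this]

open scoped Classical in
theorem hasSum_simIndex (hc0 : 0 < c) (hc1 : c < 1) (H : Finset V) (u v : V) :
    HasSum (fun p : V × ℕ => if p.1 ∈ H then simTerm G c u v p.1 p.2 else 0)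
      (simIndex G c H u v) := by
  obtain ⟨s, hs, -⟩ := existsUnique_isSimRank G c hc0 hc1
  refine (Summable.of_nonneg_of_le (fun p => ?_) (fun p => ?_)
    (hs.hasSum hc0 hc1 u v).summable).hasSum
  all_goals
    have := simTerm_nonneg (G := G) hc1 u v p.1 p.2
    split_ifs <;> simp [this]

theorem simBack_nonneg (hc1 : c < 1) (H : Finset V) (u v : V) : 0 ≤ simBack G c H u v :=
  tsum_nonneg fun p => by
    have := simTerm_nonneg (G := G) hc1 u v p.1 p.2
    split_ifs <;> simp [this]

theorem simIndex_nonneg (hc1 : c < 1) (H : Finset V) (u v : V) : 0 ≤ simIndex G c H u v :=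
  tsum_nonneg fun p => by
    have := simTerm_nonneg (G := G) hc1 u v p.1 p.2
    split_ifs <;> simp [this]

theorem IsSimRank.eq_simBack_add (hc0 : 0 < c) (hc1 : c < 1) {s : V → V → ℝ}
    (hs : IsSimRank G c s) (H : Finset V) (u v : V) :
    s u v = simBack G c H u v + simIndex G c H u v := by
  classical
  refine (hs.hasSum hc0 hc1 u v).unique ?_
  convert! (hasSum_simBack (G := G) hc0 hc1 H u v).add (hasSum_simIndex hc0 hc1 H u v) using 2 with p
  split_ifs <;> simp

variable (H : Finset V) (v : V)

theorem measurable_backGain (p : V × ℕ) : Measurable (backGain G c H v p) := by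
  unfold backGain
  split_ifs
  · exact measurable_const
  · exact (measurable_backEst p.1 p.2 v).div_const _

theorem backGain_nonneg (hc1 : c < 1) (p : V × ℕ) (b : BackDraw V → I) :
    0 ≤ backGain G c H v p b := by
  unfold backGain
  split_ifs
  · rfl
  · exact div_nonneg (backEst_nonneg hc1 _ _ _ _) (sq_nonneg _)

theorem backGain_le (hc1 : c < 1) (p : V × ℕ) (b : BackDraw V → I) :
    backGain G c H v p b ≤ Fintype.card V / (1 - Real.sqrt c) ^ 2 := by
  unfold backGain
  split_ifs
  · positivity
  · gcongr
    exact backEst_le_card hc1 _ _ _ _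

theorem measurable_indexGain (p : V × ℕ) : Measurable (indexGain G c ε H v p) :=
  measurable_const

theorem indexGain_nonneg (hc1 : c < 1) (hε : 0 < ε) (p : V × ℕ) (b : BackDraw V → I) :
    0 ≤ indexGain G c ε H v p b := by
  unfold indexGain
  split_ifs
  · exact div_nonneg (indexVal_nonneg hc1 hε _ _ _) (sq_nonneg _)
  · rfl

theorem indexGain_le (hc1 : c < 1) (hε : 0 < ε) (p : V × ℕ) (b : BackDraw V → I) :
    indexGain G c ε H v p b ≤ 1 / (1 - Real.sqrt c) := by
  have hq : 0 < 1 - Real.sqrt c := by linarith [sqrt_lt_one hc1]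
  unfold indexGain
  split_ifs
  · rw [div_le_div_iff₀ (by positivity) hq]
    have := (indexVal_le (G := G) hc1 hε p.1 p.2 v).trans (termProb_le hc1 v p.1 p.2)
    nlinarith
  · positivity

theorem sampleVal_pow {n : ℕ} (hn : n ≠ 0) (u : V) (g : V × ℕ → (BackDraw V → I) → ℝ)
    (ρ : SampleDraw V → I) :
    sampleVal G c u g ρ ^ n = sampleVal G c u (fun p b => g p b ^ n) ρ := by
  unfold sampleVal
  cases sampleOut G c u ρ <;> simp [hn]

theorem sampleVal_back_mul_index (u : V) (ρ : SampleDraw V → I) :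
    sampleVal G c u (backGain G c H v) ρ * sampleVal G c u (indexGain G c ε H v) ρ = 0 := by
  unfold sampleVal
  cases sampleOut G c u ρ with
  | none => simp
  | some p => simp only [Option.elim_some, backGain, indexGain]; split_ifs <;> simp

theorem abs_backGain_le (hc1 : c < 1) (p : V × ℕ) (b : BackDraw V → I) :
    |backGain G c H v p b| ≤ Fintype.card V / (1 - Real.sqrt c) ^ 2 := by
  rw [abs_of_nonneg (backGain_nonneg H v hc1 p b)]
  exact backGain_le H v hc1 p b

theorem abs_indexGain_le (hc1 : c < 1) (hε : 0 < ε) (p : V × ℕ) (b : BackDraw V → I) :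
    |indexGain G c ε H v p b| ≤ 1 / (1 - Real.sqrt c) := by
  rw [abs_of_nonneg (indexGain_nonneg H v hc1 hε p b)]
  exact indexGain_le H v hc1 hε p b

theorem integral_sampleVal_back (hc0 : 0 < c) (hc1 : c < 1) (u : V) :
    ∫ ρ, sampleVal G c u (backGain G c H v) ρ ∂(randLaw (SampleDraw V)) = simBack G c H u v := by
  classical
  refine (hasSum_integral_sampleVal hc1 u (measurable_backGain H v) (abs_backGain_le H v hc1)
    (by positivity)).unique ?_
  convert! hasSum_simBack (G := G) hc0 hc1 H u v using 2 with p
  unfold backGain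
  split_ifs
  · simp
  · rw [integral_div, integral_backEst hc1, simTerm_eq]; ring

/-- Conditionally on the outcome, the second moment of the backward walk is at most its mean, so
squaring costs only one more factor (1-√c)⁻². Keeping `simBack` instead of 1 in the bound pays off
in the lower tail. -/
theorem integral_sampleVal_back_sq (hc0 : 0 < c) (hc1 : c < 1) (u : V) :
    ∫ ρ, sampleVal G c u (backGain G c H v) ρ ^ 2 ∂(randLaw (SampleDraw V)) ≤
      simBack G c H u v / (1 - Real.sqrt c) ^ 2 := by
  classical
  simp_rw [sampleVal_pow two_ne_zero]
  have h := hasSum_integral_sampleVal (G := G) hc1 u (g := fun p b => backGain G c H v p b ^ 2)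
    (fun p => (measurable_backGain H v p).pow_const 2) (C := (Fintype.card V / (1 - Real.sqrt c) ^ 2) ^ 2)
    (fun p b => by
      rw [abs_pow]; exact pow_le_pow_left₀ (abs_nonneg _) (abs_backGain_le H v hc1 p b) 2)
    (sq_nonneg _)
  refine hasSum_le (fun p => ?_) h
    ((hasSum_simBack (G := G) hc0 hc1 H u v).div_const ((1 - Real.sqrt c) ^ 2))
  unfold backGain
  split_ifs
  · simp
  · simp_rw [div_pow]
    rw [integral_div, simTerm_eq, mul_div_assoc, mul_div_assoc, div_div, ← pow_two]
    refine mul_le_mul_of_nonneg_left ?_ (hitProb_nonneg hc1 u p)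
    gcongr
    exact integral_backEst_sq_le hc1 _ _ _

/-- `indexGain` ignores the backward draws, so its integral is its value; the argument `0` is a
placeholder. -/
theorem hasSum_integral_sampleVal_index (hc1 : c < 1) (hε : 0 < ε) (u : V) :
    HasSum (fun p => hitProb G c u p * indexGain G c ε H v p 0)
      (∫ ρ, sampleVal G c u (indexGain G c ε H v) ρ ∂(randLaw (SampleDraw V))) := by
  have hq : 0 < 1 - Real.sqrt c := by linarith [sqrt_lt_one hc1]
  convert! hasSum_integral_sampleVal (G := G) hc1 u (measurable_indexGain (ε := ε) H v)
    (abs_indexGain_le H v hc1 hε) (by positivity) using 3 with p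
  unfold indexGain
  simp

theorem integral_sampleVal_index_le (hc0 : 0 < c) (hc1 : c < 1) (hε : 0 < ε) (u : V) :
    ∫ ρ, sampleVal G c u (indexGain G c ε H v) ρ ∂(randLaw (SampleDraw V)) ≤
      simIndex G c H u v := by
  classical
  refine hasSum_le (fun p => ?_) (hasSum_integral_sampleVal_index H v hc1 hε u)
    (hasSum_simIndex (G := G) hc0 hc1 H u v)
  unfold indexGain
  split_ifs
  · rw [simTerm_eq, mul_div_assoc]
    exact mul_le_mul_of_nonneg_left (div_le_div_of_nonneg_right (indexVal_le hc1 hε _ _ _)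
      (by positivity)) (hitProb_nonneg hc1 u p)
  · simp

theorem rmax_div (hc1 : c < 1) : rmax c ε / (1 - Real.sqrt c) ^ 2 = ε / 12 := by
  have hq : 0 < 1 - Real.sqrt c := by linarith [sqrt_lt_one hc1]
  unfold rmax c₁
  field_simp

/-- Each outcome loses at most 2 r_max/(1-√c)² = ε/6, weighted by hit probabilities of total mass at
most 1. -/
theorem le_integral_sampleVal_index (hc0 : 0 < c) (hc1 : c < 1) (hε : 0 < ε) (u : V) :
    simIndex G c H u v - ε / 6 ≤
      ∫ ρ, sampleVal G c u (indexGain G c ε H v) ρ ∂(randLaw (SampleDraw V)) := by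
  classical
  have hr := rmax_div (ε := ε) hc1
  have h1 : simIndex G c H u v ≤
      ∫ ρ, sampleVal G c u (indexGain G c ε H v) ρ ∂(randLaw (SampleDraw V)) +
        (∑' p, hitProb G c u p) * (ε / 6) := by
    refine hasSum_le (fun p => ?_) (hasSum_simIndex (G := G) hc0 hc1 H u v)
      ((hasSum_integral_sampleVal_index H v hc1 hε u).add
        ((summable_hitProb hc1 u).hasSum.mul_right (ε / 6)))
    have h0 := hitProb_nonneg (G := G) hc1 u p
    unfold indexGain
    split_ifs
    · rw [simTerm_eq, mul_div_assoc, ← mul_add]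
      refine mul_le_mul_of_nonneg_left ?_ h0
      calc _ ≤ (indexVal G c ε p.1 p.2 v + 2 * rmax c ε) / (1 - Real.sqrt c) ^ 2 := by
            gcongr; exact le_indexVal_add hc1 hε _ _ _
        _ = indexVal G c ε p.1 p.2 v / (1 - Real.sqrt c) ^ 2 +
            2 * (rmax c ε / (1 - Real.sqrt c) ^ 2) := by ring
        _ = _ := by rw [hr]; ring
    · simp only [mul_zero, zero_add]; positivity
  have h2 := tsum_hitProb_le (G := G) hc1 u
  nlinarith

theorem integral_sampleVal_index_sq (hc0 : 0 < c) (hc1 : c < 1) (hε : 0 < ε) (u : V) :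
    ∫ ρ, sampleVal G c u (indexGain G c ε H v) ρ ^ 2 ∂(randLaw (SampleDraw V)) ≤
      simIndex G c H u v / (1 - Real.sqrt c) := by
  have hq : 0 < 1 - Real.sqrt c := by linarith [sqrt_lt_one hc1]
  have hint := integrable_sampleVal (G := G) (c := c) u (measurable_indexGain (G := G) (ε := ε) H v)
    (abs_indexGain_le H v hc1 hε) (by positivity)
  calc _ ≤ ∫ ρ, sampleVal G c u (indexGain G c ε H v) ρ * (1 / (1 - Real.sqrt c))
        ∂(randLaw (SampleDraw V)) := by
        refine integral_mono_of_nonneg (.of_forall fun _ => sq_nonneg _) (hint.mul_const _)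
          (.of_forall fun ρ => ?_)
        refine sampleVal_cases u ρ (P := fun x => x ^ 2 ≤ x * (1 / (1 - Real.sqrt c))) (by simp)
          fun p b => ?_
        rw [pow_two]
        exact mul_le_mul_of_nonneg_left (indexGain_le H v hc1 hε p b)
          (indexGain_nonneg H v hc1 hε p b)
    _ ≤ simIndex G c H u v * (1 / (1 - Real.sqrt c)) := by
        rw [integral_mul_const]
        gcongr
        exact integral_sampleVal_index_le H v hc0 hc1 hε u
    _ = _ := by ring

end Moments

/-! ### The index part of the answer -/

section IndexEst

variable {V : Type*} [Fintype V] {G : Digraph V} {c ε : ℝ}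

/-- The draws of sample `j` in round `i`. -/
def sampleDraws (ω : Draw V → I) (p : ℕ × ℕ) : SampleDraw V → I :=
  fun d => ω (SampleDraw.toDraw (p, d))

theorem sampleVal_index_eq (H : Finset V) (u v : V) (ω : Draw V → I) (i j L : ℕ)
    (hL : ∀ p, sampled G c u ω i j = some p → p.2 < L) :
    open scoped Classical in
    sampleVal G c u (indexGain G c ε H v) (sampleDraws ω (i, j)) =
      ∑ w ∈ H, ∑ l ∈ Finset.range L, if sampled G c u ω i j = some (w, l) then
        indexVal G c ε w l v / (1 - Real.sqrt c) ^ 2 else 0 := by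
  classical
  rw [← Finset.sum_product', sampleVal]
  change (sampled G c u ω i j).elim _ _ = _
  cases h : sampled G c u ω i j with
  | none => simp
  | some p =>
    have := hL p h
    simp only [Option.elim_some, indexGain, Option.some_inj]
    rw [Finset.sum_ite_eq]
    simp [this]

/-- For fixed `ω` only finitely many samples are drawn, so all sums over levels become finite; the
bound depends on `ω`. -/
theorem exists_level_bound (G : Digraph V) (c : ℝ) (u : V) (ω : Draw V → I) (dr fr : ℕ) :
    ∃ L : ℕ, ∀ i ∈ Finset.range fr, ∀ j ∈ Finset.range dr, ∀ p,
      sampled G c u ω i j = some p → p.2 < L := by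
  refine ⟨(Finset.range fr ×ˢ Finset.range dr).sup fun q =>
    (sampled G c u ω q.1 q.2).elim 0 fun p => p.2 + 1, fun i hi j hj p hp => ?_⟩
  have := Finset.le_sup (f := fun q : ℕ × ℕ => (sampled G c u ω q.1 q.2).elim 0 fun p => p.2 + 1)
    (Finset.mk_mem_product hi hj)
  simp only [hp, Option.elim_some] at this
  omega

theorem etaPiEst_nonneg (u : V) (dr fr : ℕ) (ω : Draw V → I) (w : V) (l : ℕ) :
    0 ≤ etaPiEst G c u dr fr ω w l :=
  Finset.sum_nonneg fun i _ => Finset.sum_nonneg fun j _ => by split_ifs <;> positivity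

/-- Truncating small frequencies costs at most `ε / 12`. -/
theorem indexEst_bounds (hc1 : c < 1) (hε : 0 < ε) (H : Finset V) (u v : V) (dr fr : ℕ)
    (ω : Draw V → I) :
    indexEst G c ε H u dr fr ω v ≤
      (∑ i ∈ Finset.range fr, ∑ j ∈ Finset.range dr,
        sampleVal G c u (indexGain G c ε H v) (sampleDraws ω (i, j))) / (dr * fr) ∧
    (∑ i ∈ Finset.range fr, ∑ j ∈ Finset.range dr,
        sampleVal G c u (indexGain G c ε H v) (sampleDraws ω (i, j))) / (dr * fr) - ε / 12 ≤
      indexEst G c ε H u dr fr ω v := by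
  classical
  obtain ⟨L, hL⟩ := exists_level_bound G c u ω dr fr
  have hZ : (∑ i ∈ Finset.range fr, ∑ j ∈ Finset.range dr,
      sampleVal G c u (indexGain G c ε H v) (sampleDraws ω (i, j))) / (dr * fr) =
      ∑ w ∈ H, ∑ l ∈ Finset.range L, etaPiEst G c u dr fr ω w l *
        (indexVal G c ε w l v / (1 - Real.sqrt c) ^ 2) := by
    have h1 : ∑ i ∈ Finset.range fr, ∑ j ∈ Finset.range dr,
        sampleVal G c u (indexGain G c ε H v) (sampleDraws ω (i, j)) =
        ∑ i ∈ Finset.range fr, ∑ j ∈ Finset.range dr, ∑ w ∈ H, ∑ l ∈ Finset.range L,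
        if sampled G c u ω i j = some (w, l) then
          indexVal G c ε w l v / (1 - Real.sqrt c) ^ 2 else 0 :=
      Finset.sum_congr rfl fun i hi => Finset.sum_congr rfl fun j hj =>
        sampleVal_index_eq H u v ω i j L (hL i hi j hj)
    rw [h1]
    simp_rw [Finset.sum_comm (s := Finset.range dr) (t := H),
      Finset.sum_comm (s := Finset.range fr) (t := H),
      Finset.sum_comm (s := Finset.range dr) (t := Finset.range L),
      Finset.sum_comm (s := Finset.range fr) (t := Finset.range L)]
    rw [Finset.sum_div]
    refine Finset.sum_congr rfl fun w _ => ?_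
    rw [Finset.sum_div]
    refine Finset.sum_congr rfl fun l _ => ?_
    rw [etaPiEst, Finset.sum_div, Finset.sum_mul]
    refine Finset.sum_congr rfl fun i _ => ?_
    rw [Finset.sum_div, Finset.sum_mul]
    refine Finset.sum_congr rfl fun j _ => ?_
    split_ifs <;> ring
  have hI : indexEst G c ε H u dr fr ω v = ∑ w ∈ H, ∑ l ∈ Finset.range L,
      if rmax c ε < etaPiEst G c u dr fr ω w l then etaPiEst G c u dr fr ω w l *
        (indexVal G c ε w l v / (1 - Real.sqrt c) ^ 2) else 0 := by
    unfold indexEst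
    refine Finset.sum_congr rfl fun w _ => ?_
    rw [tsum_eq_sum (s := Finset.range L)]
    · refine Finset.sum_congr rfl fun l _ => ?_
      unfold indexVal rmax
      by_cases h1 : ε / c₁ c < etaPiEst G c u dr fr ω w l <;> by_cases h2 : InList G c ε w l v <;>
        simp [h1, h2, mul_div_assoc]
    · intro l hl
      have : etaPiEst G c u dr fr ω w l = 0 :=
        Finset.sum_eq_zero fun i hi => Finset.sum_eq_zero fun j hj =>
          if_neg fun h => hl (Finset.mem_range.2 (hL i hi j hj _ h))
      simp [this]
  have hx : ∀ w l, 0 ≤ indexVal G c ε w l v / (1 - Real.sqrt c) ^ 2 := fun w l =>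
    div_nonneg (indexVal_nonneg hc1 hε w l v) (sq_nonneg _)
  have he := etaPiEst_nonneg (G := G) (c := c) u dr fr ω
  rw [hZ, hI]
  constructor
  · refine Finset.sum_le_sum fun w _ => Finset.sum_le_sum fun l _ => ?_
    split_ifs
    · rfl
    · exact mul_nonneg (he w l) (hx w l)
  · have h1 : ∑ w ∈ H, ∑ l ∈ Finset.range L, etaPiEst G c u dr fr ω w l *
        (indexVal G c ε w l v / (1 - Real.sqrt c) ^ 2) ≤
        ∑ w ∈ H, ∑ l ∈ Finset.range L, ((if rmax c ε < etaPiEst G c u dr fr ω w l then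
          etaPiEst G c u dr fr ω w l * (indexVal G c ε w l v / (1 - Real.sqrt c) ^ 2) else 0) +
          ε / 12 * termProb G c l v w) := by
      refine Finset.sum_le_sum fun w _ => Finset.sum_le_sum fun l _ => ?_
      have h0 := termProb_nonneg (G := G) hc1 l v w
      split_ifs with h
      · have : 0 ≤ ε / 12 * termProb G c l v w := by positivity
        linarith
      -- A discarded frequency is at most r_max and its stored value at most π_l(v,w); the
      -- termination probabilities of the walk from `v` sum to at most 1.
      · rw [zero_add, ← rmax_div (ε := ε) hc1, div_mul_eq_mul_div, ← mul_div_assoc]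
        have := rmax_pos hc1 hε
        gcongr
        · exact indexVal_nonneg hc1 hε w l v
        · exact not_lt.1 h
        · exact indexVal_le hc1 hε w l v
    have h2 : ∑ w ∈ H, ∑ l ∈ Finset.range L, ε / 12 * termProb G c l v w ≤ ε / 12 := by
      simp_rw [← Finset.mul_sum]
      refine mul_le_of_le_one_right (by positivity) ?_
      rw [Finset.sum_comm]
      refine (Finset.sum_le_sum fun l _ => ?_).trans (sum_sum_termProb_le (G := G) hc1 v L)
      exact Finset.sum_le_sum_of_subset_of_nonneg (Finset.subset_univ H)
        fun w _ _ => termProb_nonneg hc1 l v w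
    simp_rw [Finset.sum_add_distrib] at h1
    linarith

end IndexEst

/-! ### Concentration -/

section Concentration

/-- Follows from exp y ≥ 1 + y + y²/2 and (1 - y + y²/2)(1 + y + y²/2) = 1 + y⁴/4. -/
theorem exp_neg_le_quadratic {y : ℝ} (hy : 0 ≤ y) : Real.exp (-y) ≤ 1 - y + y ^ 2 / 2 := by
  have h := Real.quadratic_le_exp_of_nonneg hy
  have h1 : 0 < 1 + y + y ^ 2 / 2 := by positivity
  rw [Real.exp_neg]
  refine (inv_anti₀ h1 h).trans ?_
  rw [inv_le_iff_one_le_mul₀ h1]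
  nlinarith [sq_nonneg (y ^ 2)]

variable {Ω ι : Type*} [MeasurableSpace Ω] {μ : Measure Ω} [IsProbabilityMeasure μ]
  {X : ι → Ω → ℝ} {s : Finset ι} {m W C T : ℝ}

/-- The lower tail of a sum of independent nonnegative random variables is sub-Gaussian. -/
theorem measureReal_sum_le_sub (hind : iIndepFun X μ) (hX : ∀ i, Measurable (X i))
    (h0 : ∀ i ω, 0 ≤ X i ω) (hC : ∀ i ω, X i ω ≤ C) (hm : ∀ i, ∫ ω, X i ω ∂μ = m)
    (hW : ∀ i, ∫ ω, X i ω ^ 2 ∂μ ≤ W) (hW0 : 0 < W) (hs : s.Nonempty) (hT : 0 ≤ T) :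
    μ.real {ω | ∑ i ∈ s, X i ω ≤ s.card * m - T} ≤ Real.exp (-(T ^ 2 / (2 * (s.card * W)))) := by
  have hn : (0 : ℝ) < s.card := by exact_mod_cast hs.card_pos
  -- The minimiser of l² n W/2 - l T, where n is the number of summands. The bound `C` is needed for
  -- integrability only and does not enter the exponent.
  set l : ℝ := T / (s.card * W) with hl
  have hl0 : 0 ≤ l := by positivity
  have hint : ∀ i, Integrable (X i) μ := fun i =>
    .of_bound (hX i).aestronglyMeasurable C (.of_forall fun ω => by
      rw [Real.norm_of_nonneg (h0 i ω)]; exact hC i ω)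
  have hint2 : ∀ i, Integrable (fun ω => X i ω ^ 2) μ := fun i =>
    .of_bound ((hX i).pow_const 2).aestronglyMeasurable (C ^ 2) (.of_forall fun ω => by
      rw [Real.norm_of_nonneg (sq_nonneg _)]; exact pow_le_pow_left₀ (h0 i ω) (hC i ω) 2)
  have hmgf : ∀ i, mgf (X i) μ (-l) ≤ Real.exp (-l * m + l ^ 2 * W / 2) := by
    intro i
    have hi1 : Integrable (fun ω => 1 - l * X i ω) μ := (integrable_const _).sub ((hint i).const_mul l)
    calc mgf (X i) μ (-l) ≤ ∫ ω, (1 - l * X i ω + l ^ 2 / 2 * X i ω ^ 2) ∂μ := by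
          refine integral_mono_of_nonneg (.of_forall fun ω => (Real.exp_pos _).le)
            (hi1.add ((hint2 i).const_mul _)) (.of_forall fun ω => ?_)
          have := exp_neg_le_quadratic (mul_nonneg hl0 (h0 i ω))
          simp only [neg_mul]
          refine this.trans_eq ?_
          ring
      _ = 1 - l * m + l ^ 2 / 2 * ∫ ω, X i ω ^ 2 ∂μ := by
          rw [integral_add hi1 ((hint2 i).const_mul _), integral_sub (integrable_const _)
            ((hint i).const_mul l), integral_const_mul, integral_const_mul, hm]
          simp
      _ ≤ (-l * m + l ^ 2 * W / 2) + 1 := by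
          have := mul_le_mul_of_nonneg_left (hW i) (by positivity : 0 ≤ l ^ 2 / 2)
          linarith
      _ ≤ _ := Real.add_one_le_exp _
  have hch := measure_le_le_exp_mul_mgf (μ := μ) (X := ∑ i ∈ s, X i) (t := -l)
    (s.card * m - T) (by linarith) (by
      refine .of_bound ?_ 1 (.of_forall fun ω => ?_)
      · simp only [Finset.sum_apply]
        exact (Real.measurable_exp.comp ((Finset.measurable_sum s fun i _ => hX i).const_mul
          (-l))).aestronglyMeasurable
      · rw [Real.norm_of_nonneg (Real.exp_pos _).le, Real.exp_le_one_iff, neg_mul, neg_nonpos]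
        simp only [Finset.sum_apply]
        exact mul_nonneg hl0 (Finset.sum_nonneg fun i _ => h0 i ω))
  rw [hind.mgf_sum hX] at hch
  simp only [Finset.sum_apply] at hch
  refine hch.trans ?_
  calc _ ≤ Real.exp (-(-l) * (s.card * m - T)) *
        ∏ _i ∈ s, Real.exp (-l * m + l ^ 2 * W / 2) := by
        gcongr with i _
        · exact fun i _ => mgf_nonneg
        · exact hmgf i
    _ = Real.exp (-(T ^ 2 / (2 * (s.card * W)))) := by
        rw [Finset.prod_const, ← Real.exp_nat_mul, ← Real.exp_add, hl]
        congr 1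
        field_simp
        ring

/-- Hoeffding's inequality for the upper tail. -/
theorem measureReal_add_le_sum (hind : iIndepFun X μ) (hX : ∀ i, Measurable (X i))
    (h0 : ∀ i ω, 0 ≤ X i ω) (hC : ∀ i ω, X i ω ≤ C) (hm : ∀ i, ∫ ω, X i ω ∂μ = m) (hT : 0 ≤ T) :
    μ.real {ω | s.card * m + T ≤ ∑ i ∈ s, X i ω} ≤ Real.exp (-(2 * T ^ 2 / (s.card * C ^ 2))) := by
  have hsub : ∀ i, HasSubgaussianMGF (fun ω => X i ω - m) ((‖C - 0‖₊ / 2) ^ 2) μ := fun i => by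
    have := hasSubgaussianMGF_of_mem_Icc (μ := μ) (a := 0) (b := C) (hX i).aemeasurable
      (.of_forall fun ω => ⟨h0 i ω, hC i ω⟩)
    rwa [hm i] at this
  have h := HasSubgaussianMGF.measure_sum_ge_le_of_iIndepFun (s := s)
    (hind.comp (fun _ x => x - m) fun _ => by fun_prop) (fun i _ => hsub i) hT
  have hset : {ω | T ≤ ∑ i ∈ s, ((fun x => x - m) ∘ X i) ω} =
      {ω | s.card * m + T ≤ ∑ i ∈ s, X i ω} := by
    ext ω
    simp only [Function.comp, Finset.sum_sub_distrib, Finset.sum_const, nsmul_eq_mul,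
      Set.mem_ofPred_eq, le_sub_iff_add_le, add_comm]
  rw [hset] at h
  refine h.trans_eq ?_
  congr 1
  simp only [Finset.sum_const, nsmul_eq_mul, sub_zero]
  push_cast
  rw [Real.norm_eq_abs, div_pow, sq_abs, neg_div]
  congr 1
  rw [show 2 * ((s.card : ℝ) * (C ^ 2 / 2 ^ 2)) = (s.card * C ^ 2) / 2 by ring, div_div_eq_mul_div,
    mul_comm]

/-- Common source of the Cantelli and Chebyshev bounds: the cross term with the shift `U` has mean
zero, and variances are bounded by raw second moments. -/
theorem integral_sum_sub_sq_le (hind : iIndepFun X μ) (hX : ∀ i, Measurable (X i))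
    (h0 : ∀ i ω, 0 ≤ X i ω) (hC : ∀ i ω, X i ω ≤ C) (hm : ∀ i, ∫ ω, X i ω ∂μ = m)
    (hW : ∀ i, ∫ ω, X i ω ^ 2 ∂μ ≤ W) (U : ℝ) :
    ∫ ω, (∑ i ∈ s, X i ω - s.card * m + U) ^ 2 ∂μ ≤ s.card * W + U ^ 2 ∧
      Integrable (fun ω => (∑ i ∈ s, X i ω - s.card * m + U) ^ 2) μ := by
  have hL : ∀ i, MemLp (X i) 2 μ := fun i =>
    .of_bound (hX i).aestronglyMeasurable C (.of_forall fun ω => by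
      rw [Real.norm_of_nonneg (h0 i ω)]; exact hC i ω)
  have hS : MemLp (∑ i ∈ s, X i) 2 μ := memLp_finsetSum' s fun i _ => hL i
  have hmean : ∫ ω, (∑ i ∈ s, X i) ω ∂μ = s.card * m := by
    simp only [Finset.sum_apply]
    rw [integral_finsetSum _ fun i _ => (hL i).integrable one_le_two]
    simp [hm]
  have hvar : Var[∑ i ∈ s, X i; μ] ≤ s.card * W := by
    rw [IndepFun.variance_sum (fun i _ => hL i) fun i _ j _ hij => hind.indepFun hij]
    refine (Finset.sum_le_card_nsmul _ _ W fun i _ => ?_).trans_eq (nsmul_eq_mul _ _)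
    exact (variance_le_expectation_sq (hX i).aestronglyMeasurable).trans (hW i)
  have hD : MemLp (fun ω => ∑ i ∈ s, X i ω - s.card * m) 2 μ := by
    have := hS.sub (memLp_const (s.card * m : ℝ))
    convert! this using 2
    simp
  refine ⟨?_, (hD.add (memLp_const U)).integrable_sq⟩
  rw [variance_eq_integral hS.aemeasurable, hmean] at hvar
  simp only [Finset.sum_apply] at hvar
  have hD1 := hD.integrable one_le_two
  have hexp : ∀ ω, (∑ i ∈ s, X i ω - s.card * m + U) ^ 2 =
      (∑ i ∈ s, X i ω - s.card * m) ^ 2 + ((2 * U) * (∑ i ∈ s, X i ω - s.card * m) + U ^ 2) :=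
    fun ω => by ring
  simp_rw [hexp]
  have hD2 : Integrable (fun ω => 2 * U * (∑ i ∈ s, X i ω - s.card * m) + U ^ 2) μ :=
    (hD1.const_mul _).add (integrable_const _)
  rw [integral_add hD.integrable_sq hD2, integral_add (hD1.const_mul _) (integrable_const _), integral_const_mul,
    integral_sub (integrable_finsetSum _ fun i _ => (hL i).integrable one_le_two)
      (integrable_const _)]
  simp only [Finset.sum_apply] at hmean
  rw [hmean]
  simpa using hvar

/-- Cantelli's inequality, with a free parameter. -/
theorem measureReal_add_le_sum_of_variance (hind : iIndepFun X μ) (hX : ∀ i, Measurable (X i))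
    (h0 : ∀ i ω, 0 ≤ X i ω) (hC : ∀ i ω, X i ω ≤ C) (hm : ∀ i, ∫ ω, X i ω ∂μ = m)
    (hW : ∀ i, ∫ ω, X i ω ^ 2 ∂μ ≤ W) {U : ℝ} (hT : 0 < T) (hU : 0 ≤ U) :
    μ.real {ω | s.card * m + T ≤ ∑ i ∈ s, X i ω} ≤ (s.card * W + U ^ 2) / (T + U) ^ 2 := by
  obtain ⟨h1, h2⟩ := integral_sum_sub_sq_le (s := s) hind hX h0 hC hm hW U
  have hM := mul_meas_ge_le_integral_of_nonneg (.of_forall fun ω => sq_nonneg _) h2 ((T + U) ^ 2)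
  rw [le_div_iff₀ (by positivity), mul_comm]
  refine (mul_le_mul_of_nonneg_left (measureReal_mono fun ω hω => ?_) (sq_nonneg _)).trans
    (hM.trans h1)
  have : s.card * m + T ≤ ∑ i ∈ s, X i ω := hω
  have h0 : T + U ≤ ∑ i ∈ s, X i ω - s.card * m + U := by linarith
  exact pow_le_pow_left₀ (by positivity) h0 2

/-- Chebyshev's inequality. -/
theorem measureReal_le_abs_sum_sub (hind : iIndepFun X μ) (hX : ∀ i, Measurable (X i))
    (h0 : ∀ i ω, 0 ≤ X i ω) (hC : ∀ i ω, X i ω ≤ C) (hm : ∀ i, ∫ ω, X i ω ∂μ = m)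
    (hW : ∀ i, ∫ ω, X i ω ^ 2 ∂μ ≤ W) (hT : 0 < T) :
    μ.real {ω | T ≤ |∑ i ∈ s, X i ω - s.card * m|} ≤ s.card * W / T ^ 2 := by
  obtain ⟨h1, h2⟩ := integral_sum_sub_sq_le (s := s) hind hX h0 hC hm hW 0
  have hM := mul_meas_ge_le_integral_of_nonneg (.of_forall fun ω => sq_nonneg _) h2 (T ^ 2)
  rw [le_div_iff₀ (by positivity), mul_comm]
  refine (mul_le_mul_of_nonneg_left (measureReal_mono fun ω hω => ?_) (sq_nonneg _)).trans
    (hM.trans (h1.trans_eq (by ring)))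
  have : T ≤ |∑ i ∈ s, X i ω - s.card * m| := hω
  simp only [Set.mem_ofPred_eq, add_zero]
  rw [← sq_abs (∑ i ∈ s, X i ω - s.card * m)]
  exact pow_le_pow_left₀ hT.le this 2

end Concentration

/-! ### Medians -/

section Median

variable {k : ℕ} {x : ℕ → ℝ} {a : ℝ}

theorem median_eq {k : ℕ} (hk : 0 < k) (x : ℕ → ℝ) :
    ∃ l : List ℝ, (l : Multiset ℝ) = (Multiset.range k).map x ∧ l.Pairwise (· ≤ ·) ∧
      ∃ (_ : l.length = k) (h1 : (k - 1) / 2 < l.length) (h2 : k / 2 < l.length),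
        median k x = (l[(k - 1) / 2] + l[k / 2]) / 2 := by
  have hlen : (((Multiset.range k).map x).sort (· ≤ ·)).length = k := by simp
  refine ⟨((Multiset.range k).map x).sort (· ≤ ·), Multiset.sort_eq _ _,
    Multiset.pairwise_sort _ _, hlen, by omega, by omega, ?_⟩
  rw [median, List.getD_eq_getElem, List.getD_eq_getElem]

theorem card_filter_range_eq {k : ℕ} (x : ℕ → ℝ) (p : ℝ → Prop) [DecidablePred p] {l : List ℝ}
    (hl : (l : Multiset ℝ) = (Multiset.range k).map x) :
    ((Finset.range k).filter fun i => p (x i)).card = l.countP p := by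
  rw [← Multiset.coe_countP, hl, Multiset.countP_map]
  rfl

/-- If the median is at most `a`, then so are at least half of the values. -/
theorem le_card_of_median_le (hk : 0 < k) (h : median k x ≤ a) :
    (k + 1) / 2 ≤ ((Finset.range k).filter fun i => x i ≤ a).card := by
  obtain ⟨l, hl, hs, hlen, h1, h2, hm⟩ := median_eq hk x
  rw [card_filter_range_eq x (· ≤ a) hl]
  have hle : l[(k - 1) / 2] ≤ l[k / 2] :=
    hs.sortedLE.getElem_le_getElem_of_le (by omega)
  -- The smaller middle entry is at most the median, hence so are all entries before it.
  have hmid : l[(k - 1) / 2] ≤ a := by linarith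
  have htake : (l.take ((k - 1) / 2 + 1)).countP (· ≤ a) = (k - 1) / 2 + 1 := by
    have : (l.take ((k - 1) / 2 + 1)).length = (k - 1) / 2 + 1 := by
      rw [List.length_take]; omega
    refine (List.countP_eq_length.2 ?_).trans this
    intro y hy
    obtain ⟨i, hi, rfl⟩ := List.mem_iff_getElem.1 hy
    rw [List.getElem_take]
    rw [List.length_take] at hi
    simp only [decide_eq_true_eq]
    exact (hs.sortedLE.getElem_le_getElem_of_le (by omega)).trans hmid
  calc (k + 1) / 2 = (k - 1) / 2 + 1 := by omega
    _ = _ := htake.symm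
    _ ≤ _ := (List.take_sublist _ _).countP_le

/-- If the median is at least `a`, then so are at least half of the values. -/
theorem le_card_of_le_median (hk : 0 < k) (h : a ≤ median k x) :
    (k + 1) / 2 ≤ ((Finset.range k).filter fun i => a ≤ x i).card := by
  obtain ⟨l, hl, hs, hlen, h1, h2, hm⟩ := median_eq hk x
  rw [card_filter_range_eq x (a ≤ ·) hl]
  have hle : l[(k - 1) / 2] ≤ l[k / 2] :=
    hs.sortedLE.getElem_le_getElem_of_le (by omega)
  have hmid : a ≤ l[k / 2] := by linarith
  have hdrop : (l.drop (k / 2)).countP (a ≤ ·) = k - k / 2 := by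
    have : (l.drop (k / 2)).length = k - k / 2 := by
      rw [List.length_drop]; omega
    rw [← this, List.countP_eq_length.2]
    intro y hy
    obtain ⟨i, hi, rfl⟩ := List.mem_iff_getElem.1 hy
    rw [List.getElem_drop]
    simp only [decide_eq_true_eq]
    exact hmid.trans (hs.sortedLE.getElem_le_getElem_of_le (by omega))
  calc (k + 1) / 2 = k - k / 2 := by omega
    _ = _ := hdrop.symm
    _ ≤ _ := (List.drop_sublist _ _).countP_le

/-- The median of at most two values is their mean. -/
theorem median_eq_mean (hk : 0 < k) (hk2 : k ≤ 2) (x : ℕ → ℝ) :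
    median k x = (∑ i ∈ Finset.range k, x i) / k := by
  obtain ⟨l, hl, -, hlen, h1, h2, hm⟩ := median_eq hk x
  have hsum : ∑ i ∈ Finset.range k, x i = l.sum := by
    rw [← Multiset.sum_coe, hl]; rfl
  rw [hm, hsum]
  interval_cases k
  · obtain ⟨y, rfl⟩ := List.length_eq_one_iff.1 hlen
    simp
  · obtain ⟨y, z, rfl⟩ := List.length_eq_two.1 hlen
    simp

end Median

/-! ### From unlikely bad rounds to an unlikely bad majority. -/

section Majority

variable {Ω : Type*} [MeasurableSpace Ω] {μ : Measure Ω} [IsProbabilityMeasure μ]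

/-- By Pascal's rule the coefficient is a sum of two entries of row k-1. The saved factor 2 is the
1/2 in `measureReal_majority_le`. -/
theorem choose_le_two_pow_pred {k m : ℕ} (hk : 0 < k) (hm : 0 < m) : k.choose m ≤ 2 ^ (k - 1) := by
  obtain ⟨k, rfl⟩ := Nat.exists_eq_add_of_lt hk
  obtain ⟨m, rfl⟩ := Nat.exists_eq_add_of_lt hm
  simp only [zero_add, Nat.add_sub_cancel, Nat.choose_succ_succ]
  rcases le_or_gt (m + 1) k with h | h
  · rw [← Nat.sum_range_choose, ← Finset.sum_pair (f := fun i => k.choose i) (Nat.lt_succ_self m).ne]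
    refine Finset.sum_le_sum_of_subset fun i hi => ?_
    simp only [Finset.mem_insert, Finset.mem_singleton, Nat.succ_eq_add_one] at hi
    simp only [Finset.mem_range]
    omega
  · rw [Nat.choose_eq_zero_of_lt h, add_zero]
    exact Nat.choose_le_two_pow k m

open scoped Classical in
/-- It is unlikely that at least half of `k` independent unlikely events occur. -/
theorem measureReal_majority_le {β : Type*} [MeasurableSpace β] {R : ℕ → Ω → β}
    (hR : iIndepFun R μ) {S : Set β} (hS : MeasurableSet S) {r : ℝ} (hr0 : 0 ≤ r) (hr : r ≤ 2)
    (hp : ∀ i, μ.real (R i ⁻¹' S) ≤ (r / 2) ^ 2) {k : ℕ} (hk : 0 < k) :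
    μ.real {ω | (k + 1) / 2 ≤ ((Finset.range k).filter fun i => R i ω ∈ S).card} ≤ r ^ k / 2 := by
  set m := (k + 1) / 2
  have hsub : {ω | m ≤ ((Finset.range k).filter fun i => R i ω ∈ S).card} ⊆
      ⋃ A ∈ (Finset.range k).powersetCard m, ⋂ i ∈ A, R i ⁻¹' S := by
    intro ω hω
    obtain ⟨A, hA, hAm⟩ := Finset.exists_subset_card_eq (show m ≤ _ from hω)
    refine Set.mem_iUnion₂.2 ⟨A, Finset.mem_powersetCard.2
      ⟨hA.trans (Finset.filter_subset _ _), hAm⟩, Set.mem_iInter₂.2 fun i hi => ?_⟩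
    exact (Finset.mem_filter.1 (hA hi)).2
  have hA : ∀ A ∈ (Finset.range k).powersetCard m, μ.real (⋂ i ∈ A, R i ⁻¹' S) ≤ (r / 2) ^ k := by
    intro A hA
    rw [measureReal_def, hR.measure_inter_preimage_eq_mul A fun _ _ => hS, ENNReal.toReal_prod]
    calc ∏ i ∈ A, (μ (R i ⁻¹' S)).toReal ≤ ∏ _i ∈ A, (r / 2) ^ 2 :=
          Finset.prod_le_prod (fun _ _ => ENNReal.toReal_nonneg) fun i _ => hp i
      _ = (r / 2) ^ (2 * m) := by
          rw [Finset.prod_const, (Finset.mem_powersetCard.1 hA).2, pow_mul]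
      -- Here 2m ≥ k, as m is k/2 rounded up, and the base is at most 1.
      _ ≤ (r / 2) ^ k := pow_le_pow_of_le_one (by positivity) (by linarith) (by omega)
  calc _ ≤ μ.real (⋃ A ∈ (Finset.range k).powersetCard m, ⋂ i ∈ A, R i ⁻¹' S) :=
        measureReal_mono hsub (measure_ne_top μ _)
    _ ≤ ∑ A ∈ (Finset.range k).powersetCard m, μ.real (⋂ i ∈ A, R i ⁻¹' S) :=
        measureReal_biUnion_finset_le _ _
    _ ≤ ((Finset.range k).powersetCard m).card • (r / 2) ^ k :=
        Finset.sum_le_card_nsmul _ _ _ hA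
    _ = k.choose m * (r / 2) ^ k := by simp
    _ ≤ 2 ^ (k - 1) * (r / 2) ^ k := by
        gcongr
        exact_mod_cast choose_le_two_pow_pred hk (by omega)
    _ = r ^ k / 2 := by
        obtain ⟨k, rfl⟩ := Nat.exists_eq_add_of_lt hk
        simp only [zero_add, Nat.add_sub_cancel, div_pow, pow_succ]
        field_simp

end Majority

/-! ### The error of the answer -/

/-! ### Numerical constants of the error budget. -/

section Numerics

theorem exp_neg_div_le {a b : ℕ} (hb : b ≠ 0) {x : ℝ} (hx : 0 ≤ x)
    (h : (0.3678794412 : ℝ) ^ a ≤ x ^ b) : Real.exp (-(a / b : ℝ)) ≤ x := by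
  have hb' : (b : ℝ) ≠ 0 := by exact_mod_cast hb
  rw [← pow_le_pow_iff_left₀ (Real.exp_pos _).le hx hb, ← Real.exp_nat_mul]
  refine le_trans ?_ h
  rw [show (b : ℝ) * -(a / b) = a * (-1) by field_simp, Real.exp_nat_mul]
  exact pow_le_pow_left₀ (Real.exp_pos _).le Real.exp_neg_one_lt_d9.le a

/-- The number 0.7165 lies just below exp(-1/3). -/
theorem pow_le_exp_neg_third (k : ℕ) : (0.7165 : ℝ) ^ k ≤ Real.exp (-(k / 3 : ℝ)) := by
  have h : (0.7165 : ℝ) ≤ Real.exp (-(1 / 3)) := by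
    rw [← pow_le_pow_iff_left₀ (by norm_num) (Real.exp_pos _).le (three_ne_zero),
      ← Real.exp_nat_mul]
    have := Real.exp_neg_one_gt_d9
    norm_num at this ⊢
    linarith
  calc (0.7165 : ℝ) ^ k ≤ Real.exp (-(1 / 3)) ^ k := pow_le_pow_left₀ (by norm_num) h k
    _ = _ := by rw [← Real.exp_nat_mul]; congr 1; ring

/-- All four bases are below 0.7165, so the case k = 3 decides; the two median terms alone are below
0.7165³ with little to spare. The numerical comparison with 0.7165^k fails at k = 2, whence the
separate treatment of few rounds. -/
theorem four_terms_le {k : ℕ} (hk : 3 ≤ k) :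
    (0.605 : ℝ) ^ k / 2 + (0.6944 : ℝ) ^ k / 2 + Real.exp (-(0.96 * k)) + Real.exp (-(1.1616 * k))
      ≤ Real.exp (-(k / 3 : ℝ)) := by
  refine le_trans ?_ (pow_le_exp_neg_third k)
  have ha : Real.exp (-0.96) ≤ 0.3829 := by
    have := exp_neg_div_le (a := 24) (b := 25) (by norm_num) (x := 0.3829) (by norm_num)
      (by norm_num)
    norm_num at this ⊢
    exact this
  have hb : Real.exp (-1.1616) ≤ 0.3135 := by
    have := exp_neg_div_le (a := 29) (b := 25) (by norm_num) (x := 0.3135) (by norm_num)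
      (by norm_num)
    exact le_trans (Real.exp_le_exp.2 (by norm_num)) this
  have e1 : Real.exp (-(0.96 * k)) = Real.exp (-0.96) ^ k := by
    rw [← Real.exp_nat_mul]; congr 1; ring
  have e2 : Real.exp (-(1.1616 * k)) = Real.exp (-1.1616) ^ k := by
    rw [← Real.exp_nat_mul]; congr 1; ring
  have hpow : ∀ x y : ℝ, 0 ≤ x → x ≤ y → y ≤ 0.7165 → x ^ k ≤ y ^ 3 * (0.7165 : ℝ) ^ (k - 3) := by
    intro x y hx hxy hy
    calc x ^ k ≤ y ^ k := pow_le_pow_left₀ hx hxy k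
      _ = y ^ 3 * y ^ (k - 3) := by rw [← pow_add]; congr 1; omega
      _ ≤ _ := by
        have : 0 ≤ y := hx.trans hxy
        gcongr
  have h1 := hpow 0.605 0.605 (by norm_num) le_rfl (by norm_num)
  have h2 := hpow 0.6944 0.6944 (by norm_num) le_rfl (by norm_num)
  have h3 := hpow _ _ (Real.exp_pos _).le ha (by norm_num)
  have h4 := hpow _ _ (Real.exp_pos _).le hb (by norm_num)
  have h5 : (0.7165 : ℝ) ^ k = (0.7165 : ℝ) ^ 3 * (0.7165 : ℝ) ^ (k - 3) := by
    rw [← pow_add]; congr 1; omega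
  have h6 : (0 : ℝ) ≤ (0.7165 : ℝ) ^ (k - 3) := by positivity
  rw [e1, e2, h5]
  nlinarith

theorem sqrt_add_sqrt_le {A B : ℝ} (hA : 0 ≤ A) (hB : 0 ≤ B) (hAB : A + B ≤ 1.004) :
    Real.sqrt (0.4 * B) + Real.sqrt (0.16 * A) ≤ 3 / 4 := by
  have ht := Real.sq_sqrt (by positivity : 0 ≤ 0.4 * B)
  have hx := Real.sq_sqrt (by positivity : 0 ≤ 0.16 * A)
  set t := Real.sqrt (0.4 * B)
  set x := Real.sqrt (0.16 * A)
  refine abs_le_of_sq_le_sq' (b := 3 / 4) ?_ (by norm_num) |>.2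
  -- Cauchy–Schwarz: (0.4 + 0.16) · 1.004 = 0.56224 < (3/4)², with equality in the inequality when
  -- t/0.4 = x/0.16, that is t = 2.5x.
  nlinarith [sq_nonneg (t - 2.5 * x)]

end Numerics

/-! ### Independence of samples and of rounds. -/

section Samples

variable {V : Type*} [Fintype V] {G : Digraph V} {c ε : ℝ}

theorem iIndepFun_samples {f : (SampleDraw V → I) → ℝ} (hf : Measurable f) :
    iIndepFun (fun (p : ℕ × ℕ) (ω : Draw V → I) => f (sampleDraws ω p)) (randLaw (Draw V)) :=
  (iIndepFun_blocks SampleDraw.toDraw_injective).comp (fun _ => f) fun _ => hf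

theorem measurable_sampleDraws (p : ℕ × ℕ) :
    Measurable fun ω : Draw V → I => sampleDraws ω p :=
  measurable_pi_lambda _ fun d => measurable_pi_apply (SampleDraw.toDraw (p, d))

theorem integral_samples {f : (SampleDraw V → I) → ℝ} (hf : Measurable f) (p : ℕ × ℕ) :
    ∫ ω, f (sampleDraws ω p) ∂(randLaw (Draw V)) = ∫ ρ, f ρ ∂(randLaw (SampleDraw V)) :=
  integral_reindex (e := fun d => SampleDraw.toDraw (p, d))
    (fun _ _ h => (Prod.mk.inj (SampleDraw.toDraw_injective h)).2) hf

/-- The sums over the samples of different rounds are independent. -/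
theorem iIndepFun_rounds {f : (SampleDraw V → I) → ℝ} (hf : Measurable f) (dr : ℕ) :
    iIndepFun (fun (i : ℕ) (ω : Draw V → I) => ∑ j ∈ Finset.range dr, f (sampleDraws ω (i, j)))
      (randLaw (Draw V)) := by
  have he : Function.Injective fun q : ℕ × (ℕ × SampleDraw V) =>
      SampleDraw.toDraw ((q.1, q.2.1), q.2.2) := by
    rintro ⟨i, j, d⟩ ⟨i', j', d'⟩ h
    have := SampleDraw.toDraw_injective h
    simp_all
  refine (iIndepFun_blocks he).comp
    (fun _ (r : ℕ × SampleDraw V → I) => ∑ j ∈ Finset.range dr, f fun d => r (j, d)) fun _ => ?_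
  exact Finset.measurable_sum _ fun j _ => hf.comp (by fun_prop)

theorem roundEst_eq (H : Finset V) (u v : V) (dr : ℕ) (ω : Draw V → I) (i : ℕ) :
    roundEst G c H u dr ω v i = (∑ j ∈ Finset.range dr,
      sampleVal G c u (backGain G c H v) (sampleDraws ω (i, j))) / dr := by
  rw [roundEst, Finset.sum_div]
  refine Finset.sum_congr rfl fun j _ => ?_
  change _ = (sampled G c u ω i j).elim _ _ / _
  cases sampled G c u ω i j with
  | none => simp
  | some p =>
    simp only [Option.elim_some, backGain]
    split_ifs
    · simp
    · rw [div_div]; rfl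

end Samples

/-! ### Tail bounds for the two parts and the error at a single node. -/

section Error

variable {V : Type*} [Fintype V] {G : Digraph V} {c ε : ℝ}

/-- The parameters satisfy the requirement on the number of samples of a round. -/
theorem twelve_le_of_c₁_le (hc1 : c < 1) (hε : 0 < ε) {dr : ℕ} (hdr : c₁ c / ε ^ 2 ≤ dr) :
    12 ≤ dr * ((1 - Real.sqrt c) ^ 2 * ε ^ 2) := by
  have hq : 0 < 1 - Real.sqrt c := by linarith [sqrt_lt_one hc1]
  rw [div_le_iff₀ (by positivity), c₁, div_le_iff₀ (by positivity)] at hdr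
  linarith

variable (H : Finset V) (u v : V)

theorem measurable_sampleVal_back : Measurable (sampleVal G c u (backGain G c H v)) :=
  measurable_sampleVal u (measurable_backGain H v)

theorem measurable_sampleVal_index : Measurable (sampleVal G c u (indexGain G c ε H v)) :=
  measurable_sampleVal u (measurable_indexGain H v)

theorem sampleVal_back_nonneg (hc1 : c < 1) (ρ : SampleDraw V → I) :
    0 ≤ sampleVal G c u (backGain G c H v) ρ :=
  sampleVal_cases u ρ (P := fun x => 0 ≤ x) le_rfl (backGain_nonneg H v hc1)

theorem sampleVal_back_le (hc1 : c < 1) (ρ : SampleDraw V → I) :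
    sampleVal G c u (backGain G c H v) ρ ≤ Fintype.card V / (1 - Real.sqrt c) ^ 2 :=
  sampleVal_cases u ρ (P := fun x => x ≤ _) (by positivity) (backGain_le H v hc1)

theorem sampleVal_index_nonneg (hc1 : c < 1) (hε : 0 < ε) (ρ : SampleDraw V → I) :
    0 ≤ sampleVal G c u (indexGain G c ε H v) ρ :=
  sampleVal_cases u ρ (P := fun x => 0 ≤ x) le_rfl (indexGain_nonneg H v hc1 hε)

theorem sampleVal_index_le (hc1 : c < 1) (hε : 0 < ε) (ρ : SampleDraw V → I) :
    sampleVal G c u (indexGain G c ε H v) ρ ≤ 1 / (1 - Real.sqrt c) :=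
  sampleVal_cases u ρ (P := fun x => x ≤ _)
    (by have := sqrt_lt_one hc1; exact div_nonneg one_pos.le (by linarith))
    (indexGain_le H v hc1 hε)

variable {dr fr : ℕ} {s : V → V → ℝ}

theorem simBack_add_simIndex_le_one (hc0 : 0 < c) (hc1 : c < 1) :
    simBack G c H u v + simIndex G c H u v ≤ 1 := by
  obtain ⟨s, hs, -⟩ := existsUnique_isSimRank G c hc0 hc1
  rw [← hs.eq_simBack_add hc0 hc1]
  exact hs.le_one hc0 hc1 u v

/-- One round is rarely far too small. -/
theorem measureReal_round_low (hc0 : 0 < c) (hc1 : c < 1) (hε : 0 < ε)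
    (hdr : c₁ c / ε ^ 2 ≤ dr) (i : ℕ) {B : ℝ} (hB : 0 < B) (hsB : simBack G c H u v ≤ B) :
    (randLaw (Draw V)).real {ω | ∑ j ∈ Finset.range dr,
      sampleVal G c u (backGain G c H v) (sampleDraws ω (i, j)) ≤
        dr * simBack G c H u v - dr * (Real.sqrt (0.4 * B) * ε)} ≤ (0.605 / 2) ^ 2 := by
  have hq : 0 < 1 - Real.sqrt c := by linarith [sqrt_lt_one hc1]
  have h12 := twelve_le_of_c₁_le hc1 hε hdr
  have hdr0 : 0 < dr := by
    rcases Nat.eq_zero_or_pos dr with h | h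
    · rw [h] at h12; norm_num at h12
    · exact h
  have hf := measurable_sampleVal_back (G := G) (c := c) H u v
  have h := measureReal_sum_le_sub (s := Finset.range dr)
    ((iIndepFun_samples hf).precomp (Prod.mk_right_injective i))
    (fun j => hf.comp (measurable_sampleDraws (i, j)))
    (fun j ω => sampleVal_back_nonneg H u v hc1 _) (fun j ω => sampleVal_back_le H u v hc1 _)
    (fun j => (integral_samples hf (i, j)).trans (integral_sampleVal_back H v hc0 hc1 u))
    (W := B / (1 - Real.sqrt c) ^ 2)
    (fun j => (integral_samples (hf.pow_const 2) (i, j)).trans_le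
      ((integral_sampleVal_back_sq H v hc0 hc1 u).trans (by gcongr)))
    (by positivity) (by simpa using hdr0.ne')
    -- T² is proportional to `B`, which cancels against `W`; since d_r(1-√c)²ε² ≥ 12 the exponent is
    -- at least 0.2 · 12 = 12/5.
    (T := dr * (Real.sqrt (0.4 * B) * ε)) (by positivity)
  rw [Finset.card_range] at h
  refine h.trans (le_trans (b := Real.exp (-(12 / 5))) (Real.exp_le_exp.2 ?_) ?_)
  · rw [neg_le_neg_iff]
    have hd : (0 : ℝ) < dr := by exact_mod_cast hdr0
    rw [mul_pow, mul_pow, Real.sq_sqrt (by positivity), le_div_iff₀ (by positivity)]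
    calc 12 / 5 * (2 * (dr * (B / (1 - Real.sqrt c) ^ 2))) =
          12 * (0.4 * B * dr / (1 - Real.sqrt c) ^ 2) := by ring
      _ ≤ dr * ((1 - Real.sqrt c) ^ 2 * ε ^ 2) * (0.4 * B * dr / (1 - Real.sqrt c) ^ 2) := by
          gcongr
      _ = _ := by field_simp
  · have := exp_neg_div_le (a := 12) (b := 5) (by norm_num) (x := (0.605 / 2) ^ 2)
      (by norm_num) (by norm_num)
    exact this

/-- One round is rarely far too large. -/
theorem measureReal_round_high (hc0 : 0 < c) (hc1 : c < 1) (hε : 0 < ε)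
    (hdr : c₁ c / ε ^ 2 ≤ dr) (i : ℕ) :
    (randLaw (Draw V)).real {ω | dr * simBack G c H u v + dr * (0.78 * ε) ≤
      ∑ j ∈ Finset.range dr, sampleVal G c u (backGain G c H v) (sampleDraws ω (i, j))} ≤
        (0.6944 / 2) ^ 2 := by
  have hq : 0 < 1 - Real.sqrt c := by linarith [sqrt_lt_one hc1]
  have h12 := twelve_le_of_c₁_le hc1 hε hdr
  have hdr0 : 0 < dr := by
    rcases Nat.eq_zero_or_pos dr with h | h
    · rw [h] at h12; norm_num at h12
    · exact h
  have hd : (0 : ℝ) < dr := by exact_mod_cast hdr0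
  have hf := measurable_sampleVal_back (G := G) (c := c) H u v
  have hs1 : simBack G c H u v ≤ 1 := by
    linarith [simBack_add_simIndex_le_one (G := G) H u v hc0 hc1,
      simIndex_nonneg (G := G) hc1 H u v]
  have h := measureReal_add_le_sum_of_variance (s := Finset.range dr)
    ((iIndepFun_samples hf).precomp (Prod.mk_right_injective i))
    (fun j => hf.comp (measurable_sampleDraws (i, j)))
    (fun j ω => sampleVal_back_nonneg H u v hc1 _) (fun j ω => sampleVal_back_le H u v hc1 _)
    (fun j => (integral_samples hf (i, j)).trans (integral_sampleVal_back H v hc0 hc1 u))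
    (W := 1 / (1 - Real.sqrt c) ^ 2)
    (fun j => (integral_samples (hf.pow_const 2) (i, j)).trans_le
      ((integral_sampleVal_back_sq H v hc0 hc1 u).trans (by gcongr)))
    -- In units of d_r ε the variance is at most 1/12, and U = 0.1 is close to the optimal
    -- (1/12)/0.78. The result (1/12 + 0.01)/0.88² lies just below (0.6944/2)².
    (T := dr * (0.78 * ε)) (U := dr * (0.1 * ε)) (by positivity) (by positivity)
  rw [Finset.card_range] at h
  refine h.trans ?_
  have h1 : dr * (1 / (1 - Real.sqrt c) ^ 2) ≤ (dr * ε) ^ 2 / 12 := by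
    rw [le_div_iff₀ (by norm_num)]
    calc dr * (1 / (1 - Real.sqrt c) ^ 2) * 12 ≤ dr * (1 / (1 - Real.sqrt c) ^ 2) *
          (dr * ((1 - Real.sqrt c) ^ 2 * ε ^ 2)) := by gcongr
      _ = _ := by field_simp
  rw [div_le_iff₀ (by positivity)]
  nlinarith [sq_nonneg (dr * ε)]

/-- The index part is rarely far too small. -/
theorem measureReal_index_low (hc0 : 0 < c) (hc1 : c < 1) (hε : 0 < ε)
    (hdr : c₁ c / ε ^ 2 ≤ dr) (hfr : 0 < fr) {A : ℝ} (hA : 0 < A) (hsA : simIndex G c H u v ≤ A) :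
    (randLaw (Draw V)).real {ω | ∑ p ∈ Finset.range fr ×ˢ Finset.range dr,
      sampleVal G c u (indexGain G c ε H v) (sampleDraws ω p) ≤
        (fr * dr) * ∫ ρ, sampleVal G c u (indexGain G c ε H v) ρ ∂(randLaw (SampleDraw V)) -
          (fr * dr) * (Real.sqrt (0.16 * A) * ε)} ≤ Real.exp (-(0.96 * fr)) := by
  have hq : 0 < 1 - Real.sqrt c := by linarith [sqrt_lt_one hc1]
  have h12 := twelve_le_of_c₁_le hc1 hε hdr
  have hdr0 : 0 < dr := by
    rcases Nat.eq_zero_or_pos dr with h | h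
    · rw [h] at h12; norm_num at h12
    · exact h
  have hd : (0 : ℝ) < dr := by exact_mod_cast hdr0
  have hk : (0 : ℝ) < fr := by exact_mod_cast hfr
  have hf := measurable_sampleVal_index (G := G) (c := c) (ε := ε) H u v
  have h := measureReal_sum_le_sub (s := Finset.range fr ×ˢ Finset.range dr)
    (iIndepFun_samples hf) (fun p => hf.comp (measurable_sampleDraws p))
    (fun p ω => sampleVal_index_nonneg H u v hc1 hε _)
    (fun p ω => sampleVal_index_le H u v hc1 hε _) (fun p => integral_samples hf p)
    (W := A / (1 - Real.sqrt c))
    (fun p => (integral_samples (hf.pow_const 2) p).trans_le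
      ((integral_sampleVal_index_sq H v hc0 hc1 hε u).trans (by gcongr)))
    (by positivity) (by simp [hdr0.ne', hfr.ne'])
    (T := (fr * dr) * (Real.sqrt (0.16 * A) * ε)) (by positivity)
  rw [Finset.card_product, Finset.card_range, Finset.card_range, Nat.cast_mul] at h
  refine h.trans (Real.exp_le_exp.2 ?_)
  rw [neg_le_neg_iff, mul_pow, mul_pow (Real.sqrt _) ε, Real.sq_sqrt (by positivity),
    le_div_iff₀ (by positivity)]
  have hq1 : 1 - Real.sqrt c ≤ 1 := by linarith [Real.sqrt_nonneg c]
  calc 0.96 * fr * (2 * (fr * dr * (A / (1 - Real.sqrt c)))) =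
        12 * (0.16 * A * fr ^ 2 * dr * (1 - Real.sqrt c)) / (1 - Real.sqrt c) ^ 2 := by
        field_simp; ring
    _ ≤ dr * ((1 - Real.sqrt c) ^ 2 * ε ^ 2) * (0.16 * A * fr ^ 2 * dr * 1) /
          (1 - Real.sqrt c) ^ 2 := by gcongr
    _ = _ := by field_simp

/-- The index part is rarely far too large. -/
theorem measureReal_index_high (hc1 : c < 1) (hε : 0 < ε)
    (hdr : c₁ c / ε ^ 2 ≤ dr) (hfr : 0 < fr) :
    (randLaw (Draw V)).real {ω |
      (fr * dr) * ∫ ρ, sampleVal G c u (indexGain G c ε H v) ρ ∂(randLaw (SampleDraw V)) +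
          (fr * dr) * (0.22 * ε) ≤ ∑ p ∈ Finset.range fr ×ˢ Finset.range dr,
        sampleVal G c u (indexGain G c ε H v) (sampleDraws ω p)} ≤ Real.exp (-(1.1616 * fr)) := by
  have hq : 0 < 1 - Real.sqrt c := by linarith [sqrt_lt_one hc1]
  have h12 := twelve_le_of_c₁_le hc1 hε hdr
  have hdr0 : 0 < dr := by
    rcases Nat.eq_zero_or_pos dr with h | h
    · rw [h] at h12; norm_num at h12
    · exact h
  have hd : (0 : ℝ) < dr := by exact_mod_cast hdr0
  have hk : (0 : ℝ) < fr := by exact_mod_cast hfr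
  have hf := measurable_sampleVal_index (G := G) (c := c) (ε := ε) H u v
  have h := measureReal_add_le_sum (s := Finset.range fr ×ˢ Finset.range dr)
    (iIndepFun_samples hf) (fun p => hf.comp (measurable_sampleDraws p))
    (fun p ω => sampleVal_index_nonneg H u v hc1 hε _)
    (fun p ω => sampleVal_index_le H u v hc1 hε _) (fun p => integral_samples hf p)
    (T := (fr * dr) * (0.22 * ε)) (by positivity)
  rw [Finset.card_product, Finset.card_range, Finset.card_range, Nat.cast_mul] at h
  refine h.trans (Real.exp_le_exp.2 ?_)
  -- The constant is 1.1616 = 2 · 0.22² · 12.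
  rw [neg_le_neg_iff, le_div_iff₀ (by positivity)]
  calc 1.1616 * fr * (fr * dr * (1 / (1 - Real.sqrt c)) ^ 2) =
        12 * (2 * 0.22 ^ 2 * fr ^ 2 * dr) / (1 - Real.sqrt c) ^ 2 := by
        rw [div_pow, one_pow]; ring
    _ ≤ dr * ((1 - Real.sqrt c) ^ 2 * ε ^ 2) * (2 * 0.22 ^ 2 * fr ^ 2 * dr) /
          (1 - Real.sqrt c) ^ 2 := by gcongr
    _ = _ := by field_simp

/-- With at least three rounds, a large error at `v` is unlikely. -/
theorem measureReal_error_of_three_le (hc0 : 0 < c) (hc1 : c < 1) (hε : 0 < ε)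
    (hs : IsSimRank G c s) (hdr : c₁ c / ε ^ 2 ≤ dr) (hfr : 3 ≤ fr) :
    (randLaw (Draw V)).real {ω | ¬ |answer G c ε H u dr fr ω v - s u v| ≤ ε} ≤
      Real.exp (-(fr / 3 : ℝ)) := by
  classical
  have h12 := twelve_le_of_c₁_le hc1 hε hdr
  have hdr0 : 0 < dr := by
    rcases Nat.eq_zero_or_pos dr with h | h
    · rw [h] at h12; norm_num at h12
    · exact h
  have hd : (0 : ℝ) < dr := by exact_mod_cast hdr0
  have hk : (0 : ℝ) < fr := by exact_mod_cast (by omega : 0 < fr)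
  have hB0 := simBack_nonneg (G := G) hc1 H u v
  have hA0 := simIndex_nonneg (G := G) hc1 H u v
  have hAB := simBack_add_simIndex_le_one (G := G) H u v hc0 hc1
  have hssum := hs.eq_simBack_add hc0 hc1 H u v
  have hmZ1 := integral_sampleVal_index_le (G := G) H v hc0 hc1 hε u
  have hmZ2 := le_integral_sampleVal_index (G := G) H v hc0 hc1 hε u
  set sB := simBack G c H u v
  set sI := simIndex G c H u v
  set mZ := ∫ ρ, sampleVal G c u (indexGain G c ε H v) ρ ∂(randLaw (SampleDraw V))
  -- The shift 1/500 keeps the second-moment bounds positive when s_B or s_I vanishes; two shifts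
  -- make up the 1.004 in `sqrt_add_sqrt_le`.
  set t := Real.sqrt (0.4 * (sB + 1 / 500)) with ht
  set x := Real.sqrt (0.16 * (sI + 1 / 500)) with hx
  have htx : t + x ≤ 3 / 4 :=
    sqrt_add_sqrt_le (by positivity) (by positivity) (by linarith)
  set Y := sampleVal G c u (backGain G c H v)
  set Z := sampleVal G c u (indexGain G c ε H v)
  set R : ℕ → (Draw V → I) → ℝ := fun i ω => ∑ j ∈ Finset.range dr, Y (sampleDraws ω (i, j))
  have hR : iIndepFun R (randLaw (Draw V)) :=
    iIndepFun_rounds (measurable_sampleVal_back H u v) dr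
  set E1 : Set (Draw V → I) := {ω | (fr + 1) / 2 ≤ ((Finset.range fr).filter fun i =>
    R i ω ∈ Set.Iic (dr * sB - dr * (t * ε))).card} with hE1
  set E2 : Set (Draw V → I) := {ω | (fr + 1) / 2 ≤ ((Finset.range fr).filter fun i =>
    R i ω ∈ Set.Ici (dr * sB + dr * (0.78 * ε))).card} with hE2
  set E3 : Set (Draw V → I) := {ω | ∑ p ∈ Finset.range fr ×ˢ Finset.range dr,
    Z (sampleDraws ω p) ≤ (fr * dr) * mZ - (fr * dr) * (x * ε)} with hE3
  set E4 : Set (Draw V → I) := {ω | (fr * dr) * mZ + (fr * dr) * (0.22 * ε) ≤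
    ∑ p ∈ Finset.range fr ×ˢ Finset.range dr, Z (sampleDraws ω p)} with hE4
  have b1 : (randLaw (Draw V)).real E1 ≤ 0.605 ^ fr / 2 :=
    measureReal_majority_le hR measurableSet_Iic (by norm_num) (by norm_num)
      (fun i => measureReal_round_low H u v hc0 hc1 hε hdr i (by positivity) (by linarith))
      (by omega)
  have b2 : (randLaw (Draw V)).real E2 ≤ 0.6944 ^ fr / 2 :=
    measureReal_majority_le hR measurableSet_Ici (by norm_num) (by norm_num)
      (fun i => measureReal_round_high H u v hc0 hc1 hε hdr i) (by omega)
  have b3 : (randLaw (Draw V)).real E3 ≤ Real.exp (-(0.96 * fr)) :=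
    measureReal_index_low H u v hc0 hc1 hε hdr (by omega) (by positivity) (by linarith)
  have b4 : (randLaw (Draw V)).real E4 ≤ Real.exp (-(1.1616 * fr)) :=
    measureReal_index_high H u v hc1 hε hdr (by omega)
  have hsub : {ω | ¬ |answer G c ε H u dr fr ω v - s u v| ≤ ε} ⊆ E1 ∪ E2 ∪ E3 ∪ E4 := by
    intro ω hω
    by_contra hnot
    simp only [Set.mem_union, not_or] at hnot
    obtain ⟨⟨⟨n1, n2⟩, n3⟩, n4⟩ := hnot
    refine hω ?_
    have hround : ∀ i, roundEst G c H u dr ω v i = R i ω / dr := roundEst_eq H u v dr ω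
    have m1 : sB - t * ε < median fr (roundEst G c H u dr ω v) := by
      by_contra hle
      refine n1 ((le_card_of_median_le (by omega) (not_lt.1 hle)).trans (Finset.card_le_card ?_))
      refine Finset.monotone_filter_right _ fun i _ hi => ?_
      rw [hround, div_le_iff₀ hd] at hi
      rw [Set.mem_Iic]
      linarith
    have m2 : median fr (roundEst G c H u dr ω v) < sB + 0.78 * ε := by
      by_contra hle
      refine n2 ((le_card_of_le_median (by omega) (not_lt.1 hle)).trans (Finset.card_le_card ?_))
      refine Finset.monotone_filter_right _ fun i _ hi => ?_
      rw [hround, le_div_iff₀ hd] at hi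
      rw [Set.mem_Ici]
      linarith
    simp only [hE3, hE4, Set.mem_ofPred_eq, not_le, Finset.sum_product] at n3 n4
    obtain ⟨i1, i2⟩ := indexEst_bounds (G := G) hc1 hε H u v dr fr ω
    have hn : (0 : ℝ) < dr * fr := by positivity
    have m3 : mZ - x * ε < (∑ i ∈ Finset.range fr, ∑ j ∈ Finset.range dr,
        Z (sampleDraws ω (i, j))) / (dr * fr) := by
      rw [lt_div_iff₀ hn]; linarith
    have m4 : (∑ i ∈ Finset.range fr, ∑ j ∈ Finset.range dr,
        Z (sampleDraws ω (i, j))) / (dr * fr) < mZ + 0.22 * ε := by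
      rw [div_lt_iff₀ hn]; linarith
    have h34 := mul_le_mul_of_nonneg_right htx hε.le
    rw [answer, abs_le]
    -- Downwards: t + x ≤ 3/4, plus bias 1/6 + 1/12 = 1/4. Upwards: 0.78 + 0.22 = 1, and the index
    -- bias has the favourable sign.
    constructor <;> linarith
  calc _ ≤ (randLaw (Draw V)).real (E1 ∪ E2 ∪ E3 ∪ E4) := measureReal_mono hsub
    _ ≤ (randLaw (Draw V)).real E1 + (randLaw (Draw V)).real E2 + (randLaw (Draw V)).real E3 +
        (randLaw (Draw V)).real E4 :=
      (measureReal_union_le _ _).trans (add_le_add_left ((measureReal_union_le _ _).trans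
        (add_le_add_left (measureReal_union_le _ _) _)) _)
    _ ≤ _ := (by linarith : _ ≤ _).trans (four_terms_le hfr)

/-- With at most two rounds, a large error at `v` is unlikely. -/
theorem measureReal_error_of_le_two (hc0 : 0 < c) (hc1 : c < 1) (hε : 0 < ε)
    (hs : IsSimRank G c s) (hdr : c₁ c / ε ^ 2 ≤ dr) (hfr : 0 < fr) (hfr2 : fr ≤ 2) :
    (randLaw (Draw V)).real {ω | ¬ |answer G c ε H u dr fr ω v - s u v| ≤ ε} ≤
      Real.exp (-(fr / 3 : ℝ)) := by
  have hq : 0 < 1 - Real.sqrt c := by linarith [sqrt_lt_one hc1]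
  have hq1 : 1 - Real.sqrt c ≤ 1 := by linarith [Real.sqrt_nonneg c]
  have h12 := twelve_le_of_c₁_le hc1 hε hdr
  have hdr0 : 0 < dr := by
    rcases Nat.eq_zero_or_pos dr with h | h
    · rw [h] at h12; norm_num at h12
    · exact h
  have hd : (0 : ℝ) < dr := by exact_mod_cast hdr0
  have hk : (0 : ℝ) < fr := by exact_mod_cast hfr
  have hk1 : (1 : ℝ) ≤ fr := by exact_mod_cast hfr
  have hA0 := simIndex_nonneg (G := G) hc1 H u v
  have hAB := simBack_add_simIndex_le_one (G := G) H u v hc0 hc1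
  have hssum := hs.eq_simBack_add hc0 hc1 H u v
  have hmZ1 := integral_sampleVal_index_le (G := G) H v hc0 hc1 hε u
  have hmZ2 := le_integral_sampleVal_index (G := G) H v hc0 hc1 hε u
  have hmY := integral_sampleVal_back (G := G) H v hc0 hc1 u
  have hY2 := integral_sampleVal_back_sq (G := G) H v hc0 hc1 u
  have hZ2 := integral_sampleVal_index_sq (G := G) H v hc0 hc1 hε u
  have hYm := measurable_sampleVal_back (G := G) (c := c) H u v
  have hZm := measurable_sampleVal_index (G := G) (c := c) (ε := ε) H u v
  have hYn := sampleVal_back_nonneg (G := G) H u v hc1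
  have hZn := sampleVal_index_nonneg (G := G) H u v hc1 hε
  have hYC := sampleVal_back_le (G := G) H u v hc1
  have hZC := sampleVal_index_le (G := G) H u v hc1 hε
  have hYZ := sampleVal_back_mul_index (G := G) (c := c) (ε := ε) H v u
  set sB := simBack G c H u v
  set sI := simIndex G c H u v
  set mZ := ∫ ρ, sampleVal G c u (indexGain G c ε H v) ρ ∂(randLaw (SampleDraw V))
  set Y := sampleVal G c u (backGain G c H v) with hY
  set Z := sampleVal G c u (indexGain G c ε H v) with hZ
  have hi : ∀ {f : (SampleDraw V → I) → ℝ} {C : ℝ}, Measurable f → (∀ ρ, 0 ≤ f ρ) →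
      (∀ ρ, f ρ ≤ C) → Integrable f (randLaw (SampleDraw V)) := fun hf h0 hC =>
    .of_bound hf.aestronglyMeasurable _ (.of_forall fun ρ => by
      rw [Real.norm_of_nonneg (h0 ρ)]; exact hC ρ)
  have hi2 : ∀ {f : (SampleDraw V → I) → ℝ} {C : ℝ}, Measurable f → (∀ ρ, 0 ≤ f ρ) →
      (∀ ρ, f ρ ≤ C) → Integrable (fun ρ => f ρ ^ 2) (randLaw (SampleDraw V)) := fun hf h0 hC =>
    hi (hf.pow_const 2) (fun ρ => sq_nonneg _) fun ρ => pow_le_pow_left₀ (h0 ρ) (hC ρ) 2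
  have hf : Measurable fun ρ => Y ρ + Z ρ := hYm.add hZm
  have hmean : ∫ ρ, (Y ρ + Z ρ) ∂(randLaw (SampleDraw V)) = sB + mZ := by
    rw [integral_add (hi hYm hYn hYC) (hi hZm hZn hZC), hmY]
  -- No sample feeds both parts, so YZ = 0 and the second moments add up, with s_B + s_I ≤ 1.
  have hsq : ∫ ρ, (Y ρ + Z ρ) ^ 2 ∂(randLaw (SampleDraw V)) ≤ 1 / (1 - Real.sqrt c) ^ 2 := by
    have : ∀ ρ, (Y ρ + Z ρ) ^ 2 = Y ρ ^ 2 + Z ρ ^ 2 := fun ρ => by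
      linear_combination 2 * hYZ ρ
    simp_rw [this]
    rw [integral_add (hi2 hYm hYn hYC) (hi2 hZm hZn hZC)]
    calc _ ≤ sB / (1 - Real.sqrt c) ^ 2 + sI / (1 - Real.sqrt c) ^ 2 := by
          refine add_le_add hY2 (hZ2.trans ?_)
          gcongr
          nlinarith
      _ ≤ _ := by rw [← add_div]; gcongr
  have h := measureReal_le_abs_sum_sub (s := Finset.range fr ×ˢ Finset.range dr)
    (iIndepFun_samples hf) (fun p => hf.comp (measurable_sampleDraws p))
    (fun p ω => add_nonneg (hYn _) (hZn _)) (fun p ω => add_le_add (hYC _) (hZC _))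
    (fun p => (integral_samples hf p).trans hmean)
    (fun p => (integral_samples (hf.pow_const 2) p).trans_le hsq)
    (T := (fr * dr) * (3 / 4 * ε)) (by positivity)
  rw [Finset.card_product, Finset.card_range, Finset.card_range, Nat.cast_mul] at h
  refine (measureReal_mono fun ω hω => ?_).trans (h.trans ?_)
  · by_contra hlt
    refine hω ?_
    rw [Set.mem_ofPred_eq, not_le] at hlt
    obtain ⟨i1, i2⟩ := indexEst_bounds (G := G) hc1 hε H u v dr fr ω
    have hmed : median fr (roundEst G c H u dr ω v) =
        (∑ i ∈ Finset.range fr, ∑ j ∈ Finset.range dr, Y (sampleDraws ω (i, j))) / (dr * fr) := by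
      rw [median_eq_mean hfr hfr2]
      simp_rw [roundEst_eq]
      rw [← Finset.sum_div, div_div]
    have hn : (0 : ℝ) < dr * fr := by positivity
    simp only [Finset.sum_product, Finset.sum_add_distrib] at hlt
    rw [← hZ] at i1 i2
    set SY := ∑ i ∈ Finset.range fr, ∑ j ∈ Finset.range dr, Y (sampleDraws ω (i, j))
    set SZ := ∑ i ∈ Finset.range fr, ∑ j ∈ Finset.range dr, Z (sampleDraws ω (i, j))
    obtain ⟨l1, l2⟩ := abs_lt.1 hlt
    have e1 : sB + mZ - 3 / 4 * ε < SY / (dr * fr) + SZ / (dr * fr) := by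
      rw [← add_div, lt_div_iff₀ hn]; linarith
    have e2 : SY / (dr * fr) + SZ / (dr * fr) < sB + mZ + 3 / 4 * ε := by
      rw [← add_div, div_lt_iff₀ hn]; linarith
    rw [answer, hmed, abs_le]
    constructor <;> linarith
  · refine le_trans ?_ (pow_le_exp_neg_third fr)
    have h1 : (0.7165 : ℝ) ^ 2 ≤ 0.7165 ^ fr :=
      pow_le_pow_of_le_one (by norm_num) (by norm_num) hfr2
    refine le_trans ?_ h1
    rw [div_le_iff₀ (by positivity)]
    calc fr * dr * (1 / (1 - Real.sqrt c) ^ 2) ≤ fr * dr * (fr / (1 - Real.sqrt c) ^ 2) := by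
          gcongr
      _ = 12 * (fr ^ 2 * dr / (1 - Real.sqrt c) ^ 2) / 12 := by ring
      _ ≤ dr * ((1 - Real.sqrt c) ^ 2 * ε ^ 2) * (fr ^ 2 * dr / (1 - Real.sqrt c) ^ 2) / 12 := by
          gcongr
      _ = (fr * dr * ε) ^ 2 / 12 := by field_simp
      _ ≤ _ := by nlinarith [sq_nonneg (fr * dr * ε)]

theorem measureReal_error (hc0 : 0 < c) (hc1 : c < 1) (hε : 0 < ε)
    (hs : IsSimRank G c s) (hdr : c₁ c / ε ^ 2 ≤ dr) (hfr : 0 < fr) :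
    (randLaw (Draw V)).real {ω | ¬ |answer G c ε H u dr fr ω v - s u v| ≤ ε} ≤
      Real.exp (-(fr / 3 : ℝ)) := by
  rcases le_or_gt fr 2 with h | h
  · exact measureReal_error_of_le_two H u v hc0 hc1 hε hs hdr hfr h
  · exact measureReal_error_of_three_le H u v hc0 hc1 hε hs hdr h

end Error

end PRSim

theorem mainTheorem1 {V : Type*} [Fintype V] (G : Digraph V)
    (c : ℝ) (hc0 : 0 < c) (hc1 : c < 1)
    (s : V → V → ℝ) (hs : PRSim.IsSimRank G c s)
    (j₀ : ℕ) (H : Finset V) (hH : PRSim.IsHubSet G c j₀ H)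
    (ε : ℝ) (hε : 0 < ε) (δ : ℝ) (hδ0 : 0 < δ) (hδ1 : δ < 1)
    (dr fr : ℕ) (hdr : PRSim.c₁ c / ε ^ 2 ≤ (dr : ℝ))
    (hfr : 3 * Real.log ((Fintype.card V : ℝ) / δ) ≤ (fr : ℝ))
    (u : V) :
    1 - δ ≤ (PRSim.randLaw (PRSim.Draw V)).real
      {ω | ∀ v : V, |PRSim.answer G c ε H u dr fr ω v - s u v| ≤ ε} := by
  have hn : (1 : ℝ) ≤ Fintype.card V := by exact_mod_cast Fintype.card_pos_iff.2 ⟨u⟩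
  have hn0 : (0 : ℝ) < Fintype.card V / δ := by positivity
  have hlog : 0 < Real.log (Fintype.card V / δ) :=
    Real.log_pos (by rw [lt_div_iff₀ hδ0]; linarith)
  -- At least one round exists because n ≥ 1 > δ makes the logarithm positive; the median of no
  -- values would be a default value.
  have hfr0 : 0 < fr := by
    have : (0 : ℝ) < fr := by linarith
    exact_mod_cast this
  set S := {ω | ∀ v : V, |PRSim.answer G c ε H u dr fr ω v - s u v| ≤ ε}
  have hcompl : (PRSim.randLaw (PRSim.Draw V)).real Sᶜ ≤ δ := by
    have hsub : Sᶜ ⊆ ⋃ v ∈ (Finset.univ : Finset V),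
        {ω | ¬ |PRSim.answer G c ε H u dr fr ω v - s u v| ≤ ε} := by
      intro ω hω
      simp only [S, Set.mem_compl_iff, Set.mem_ofPred_eq, not_forall] at hω
      simpa using hω
    calc _ ≤ (PRSim.randLaw (PRSim.Draw V)).real (⋃ v ∈ (Finset.univ : Finset V),
          {ω | ¬ |PRSim.answer G c ε H u dr fr ω v - s u v| ≤ ε}) :=
          measureReal_mono hsub (measure_ne_top _ _)
      _ ≤ ∑ v : V, (PRSim.randLaw (PRSim.Draw V)).real
          {ω | ¬ |PRSim.answer G c ε H u dr fr ω v - s u v| ≤ ε} :=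
          measureReal_biUnion_finset_le _ _
      _ ≤ ∑ _v : V, Real.exp (-(fr / 3 : ℝ)) := Finset.sum_le_sum fun v _ =>
          PRSim.measureReal_error H u v hc0 hc1 hε hs hdr hfr0
      _ ≤ ∑ _v : V, δ / Fintype.card V := by
          refine Finset.sum_le_sum fun v _ => ?_
          calc Real.exp (-(fr / 3 : ℝ)) ≤ Real.exp (-Real.log (Fintype.card V / δ)) :=
                Real.exp_le_exp.2 (by linarith)
            _ = δ / Fintype.card V := by rw [Real.exp_neg, Real.exp_log hn0, inv_div]
      _ = δ := by
          rw [Finset.sum_const, nsmul_eq_mul, Finset.card_univ]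
          field_simp
  -- Subadditivity suffices here, so measurability of the success event is not needed.
  have huniv : 1 ≤ (PRSim.randLaw (PRSim.Draw V)).real S +
      (PRSim.randLaw (PRSim.Draw V)).real Sᶜ := by
    have := measureReal_union_le (μ := PRSim.randLaw (PRSim.Draw V)) S Sᶜ
    rwa [Set.union_compl_self, probReal_univ] at this
  linarith
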